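/- **Conventions.** For a metric space $X$, $B(z,s)$ denotes the open ball. Given $r>0$ and a continuous function $\varrho:[0,r)\to[0,\infty)$ with $\varrho(0)=0$ and $\varrho(s)\ge s$ for all $s\in[0,r)$, we say that $\varrho$ is a *local geometric contractibility function* for $X$ if for every $z\in X$ and every $s\in(0,r)$ the ball $B(z,s)$ is contractible in $B(z,\varrho(s))$, i.e. the inclusion $B(z,s)\hookrightarrow B(z,\varrho(s))$ is homotopic to a constant map. $\mathscr H^m$ denotes the $m$-dimensional Hausdorff measure, normalized so that a set of diameter $d$ contributes $\omega_m(d/2)^m$ to a covering sum, where $\omega_m$ is the Lebesgue measure of the unit ball of $\mathbb R^m$. An $\mathscr H^m$-measurable subset $A$ of a metric space $Z$ is *countably $\mathscr H^m$-rectifiable* if there are countably many Lipschitz maps $f_i:B_i\to Z$ from subsets $B_i\subset\mathbb R^m$ with $\mathscr H^m\big(A\setminus\bigcup_i f_i(B_i)\big)=0$. **Theorem.** For every integer $m\ge 2$ and every $\alpha\in(0,1)$ there exist $C,r>0$ and a sequence of smooth Riemannian metrics $g_n$ on the $m$-sphere $S^m$ such that the Riemannian manifolds $M_n:=(S^m,g_n)$,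 with their Riemannian distances, satisfy $$\sup_n\big[\operatorname{Vol}(M_n)+\operatorname{diam}M_n\big]<\infty,$$ the function $\varrho(s):=Cs^\alpha$, $s\in[0,r)$, is a local geometric contractibility function for every $M_n$, and $M_n$ converges in the Gromov–Hausdorff sense to a compact metric space $X$, homeomorphic to $S^m$, which satisfies $0<\mathscr H^m(X)<\infty$ but which is not countably $\mathscr H^m$-rectifiable. -/

import Mathlib

open Set MeasureTheory Measure Filter Topology Bundle Manifold
open scoped ENNReal NNReal ContDiff

/-- Smooth (`C^∞`) Riemannian metrics on an `m`-dimensional manifold `M` without boundary. -/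
abbrev SmoothMetric (m : ℕ) (M : Type) [TopologicalSpace M]
    [ChartedSpace (EuclideanSpace ℝ (Fin m)) M] [IsManifold (𝓡 m) ∞ M] : Type :=
  ContMDiffRiemannianMetric (𝓡 m) ∞ (EuclideanSpace ℝ (Fin m))
    (fun x : M => TangentSpace (𝓡 m) x)

section Riemannian

variable {m : ℕ} {M : Type} [TopologicalSpace M]
  [ChartedSpace (EuclideanSpace ℝ (Fin m)) M] [IsManifold (𝓡 m) ∞ M]

/-- The extended Riemannian distance of `g`: the infimum of the `g`-lengths of `C^1` paths. -/
noncomputable def SmoothMetric.edist (g : SmoothMetric m M) (x y : M) : ℝ≥0∞ :=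
  letI : RiemannianBundle (fun x : M => TangentSpace (𝓡 m) x) := ⟨g.toRiemannianMetric⟩
  riemannianEDist (𝓡 m) x y

/-- The extended metric structure with distance `SmoothMetric.edist`; its topology is
definitionally the given one. -/
@[reducible] noncomputable def SmoothMetric.toEMetricSpace [T3Space M] (g : SmoothMetric m M) :
    EMetricSpace M :=
  letI : RiemannianBundle (fun x : M => TangentSpace (𝓡 m) x) := ⟨g.toRiemannianMetric⟩
  haveI : IsContinuousRiemannianBundle (EuclideanSpace ℝ (Fin m))
      (fun x : M => TangentSpace (𝓡 m) x) :=
    ⟨⟨g.inner, g.contMDiff.continuous, fun _ _ _ => rfl⟩⟩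
  EMetricSpace.ofRiemannianMetric (𝓡 m) M

theorem SmoothMetric.toEMetricSpace_edist [T3Space M] (g : SmoothMetric m M) (x y : M) :
    g.toEMetricSpace.edist x y = g.edist x y := rfl

/-- On a connected manifold the Riemannian distance is finite. -/
theorem SmoothMetric.edist_ne_top [T3Space M] [ConnectedSpace M] (g : SmoothMetric m M)
    (x y : M) : g.edist x y ≠ ⊤ := by
  let hE : EMetricSpace M := g.toEMetricSpace
  have hclopen : IsClopen (Metric.eball x (⊤ : ℝ≥0∞)) :=
    ⟨Metric.isClosed_eball_top, Metric.isOpen_eball⟩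
  have huniv := hclopen.eq_univ ⟨x, Metric.mem_eball_self (by simp)⟩
  have hy : y ∈ Metric.eball x (⊤ : ℝ≥0∞) := by rw [huniv]; trivial
  have h2 : hE.edist x y < ⊤ := Metric.mem_eball'.1 hy
  exact ne_of_lt h2

/-- The metric space `(M, g)`: the manifold `M` with the Riemannian distance of `g`. -/
def SmoothMetric.Space (_g : SmoothMetric m M) : Type := M

noncomputable instance [T3Space M] [ConnectedSpace M] (g : SmoothMetric m M) :
    MetricSpace g.Space :=
  letI : EMetricSpace M := g.toEMetricSpace
  EMetricSpace.toMetricSpace (α := M) g.edist_ne_top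

instance [T3Space M] [ConnectedSpace M] [CompactSpace M] (g : SmoothMetric m M) :
    CompactSpace g.Space :=
  inferInstanceAs (CompactSpace M)

instance [Nonempty M] (g : SmoothMetric m M) : Nonempty g.Space :=
  inferInstanceAs (Nonempty M)

/-- The Gram matrix `g(∂ᵢ, ∂ⱼ)` of the coordinate vector fields of the chart `chartAt c`, at the
point with coordinates `y`. -/
noncomputable def SmoothMetric.gram (g : SmoothMetric m M) (c : M)
    (y : EuclideanSpace ℝ (Fin m)) : Matrix (Fin m) (Fin m) ℝ :=
  let φ := chartAt (EuclideanSpace ℝ (Fin m)) c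
  Matrix.of fun i j =>
    g.inner (φ.symm y)
      (mfderiv (𝓡 m) (𝓡 m) φ.symm y (EuclideanSpace.single i (1 : ℝ)))
      (mfderiv (𝓡 m) (𝓡 m) φ.symm y (EuclideanSpace.single j (1 : ℝ)))

/-- The Riemannian volume measure of `g` on the domain of `chartAt c`:
`√(det g(∂ᵢ, ∂ⱼ)) dy` in coordinates. -/
noncomputable def SmoothMetric.chartVolume [MeasurableSpace M] (g : SmoothMetric m M)
    (c : M) : Measure M :=
  ((volume.restrict (chartAt (EuclideanSpace ℝ (Fin m)) c).target).withDensity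
      fun y => ENNReal.ofReal √(g.gram c y).det).map
    (chartAt (EuclideanSpace ℝ (Fin m)) c).symm

/-- The Riemannian volume measure of `g` (on a second countable manifold): the least measure that
dominates the volume measures of all the charts `chartAt c`. As these agree on the overlaps, it
restricts to each of them. -/
noncomputable def SmoothMetric.volumeMeasure [MeasurableSpace M] (g : SmoothMetric m M) :
    Measure M :=
  ⨆ c : M, g.chartVolume c

end Riemannian

/-- `A` is contractible in `B`: the inclusion `A ⊆ B` is homotopic to a constant map. -/
def ContractibleIn {X : Type} [TopologicalSpace X] (A B : Set X) : Prop :=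
  ∃ h : A ⊆ B, (ContinuousMap.inclusion h).Nullhomotopic

/-- `ρ : [0, r) → [0, ∞)` is a local geometric contractibility function for `X`. -/
structure IsLocalContractibilityFunction (X : Type) [MetricSpace X] (r : ℝ) (ρ : ℝ → ℝ) :
    Prop where
  pos : 0 < r
  continuousOn : ContinuousOn ρ (Ico 0 r)
  map_zero : ρ 0 = 0
  le_self : ∀ s ∈ Ico 0 r, s ≤ ρ s
  contractible : ∀ z : X, ∀ s ∈ Ioo 0 r, ContractibleIn (Metric.ball z s) (Metric.ball z (ρ s))

/-- The `m`-dimensional Hausdorff measure, normalized by the factor `ω_m / 2 ^ m`, where `ω_m` is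
the Lebesgue measure of the unit ball of `ℝᵐ`. -/
noncomputable def normalizedHausdorff (m : ℕ) (Z : Type) [MetricSpace Z] [MeasurableSpace Z]
    [BorelSpace Z] : Measure Z :=
  (volume (Metric.ball (0 : EuclideanSpace ℝ (Fin m)) 1) / 2 ^ m) • μH[(m : ℝ)]

/-- `A` is countably `H^m`-rectifiable: it is `H^m`-measurable, and up to an `H^m`-null set it is
covered by the images of countably many Lipschitz maps from subsets of `ℝᵐ`. -/
def IsCountablyRectifiable (m : ℕ) {Z : Type} [MetricSpace Z] [MeasurableSpace Z]
    [BorelSpace Z] (A : Set Z) : Prop :=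
  (normalizedHausdorff m Z).toOuterMeasure.IsCaratheodory A ∧
  ∃ (B : ℕ → Set (EuclideanSpace ℝ (Fin m))) (f : ∀ i, B i → Z),
    (∀ i, ∃ K : ℝ≥0, LipschitzWith K (f i)) ∧
    normalizedHausdorff m Z (A \ ⋃ i, range (f i)) = 0

/-- The unit sphere `S^m` of `ℝ^(m+1)`. -/
abbrev UnitSphere (m : ℕ) : Type := Metric.sphere (0 : EuclideanSpace ℝ (Fin (m + 1))) 1

theorem connectedSpace_unitSphere {m : ℕ} (hm : 2 ≤ m) : ConnectedSpace (UnitSphere m) := by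
  rw [← isConnected_iff_connectedSpace]
  apply isConnected_sphere _ _ zero_le_one
  rw [← Module.finrank_eq_rank, finrank_euclideanSpace_fin]
  exact_mod_cast (by omega : 1 < m + 1)

instance (m : ℕ) : Nonempty (UnitSphere m) :=
  ⟨⟨EuclideanSpace.single 0 1, by simp⟩⟩

/-! The metrics are conformal to the round one. On a great circle arc sits a Cantor set, the
intersection of nested families of `num j` disjoint balls of Euclidean radius `rad j = a j / 64 ^
j`, each containing one or two balls of the next level. The conformal factor `factor n` is `64 ^ j`
on entering a ball of level `j ≤ n`. Crossing the shell of such a ball then costs about `a j`, and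
the ball has diameter comparable to `tail j = ∑_{i ≥ j} a i`, uniformly in `n`.

Upper bounds for distances (`d_push_pt_le`, `d_le`) come from paths that leave the arc in a normal
direction and so avoid the deeper balls. Lower bounds (`sum_le_d`) come from sums of bump functions
along a branch, whose gradients are dominated by the conformal factor. The distances increase with
`n` and are equicontinuous, so their supremum metrizes the sphere, and it is the Gromov–Hausdorff
limit.

For contractibility, a metric ball of radius `s` is enclosed in a round cap on which `1 / factor`
varies little. The cap has metric radius `O(s)`, or else it meets a ball of the first level `i` with
`a i` below a multiple of `s`, which adds `O(tail i)`. The condition `tail i ≤ K * a i ^ α` gives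
the radius `C * s ^ α`.

With `a j` of order `j ^ (-P-1)` and `tail j` of order `j ^ (-P)`, that condition holds once `α * (P
+ 1) ≤ P`. The gap between the two orders leaves room for `∑ num j * a j ^ m` to converge, which
bounds the volumes, while `num j * tail j ^ m` stays of order one along a sequence of levels, which
gives the Cantor set positive finite measure: it is covered by `num j` balls of diameter `O(tail
j)`, and conversely maps onto `[0, 1)` by an `m`-Hölder map (`hausdorffMeasure_cantor_pos`).

Non-rectifiability comes from clustering the branchings in level. The levels are cut into blocks `[2
^ k ^ 2, 2 ^ (k + 1) ^ 2)`, and all branchings of a block occur at its beginning. At the end of a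
block, distinct balls have diameter `O(tail)` but mutual distance at least a multiple of `M * tail`,
with `M → ∞`. By packing, a Lipschitz image of a bounded subset of `ℝᵐ` meets at most `O((M * tail)
^ (-m))` of them, so its trace on the Cantor set has measure `O(M ^ (-m)) → 0`. Thus the Cantor set
meets every Lipschitz image in a null set. -/

/-! ### Conformal metrics on the round sphere. -/

/-- The differential at `x` of the inclusion of the unit sphere in its ambient Euclidean space. -/
noncomputable def sphereIncl (m : ℕ) (x : UnitSphere m) :
    EuclideanSpace ℝ (Fin m) →L[ℝ] EuclideanSpace ℝ (Fin (m + 1)) :=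
  mfderiv (𝓡 m) 𝓘(ℝ, EuclideanSpace ℝ (Fin (m + 1)))
    ((↑) : UnitSphere m → EuclideanSpace ℝ (Fin (m + 1))) x

theorem contMDiff_coe_unitSphere (m : ℕ) {n : ℕ∞ω} :
    ContMDiff (𝓡 m) 𝓘(ℝ, EuclideanSpace ℝ (Fin (m + 1))) n
      ((↑) : UnitSphere m → EuclideanSpace ℝ (Fin (m + 1))) :=
  haveI := Fact.mk (@finrank_euclideanSpace_fin ℝ _ (m + 1))
  contMDiff_coe_sphere

theorem sphereIncl_injective (m : ℕ) (x : UnitSphere m) :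
    Function.Injective (sphereIncl m x) :=
  haveI := Fact.mk (@finrank_euclideanSpace_fin ℝ _ (m + 1))
  injective_mvfderiv_subtypeVal_sphere (n := m) x

theorem exists_norm_le_sphereIncl (m : ℕ) (x : UnitSphere m) :
    ∃ K : ℝ, 0 < K ∧ ∀ v, ‖v‖ ≤ K * ‖sphereIncl m x v‖ := by
  obtain ⟨K, hK, h⟩ := (sphereIncl m x).toLinearMap.exists_antilipschitzWith
    (LinearMap.ker_eq_bot.2 (sphereIncl_injective m x))
  refine ⟨K, by exact_mod_cast hK, fun v => ?_⟩
  simpa [dist_eq_norm] using h.le_mul_dist v 0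

/-- The bilinear form `(v, w) ↦ ⟪A v, A w⟫` of a linear map `A`. -/
noncomputable def pullbackInner {V W : Type*} [NormedAddCommGroup V] [NormedSpace ℝ V]
    [NormedAddCommGroup W] [InnerProductSpace ℝ W] (A : V →L[ℝ] W) : V →L[ℝ] V →L[ℝ] ℝ :=
  ((ContinuousLinearMap.compL ℝ V W ℝ).flip A).comp ((innerSL ℝ).comp A)

theorem pullbackInner_apply {V W : Type*} [NormedAddCommGroup V] [NormedSpace ℝ V]
    [NormedAddCommGroup W] [InnerProductSpace ℝ W] (A : V →L[ℝ] W) (v w : V) :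
    pullbackInner A v w = inner ℝ (A v) (A w) := rfl

set_option synthInstance.maxHeartbeats 200000 in
theorem contDiff_pullbackInner {V W : Type*} [NormedAddCommGroup V] [NormedSpace ℝ V]
    [NormedAddCommGroup W] [InnerProductSpace ℝ W] :
    ContDiff ℝ ∞ (pullbackInner : (V →L[ℝ] W) → V →L[ℝ] V →L[ℝ] ℝ) := by
  exact (ContinuousLinearMap.compL ℝ V W ℝ).flip.contDiff.clm_comp
    (contDiff_const.clm_comp contDiff_id)

theorem isVonNBounded_pullbackInner (m : ℕ) (x : UnitSphere m) {r : ℝ} (hr : 0 < r) :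
    Bornology.IsVonNBounded ℝ {v : EuclideanSpace ℝ (Fin m) |
      pullbackInner (r • sphereIncl m x) v v < 1} := by
  obtain ⟨K, hK, h⟩ := exists_norm_le_sphereIncl m x
  refine (NormedSpace.isVonNBounded_ball ℝ (EuclideanSpace ℝ (Fin m)) (K / r + 1)).subset ?_
  intro v hv
  simp only [mem_ofPred_eq, pullbackInner_apply, real_inner_self_eq_norm_sq,
    _root_.smul_apply, norm_smul, Real.norm_eq_abs, abs_of_pos hr] at hv
  have h1 : r * ‖sphereIncl m x v‖ < 1 := by
    by_contra! hc
    nlinarith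
  have h2 : ‖sphereIncl m x v‖ < 1 / r := by rwa [lt_div_iff₀ hr, mul_comm]
  have h3 := mul_lt_mul_of_pos_left h2 hK
  rw [mem_ball_zero_iff]
  calc ‖v‖ ≤ _ := h v
    _ ≤ K * (1 / r) := h3.le
    _ < _ := by rw [mul_one_div]; linarith

/-- The bilinear form `ρ(x)² ⟪v, w⟫` on the tangent space of the unit sphere at `x`. -/
noncomputable def conformalInner (m : ℕ) (ρ : EuclideanSpace ℝ (Fin (m + 1)) → ℝ)
    (x : UnitSphere m) : TangentSpace (𝓡 m) x →L[ℝ] TangentSpace (𝓡 m) x →L[ℝ] ℝ :=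
  (pullbackInner (ρ x • sphereIncl m x) :
    EuclideanSpace ℝ (Fin m) →L[ℝ] EuclideanSpace ℝ (Fin m) →L[ℝ] ℝ)

theorem conformalInner_apply (m : ℕ) (ρ : EuclideanSpace ℝ (Fin (m + 1)) → ℝ)
    (x : UnitSphere m) (v w : TangentSpace (𝓡 m) x) :
    conformalInner m ρ x v w = inner ℝ (ρ x • sphereIncl m x v) (ρ x • sphereIncl m x w) := rfl

/-- The conformal metric `ρ² g` on the unit sphere, with `g` the round metric. -/
noncomputable def conformalMetric (m : ℕ) (ρ : EuclideanSpace ℝ (Fin (m + 1)) → ℝ)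
    (hρ : ContDiff ℝ ∞ ρ) (hpos : ∀ x, 0 < ρ x) : SmoothMetric m (UnitSphere m) where
  inner := conformalInner m ρ
  symm x v w := by
    rw [conformalInner_apply, conformalInner_apply, real_inner_comm]
  pos x v hv := by
    rw [conformalInner_apply]
    refine real_inner_self_pos.2 ?_
    have h1 : sphereIncl m x v ≠ 0 := fun h => hv (sphereIncl_injective m x (by rw [h]; exact
      (map_zero (sphereIncl m x)).symm))
    exact smul_ne_zero (hpos x).ne' h1
  isVonNBounded x := isVonNBounded_pullbackInner m x (hpos x)
  contMDiff := by
    intro x₀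
    rw [contMDiffAt_section]
    have h1 : ContMDiffAt (𝓡 m) 𝓘(ℝ, _) ∞ (inTangentCoordinates (𝓡 m)
        𝓘(ℝ, EuclideanSpace ℝ (Fin (m + 1))) id
        ((↑) : UnitSphere m → EuclideanSpace ℝ (Fin (m + 1))) (sphereIncl m) x₀) x₀ :=
      ((contMDiff_coe_unitSphere m (n := ω)).contMDiffAt).mfderiv_const le_top
    have h2 : ContMDiffAt (𝓡 m) 𝓘(ℝ, ℝ) ∞ (fun x : UnitSphere m => ρ x) x₀ :=
      (hρ.contMDiff.comp (contMDiff_coe_unitSphere m)).contMDiffAt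
    have h3 := (contDiff_pullbackInner (V := EuclideanSpace ℝ (Fin m))
      (W := EuclideanSpace ℝ (Fin (m + 1)))).contMDiff.contMDiffAt.comp x₀ (h2.smul h1)
    -- Read in the trivialization at `x₀`, the section is `pullbackInner` applied to a smooth family
    -- of linear maps. The identity holds only over the base set, which is a neighbourhood of `x₀`.
    refine h3.congr_of_eventuallyEq ?_
    filter_upwards [(trivializationAt (EuclideanSpace ℝ (Fin m))
      (fun x : UnitSphere m => TangentSpace (𝓡 m) x) x₀).open_baseSet.mem_nhds
      (mem_baseSet_trivializationAt _ _ x₀)] with x hx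
    ext v w
    rw [hom_trivializationAt_apply]
    refine (inCoordinates_apply_eq₂ hx hx (by simp)).trans ?_
    have hA : ∀ u, inTangentCoordinates (𝓡 m) 𝓘(ℝ, EuclideanSpace ℝ (Fin (m + 1))) id
        ((↑) : UnitSphere m → EuclideanSpace ℝ (Fin (m + 1))) (sphereIncl m) x₀ x u =
        sphereIncl m x ((trivializationAt (EuclideanSpace ℝ (Fin m))
          (fun x : UnitSphere m => TangentSpace (𝓡 m) x) x₀).symm x u) := by
      intro u
      have e1 : inTangentCoordinates (𝓡 m) 𝓘(ℝ, EuclideanSpace ℝ (Fin (m + 1))) id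
        ((↑) : UnitSphere m → EuclideanSpace ℝ (Fin (m + 1))) (sphereIncl m) x₀ x =
        ContinuousLinearMap.inCoordinates (EuclideanSpace ℝ (Fin m)) (TangentSpace (𝓡 m))
          (EuclideanSpace ℝ (Fin (m + 1)))
          (TangentSpace 𝓘(ℝ, EuclideanSpace ℝ (Fin (m + 1)))) x₀ x
          (x₀ : EuclideanSpace ℝ (Fin (m + 1))) (x : EuclideanSpace ℝ (Fin (m + 1)))
          (sphereIncl m x) := rfl
      have e2 := congrArg (fun L => L u) e1
      unfold ContinuousLinearMap.inCoordinates at e2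
      rw [TangentBundle.continuousLinearMapAt_model_space] at e2
      refine e2.trans ?_
      exact congrArg (sphereIncl m x) (Trivialization.symmL_apply _ hx u)
    change _ = inner ℝ (ρ x • inTangentCoordinates (𝓡 m) 𝓘(ℝ, EuclideanSpace ℝ (Fin (m + 1))) id
        ((↑) : UnitSphere m → EuclideanSpace ℝ (Fin (m + 1))) (sphereIncl m) x₀ x v)
      (ρ x • inTangentCoordinates (𝓡 m) 𝓘(ℝ, EuclideanSpace ℝ (Fin (m + 1))) id
        ((↑) : UnitSphere m → EuclideanSpace ℝ (Fin (m + 1))) (sphereIncl m) x₀ x w)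
    rw [hA, hA, ← conformalInner_apply]
    simp

/-! ### Distance estimates for conformal metrics. -/

section ConformalDistance

variable {m : ℕ} {ρ : EuclideanSpace ℝ (Fin (m + 1)) → ℝ} (hρ : ContDiff ℝ ∞ ρ)
  (hpos : ∀ x, 0 < ρ x)

theorem enorm_tangent_conformalMetric (x : UnitSphere m) (v : TangentSpace (𝓡 m) x) :
    letI : RiemannianBundle (fun x : UnitSphere m => TangentSpace (𝓡 m) x) :=
      ⟨(conformalMetric m ρ hρ hpos).toRiemannianMetric⟩
    ‖v‖ₑ = ENNReal.ofReal (ρ x) * ‖sphereIncl m x v‖ₑ := by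
  let _ : RiemannianBundle (fun x : UnitSphere m => TangentSpace (𝓡 m) x) :=
    ⟨(conformalMetric m ρ hρ hpos).toRiemannianMetric⟩
  have h1 : ‖v‖ = ρ x * ‖sphereIncl m x v‖ := by
    have h2 : inner ℝ v v = inner ℝ (ρ x • sphereIncl m x v) (ρ x • sphereIncl m x v) :=
      conformalInner_apply m ρ x v v
    rw [real_inner_self_eq_norm_sq, real_inner_self_eq_norm_sq, norm_smul, Real.norm_eq_abs,
      abs_of_pos (hpos x)] at h2
    exact (pow_left_inj₀ (norm_nonneg _) (by have := hpos x; positivity) two_ne_zero).1 h2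
  rw [← ofReal_norm, h1, ENNReal.ofReal_mul (hpos x).le, ofReal_norm]

theorem sphereIncl_mfderivWithin {γ : ℝ → UnitSphere m} {s : Set ℝ} {t : ℝ}
    (hγ : MDifferentiableWithinAt 𝓘(ℝ, ℝ) (𝓡 m) γ s t) (hs : UniqueDiffWithinAt ℝ s t) :
    sphereIncl m (γ t) (mfderivWithin 𝓘(ℝ, ℝ) (𝓡 m) γ s t 1) =
      derivWithin (fun u => (γ u : EuclideanSpace ℝ (Fin (m + 1)))) s t := by
  have h1 := mfderiv_comp_mfderivWithin (I := 𝓘(ℝ, ℝ)) (I' := 𝓡 m)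
    (I'' := 𝓘(ℝ, EuclideanSpace ℝ (Fin (m + 1)))) t
    ((contMDiff_coe_unitSphere m (n := 1)).mdifferentiable one_ne_zero (γ t)) hγ
    (uniqueMDiffWithinAt_iff_uniqueDiffWithinAt.2 hs)
  rw [mfderivWithin_eq_fderivWithin] at h1
  exact (DFunLike.congr_fun h1 (1 : ℝ)).symm

theorem pathELength_conformalMetric {γ : ℝ → UnitSphere m}
    (hγ : ContMDiffOn 𝓘(ℝ, ℝ) (𝓡 m) 1 γ (Icc 0 1)) :
    letI : RiemannianBundle (fun x : UnitSphere m => TangentSpace (𝓡 m) x) :=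
      ⟨(conformalMetric m ρ hρ hpos).toRiemannianMetric⟩
    pathELength (𝓡 m) γ 0 1 = ∫⁻ t in Icc (0 : ℝ) 1, ENNReal.ofReal (ρ (γ t)) *
      ‖derivWithin (fun u => (γ u : EuclideanSpace ℝ (Fin (m + 1)))) (Icc 0 1) t‖ₑ := by
  let _ : RiemannianBundle (fun x : UnitSphere m => TangentSpace (𝓡 m) x) :=
    ⟨(conformalMetric m ρ hρ hpos).toRiemannianMetric⟩
  rw [pathELength_eq_lintegral_mfderivWithin_Icc]
  refine setLIntegral_congr_fun measurableSet_Icc fun t ht => ?_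
  refine (enorm_tangent_conformalMetric hρ hpos (γ t) _).trans ?_
  rw [sphereIncl_mfderivWithin (hγ.mdifferentiableOn one_ne_zero t ht)
    (uniqueDiffOn_Icc zero_lt_one t ht)]

theorem conformal_edist_lt_iff {x y : UnitSphere m} {r : ℝ≥0∞}
    (h : (conformalMetric m ρ hρ hpos).edist x y < r) :
    ∃ γ : ℝ → UnitSphere m, γ 0 = x ∧ γ 1 = y ∧ ContMDiffOn 𝓘(ℝ, ℝ) (𝓡 m) 1 γ (Icc 0 1) ∧
      (∫⁻ t in Icc (0 : ℝ) 1, ENNReal.ofReal (ρ (γ t)) *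
      ‖derivWithin (fun u => (γ u : EuclideanSpace ℝ (Fin (m + 1)))) (Icc 0 1) t‖ₑ) < r := by
  let _ : RiemannianBundle (fun x : UnitSphere m => TangentSpace (𝓡 m) x) :=
    ⟨(conformalMetric m ρ hρ hpos).toRiemannianMetric⟩
  obtain ⟨γ, h0, h1, hγ, hl⟩ := exists_lt_of_riemannianEDist_lt h
  exact ⟨γ, h0, h1, hγ, by rwa [← pathELength_conformalMetric hρ hpos hγ]⟩

theorem conformal_edist_le {γ : ℝ → UnitSphere m}
    (hγ : ContMDiffOn 𝓘(ℝ, ℝ) (𝓡 m) 1 γ (Icc 0 1)) :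
    (conformalMetric m ρ hρ hpos).edist (γ 0) (γ 1) ≤
      ∫⁻ t in Icc (0 : ℝ) 1, ENNReal.ofReal (ρ (γ t)) *
      ‖derivWithin (fun u => (γ u : EuclideanSpace ℝ (Fin (m + 1)))) (Icc 0 1) t‖ₑ := by
  let _ : RiemannianBundle (fun x : UnitSphere m => TangentSpace (𝓡 m) x) :=
    ⟨(conformalMetric m ρ hρ hpos).toRiemannianMetric⟩
  rw [← pathELength_conformalMetric hρ hpos hγ]
  exact riemannianEDist_le_pathELength hγ rfl rfl zero_le_one

theorem conformal_edist_mono {ρ' : EuclideanSpace ℝ (Fin (m + 1)) → ℝ} (hρ' : ContDiff ℝ ∞ ρ')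
    (hpos' : ∀ x, 0 < ρ' x) (h : ∀ x, ρ x ≤ ρ' x) (x y : UnitSphere m) :
    (conformalMetric m ρ hρ hpos).edist x y ≤ (conformalMetric m ρ' hρ' hpos').edist x y := by
  refine le_of_forall_gt fun r hr => ?_
  obtain ⟨γ, rfl, rfl, hγ, hl⟩ := conformal_edist_lt_iff hρ' hpos' hr
  refine (conformal_edist_le hρ hpos hγ).trans_lt (lt_of_le_of_lt ?_ hl)
  gcongr
  exact h _

/-- A function whose gradient is bounded by the conformal factor is `1`-Lipschitz. -/
theorem ofReal_abs_sub_le_conformal_edist {f : EuclideanSpace ℝ (Fin (m + 1)) → ℝ}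
    (hf : ContDiff ℝ 1 f) (h : ∀ x, ‖fderiv ℝ f x‖ ≤ ρ x) (x y : UnitSphere m) :
    ENNReal.ofReal |f x - f y| ≤ (conformalMetric m ρ hρ hpos).edist x y := by
  refine le_of_forall_gt fun r hr => ?_
  obtain ⟨γ, rfl, rfl, hγ, hl⟩ := conformal_edist_lt_iff hρ hpos hr
  refine lt_of_le_of_lt ?_ hl
  have hc : ContDiffOn ℝ 1 (fun u => (γ u : EuclideanSpace ℝ (Fin (m + 1)))) (Icc 0 1) :=
    contMDiffOn_iff_contDiffOn.1 ((contMDiff_coe_unitSphere m).comp_contMDiffOn hγ)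
  have h1 := enorm_sub_le_lintegral_derivWithin_Icc_of_contDiffOn_Icc
    (hf.comp_contDiffOn hc) zero_le_one
  rw [abs_sub_comm, ← Real.enorm_eq_ofReal_abs]
  refine h1.trans (setLIntegral_mono' measurableSet_Icc fun t ht => ?_)
  have h2 : derivWithin (f ∘ fun u => (γ u : EuclideanSpace ℝ (Fin (m + 1)))) (Icc 0 1) t =
      fderiv ℝ f (γ t)
        (derivWithin (fun u => (γ u : EuclideanSpace ℝ (Fin (m + 1)))) (Icc 0 1) t) :=
    ((hf.differentiable one_ne_zero (γ t)).hasFDerivAt.comp_hasDerivWithinAt t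
      (hc.differentiableOn one_ne_zero t ht).hasDerivWithinAt).derivWithin
      (uniqueDiffOn_Icc zero_lt_one t ht)
  rw [h2]
  refine (ContinuousLinearMap.le_opENorm _ _).trans ?_
  gcongr
  rw [← ofReal_norm]
  exact ENNReal.ofReal_le_ofReal (h _)

end ConformalDistance

/-! ### Great circle arcs parametrized by chords. -/

/-- The radial projection of a nonzero vector to the unit sphere. -/
noncomputable def radial (m : ℕ) (v : EuclideanSpace ℝ (Fin (m + 1))) : UnitSphere m :=
  open Classical in
  if h : v = 0 then Classical.arbitrary _ else ⟨‖v‖⁻¹ • v, by simp [norm_smul, h]⟩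

theorem coe_radial {m : ℕ} {v : EuclideanSpace ℝ (Fin (m + 1))} (h : v ≠ 0) :
    (radial m v : EuclideanSpace ℝ (Fin (m + 1))) = ‖v‖⁻¹ • v := by
  simp [radial, h]

theorem norm_coe_unitSphere {m : ℕ} (x : UnitSphere m) :
    ‖(x : EuclideanSpace ℝ (Fin (m + 1)))‖ = 1 := by
  simp

theorem norm_chord_sq {m : ℕ} (x y : UnitSphere m) (t : ℝ) :
    ‖(x + t • (y - x) : EuclideanSpace ℝ (Fin (m + 1)))‖ ^ 2 =
      1 - t * (1 - t) * ‖(y - x : EuclideanSpace ℝ (Fin (m + 1)))‖ ^ 2 := by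
  have hx := norm_coe_unitSphere x
  have hy := norm_coe_unitSphere y
  have h1 := norm_sub_sq_real (y : EuclideanSpace ℝ (Fin (m + 1))) x
  rw [norm_add_sq_real, norm_smul, inner_smul_right, inner_sub_right, real_inner_self_eq_norm_sq,
    mul_pow, Real.norm_eq_abs, sq_abs, h1, hx, hy, real_inner_comm]
  ring

theorem three_quarters_le_norm_chord_sq {m : ℕ} {x y : UnitSphere m}
    (h : ‖(y - x : EuclideanSpace ℝ (Fin (m + 1)))‖ ≤ 1) (t : ℝ) :
    3 / 4 ≤ ‖(x + t • (y - x) : EuclideanSpace ℝ (Fin (m + 1)))‖ ^ 2 := by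
  rw [norm_chord_sq]
  have h1 : ‖(y - x : EuclideanSpace ℝ (Fin (m + 1)))‖ ^ 2 ≤ 1 := by
    nlinarith [norm_nonneg (y - x : EuclideanSpace ℝ (Fin (m + 1)))]
  nlinarith [sq_nonneg (t - 1 / 2), sq_nonneg ‖(y - x : EuclideanSpace ℝ (Fin (m + 1)))‖]

theorem chord_ne_zero {m : ℕ} {x y : UnitSphere m}
    (h : ‖(y - x : EuclideanSpace ℝ (Fin (m + 1)))‖ ≤ 1) (t : ℝ) :
    (x + t • (y - x) : EuclideanSpace ℝ (Fin (m + 1))) ≠ 0 := by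
  intro h0
  have := three_quarters_le_norm_chord_sq h t
  rw [h0] at this
  norm_num at this

/-- The great circle arc from `x` to `y`, parametrized by the chord. -/
noncomputable def arc {m : ℕ} (x y : UnitSphere m) (t : ℝ) : UnitSphere m :=
  radial m (x + t • (y - x))

theorem coe_arc {m : ℕ} {x y : UnitSphere m}
    (h : ‖(y - x : EuclideanSpace ℝ (Fin (m + 1)))‖ ≤ 1) (t : ℝ) :
    (arc x y t : EuclideanSpace ℝ (Fin (m + 1))) =
      ‖(x + t • (y - x) : EuclideanSpace ℝ (Fin (m + 1)))‖⁻¹ • (x + t • (y - x)) :=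
  coe_radial (chord_ne_zero h t)

theorem radial_coe {m : ℕ} (x : UnitSphere m) : radial m x = x := by
  have h : (x : EuclideanSpace ℝ (Fin (m + 1))) ≠ 0 := by
    intro h0
    have := norm_coe_unitSphere x
    rw [h0] at this
    simp at this
  ext1
  rw [coe_radial h, norm_coe_unitSphere]
  simp

theorem arc_zero {m : ℕ} (x y : UnitSphere m) : arc x y 0 = x := by
  simp [arc, radial_coe]

theorem arc_one {m : ℕ} (x y : UnitSphere m) : arc x y 1 = y := by
  simp [arc, radial_coe]

theorem contDiff_arc {m : ℕ} {x y : UnitSphere m}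
    (h : ‖(y - x : EuclideanSpace ℝ (Fin (m + 1)))‖ ≤ 1) :
    ContDiff ℝ 1 (fun t => (arc x y t : EuclideanSpace ℝ (Fin (m + 1)))) := by
  have h1 : ContDiff ℝ 1 (fun t : ℝ => (x + t • (y - x) : EuclideanSpace ℝ (Fin (m + 1)))) := by
    fun_prop
  simp_rw [coe_arc h]
  exact ((h1.norm ℝ (chord_ne_zero h)).inv fun t => norm_ne_zero_iff.2 (chord_ne_zero h t)).smul h1

theorem contMDiff_arc {m : ℕ} {x y : UnitSphere m}
    (h : ‖(y - x : EuclideanSpace ℝ (Fin (m + 1)))‖ ≤ 1) :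
    ContMDiff 𝓘(ℝ, ℝ) (𝓡 m) 1 (arc x y) := by
  have := Fact.mk (@finrank_euclideanSpace_fin ℝ _ (m + 1))
  exact ContMDiff.codRestrict_sphere (n := m) (contMDiff_iff_contDiff.2 (contDiff_arc h))
    fun t => (arc x y t).2

/-- The arc is the chord divided by its norm `√q`, and `q ≥ 3 / 4` for chords of length at most one.
The product rule gives `6 / 5` from the chord's own derivative and `2 / 3` from the derivative of
the normalization, together less than `2`. -/
theorem norm_deriv_arc_le {m : ℕ} {x y : UnitSphere m}
    (h : ‖(y - x : EuclideanSpace ℝ (Fin (m + 1)))‖ ≤ 1) {t : ℝ} (ht : t ∈ Icc (0 : ℝ) 1) :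
    ‖deriv (fun t => (arc x y t : EuclideanSpace ℝ (Fin (m + 1)))) t‖ ≤
      2 * ‖(y - x : EuclideanSpace ℝ (Fin (m + 1)))‖ := by
  set w : EuclideanSpace ℝ (Fin (m + 1)) := y - x with hw
  set q : ℝ → ℝ := fun t => 1 - t * (1 - t) * ‖w‖ ^ 2 with hq
  have hqs : ∀ t, ‖(x + t • w : EuclideanSpace ℝ (Fin (m + 1)))‖ = √(q t) := fun t => by
    rw [← Real.sqrt_sq (norm_nonneg (x + t • w : EuclideanSpace ℝ (Fin (m + 1)))), hw,
      norm_chord_sq]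
  have hq34 : ∀ t, 3 / 4 ≤ q t := fun t => by
    have := three_quarters_le_norm_chord_sq h t
    rwa [norm_chord_sq] at this
  have hqd : HasDerivAt q ((2 * t - 1) * ‖w‖ ^ 2) t := by
    have := (((hasDerivAt_id t).mul ((hasDerivAt_const t (1 : ℝ)).sub (hasDerivAt_id t))).mul_const
      (‖w‖ ^ 2)).const_sub 1
    convert! this using 1
    simp only [id, Pi.sub_apply]
    ring
  have hq0 : 0 < q t := by linarith [hq34 t]
  have hsd := (hqd.sqrt hq0.ne').inv (Real.sqrt_ne_zero'.2 hq0)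
  have hvd : HasDerivAt (fun t : ℝ => (x + t • w : EuclideanSpace ℝ (Fin (m + 1)))) w t := by
    have := ((hasDerivAt_id t).smul_const w).const_add (x : EuclideanSpace ℝ (Fin (m + 1)))
    simpa using this
  have hd := hsd.smul hvd
  have he : (fun t => (arc x y t : EuclideanSpace ℝ (Fin (m + 1)))) =
      fun t => (√(q t))⁻¹ • (x + t • w : EuclideanSpace ℝ (Fin (m + 1))) := by
    funext t
    rw [coe_arc h, ← hw, hqs]
  rw [he]
  refine (congrArg norm hd.deriv).trans_le ?_
  refine (norm_add_le _ _).trans ?_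
  have hs0 : 0 < √(q t) := Real.sqrt_pos.2 hq0
  have hs2 : √(q t) ^ 2 = q t := Real.sq_sqrt hq0.le
  -- A rational number just below `√(3 / 4)`.
  have hsl : 43 / 50 ≤ √(q t) := Real.le_sqrt_of_sq_le (by linarith [hq34 t])
  have hw0 := norm_nonneg w
  have a1 : ‖(√(q t))⁻¹ • w‖ ≤ 6 / 5 * ‖w‖ := by
    rw [norm_smul, norm_inv, Real.norm_eq_abs, abs_of_pos hs0]
    gcongr
    rw [inv_le_comm₀ hs0 (by norm_num)]
    linarith
  have a2 : |(2 * t - 1) * ‖w‖ ^ 2| ≤ ‖w‖ := by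
    rw [abs_mul, abs_of_nonneg (sq_nonneg ‖w‖)]
    have : |2 * t - 1| ≤ 1 := abs_le.2 ⟨by linarith [ht.1], by linarith [ht.2]⟩
    nlinarith
  have a3 : ‖(-((2 * t - 1) * ‖w‖ ^ 2 / (2 * √(q t))) / √(q t) ^ 2) •
      (x + t • w : EuclideanSpace ℝ (Fin (m + 1)))‖ ≤ 2 / 3 * ‖w‖ := by
    rw [norm_smul, hqs, Real.norm_eq_abs, abs_div, abs_neg, abs_div, hs2, abs_of_pos hq0,
      abs_of_pos (by positivity : 0 < 2 * √(q t)), div_mul_eq_mul_div, div_le_iff₀ hq0,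
      div_mul_eq_mul_div, div_le_iff₀ (by positivity)]
    nlinarith [mul_le_mul_of_nonneg_right a2 hs0.le, mul_nonneg hw0 hs0.le, hq34 t,
      mul_le_mul_of_nonneg_left (hq34 t) (mul_nonneg hw0 hs0.le)]
  calc _ ≤ 6 / 5 * ‖w‖ + 2 / 3 * ‖w‖ := add_le_add a1 a3
    _ ≤ _ := by linarith

theorem conformal_edist_le_of_arc {m : ℕ} {ρ : EuclideanSpace ℝ (Fin (m + 1)) → ℝ}
    (hρ : ContDiff ℝ ∞ ρ) (hpos : ∀ x, 0 < ρ x) {x y : UnitSphere m}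
    (h : ‖(y - x : EuclideanSpace ℝ (Fin (m + 1)))‖ ≤ 1) {c : ℝ}
    (hc : ∀ t ∈ Icc (0 : ℝ) 1, ρ (arc x y t) ≤ c) :
    (conformalMetric m ρ hρ hpos).edist x y ≤
      ENNReal.ofReal (2 * c * ‖(y - x : EuclideanSpace ℝ (Fin (m + 1)))‖) := by
  have h1 := conformal_edist_le hρ hpos (contMDiff_arc h).contMDiffOn
  rw [arc_zero, arc_one] at h1
  have hc0 : 0 ≤ c := (hpos _).le.trans (hc 0 ⟨le_rfl, zero_le_one⟩)
  refine h1.trans ?_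
  calc _ ≤ ∫⁻ t in Icc (0 : ℝ) 1, ENNReal.ofReal
        (2 * c * ‖(y - x : EuclideanSpace ℝ (Fin (m + 1)))‖) := by
        refine setLIntegral_mono' measurableSet_Icc fun t ht => ?_
        rw [((contDiff_arc h).differentiable one_ne_zero t).derivWithin
          (uniqueDiffOn_Icc zero_lt_one t ht), ← ofReal_norm,
          ← ENNReal.ofReal_mul (hpos _).le]
        refine ENNReal.ofReal_le_ofReal ?_
        calc _ ≤ c * (2 * ‖(y - x : EuclideanSpace ℝ (Fin (m + 1)))‖) :=
              mul_le_mul (hc t ht) (norm_deriv_arc_le h ht) (norm_nonneg _) hc0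
          _ = _ := by ring
    _ = _ := by simp


/-! ### Stereographic charts and the volume density. -/

section Stereographic

variable {m : ℕ}

/-- The inverse stereographic projection `ℝᵐ → S^m` inverting the preferred chart at `c`. -/
noncomputable def invStereo (c : UnitSphere m) : EuclideanSpace ℝ (Fin m) → UnitSphere m :=
  (chartAt (EuclideanSpace ℝ (Fin m)) c).symm

theorem chart_target_unitSphere (c : UnitSphere m) :
    (chartAt (EuclideanSpace ℝ (Fin m)) c).target = univ :=
  have := Fact.mk (@finrank_euclideanSpace_fin ℝ _ (m + 1))
  stereographic'_target (-c)

theorem chart_source_unitSphere (c : UnitSphere m) :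
    (chartAt (EuclideanSpace ℝ (Fin m)) c).source = {-c}ᶜ :=
  have := Fact.mk (@finrank_euclideanSpace_fin ℝ _ (m + 1))
  stereographic'_source (-c)

theorem exists_invStereo_eq (c : UnitSphere m) :
    ∃ U : EuclideanSpace ℝ (Fin m) →ₗᵢ[ℝ] EuclideanSpace ℝ (Fin (m + 1)),
      (∀ y, inner ℝ (c : EuclideanSpace ℝ (Fin (m + 1))) (U y) = 0) ∧
      ∀ y, (invStereo c y : EuclideanSpace ℝ (Fin (m + 1))) =
        (‖y‖ ^ 2 + 4)⁻¹ • ((4 : ℝ) • U y - (‖y‖ ^ 2 - 4) • (c : EuclideanSpace ℝ (Fin (m + 1)))) := by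
  have := Fact.mk (@finrank_euclideanSpace_fin ℝ _ (m + 1))
  let U := (OrthonormalBasis.fromOrthogonalSpanSingleton (𝕜 := ℝ) m
    (ne_zero_of_mem_unit_sphere (-c))).repr
  refine ⟨(Submodule.subtypeₗᵢ _).comp U.symm.toLinearIsometry, fun y => ?_, fun y => ?_⟩
  · have h := (U.symm y).2
    rw [Submodule.mem_orthogonal_singleton_iff_inner_right] at h
    have h' : inner ℝ (c : EuclideanSpace ℝ (Fin (m + 1)))
      (U.symm y : EuclideanSpace ℝ (Fin (m + 1))) = 0 := by simpa using h
    exact h'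
  · have h := stereographic'_symm_apply (n := m) (-c) y
    have hn : ‖(U.symm y : EuclideanSpace ℝ (Fin (m + 1)))‖ = ‖y‖ := by
      rw [← Submodule.coe_norm, LinearIsometryEquiv.norm_map]
    have h' : (invStereo c y : EuclideanSpace ℝ (Fin (m + 1))) =
        (‖(U.symm y : EuclideanSpace ℝ (Fin (m + 1)))‖ ^ 2 + 4)⁻¹ •
          (4 : ℝ) • (U.symm y : EuclideanSpace ℝ (Fin (m + 1))) +
        (‖(U.symm y : EuclideanSpace ℝ (Fin (m + 1)))‖ ^ 2 + 4)⁻¹ •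
          (‖(U.symm y : EuclideanSpace ℝ (Fin (m + 1)))‖ ^ 2 - 4) •
            (-(c : EuclideanSpace ℝ (Fin (m + 1)))) := h
    rw [hn] at h'
    rw [h']
    change _ = (‖y‖ ^ 2 + 4)⁻¹ • ((4 : ℝ) • (U.symm y : EuclideanSpace ℝ (Fin (m + 1))) - _)
    module

/-- This chord formula carries all the metric information about the chart: its Lipschitz bounds, its
conformal factor and the size of preimages of caps are read off from it. -/
theorem norm_invStereo_sub_sq (c : UnitSphere m) (y z : EuclideanSpace ℝ (Fin m)) :
    ‖(invStereo c y - invStereo c z : EuclideanSpace ℝ (Fin (m + 1)))‖ ^ 2 =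
      16 * ‖y - z‖ ^ 2 / ((‖y‖ ^ 2 + 4) * (‖z‖ ^ 2 + 4)) := by
  obtain ⟨U, hU, h⟩ := exists_invStereo_eq c
  rw [norm_sub_sq_real, norm_coe_unitSphere, norm_coe_unitSphere, h, h, norm_sub_sq_real]
  have hU' : ∀ y, inner ℝ (U y) (c : EuclideanSpace ℝ (Fin (m + 1))) = 0 := fun y => by
    rw [real_inner_comm, hU]
  simp only [inner_smul_left, inner_smul_right, inner_sub_left, inner_sub_right, hU, hU',
    LinearIsometry.inner_map_map, real_inner_self_eq_norm_sq, norm_coe_unitSphere]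
  simp
  have h1 : ‖y‖ ^ 2 + 4 ≠ 0 := by positivity
  have h2 : ‖z‖ ^ 2 + 4 ≠ 0 := by positivity
  field_simp
  ring

theorem invStereo_zero (c : UnitSphere m) : invStereo c 0 = c := by
  obtain ⟨U, hU, h⟩ := exists_invStereo_eq c
  ext1
  rw [h]
  simp [← smul_assoc]

theorem continuous_invStereo (c : UnitSphere m) : Continuous (invStereo c) := by
  have := (chartAt (EuclideanSpace ℝ (Fin m)) c).continuousOn_symm
  rwa [chart_target_unitSphere, continuousOn_univ] at this

theorem invStereo_injective (c : UnitSphere m) : Function.Injective (invStereo c) := by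
  have := (chartAt (EuclideanSpace ℝ (Fin m)) c).symm.injOn
  rwa [OpenPartialHomeomorph.symm_source, chart_target_unitSphere, injOn_univ] at this

theorem measurableEmbedding_invStereo (c : UnitSphere m) : MeasurableEmbedding (invStereo c) :=
  (continuous_invStereo c).measurableEmbedding (invStereo_injective c)

theorem lipschitzWith_invStereo (c : UnitSphere m) : LipschitzWith 1 (invStereo c) := by
  refine LipschitzWith.of_dist_le_mul fun y z => ?_
  rw [Subtype.dist_eq, dist_eq_norm, dist_eq_norm, NNReal.coe_one, one_mul]
  refine pow_le_pow_iff_left₀ (norm_nonneg _) (norm_nonneg _) two_ne_zero |>.1 ?_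
  rw [norm_invStereo_sub_sq, div_le_iff₀ (by positivity)]
  nlinarith [sq_nonneg ‖y‖, sq_nonneg ‖z‖, sq_nonneg ‖y - z‖,
    mul_nonneg (sq_nonneg ‖y‖) (sq_nonneg ‖z‖),
    mul_nonneg (sq_nonneg ‖y - z‖) (add_nonneg (add_nonneg (sq_nonneg ‖y‖) (sq_nonneg ‖z‖))
      (mul_nonneg (sq_nonneg ‖y‖) (sq_nonneg ‖z‖)))]

/-- The conformal factor of the inverse stereographic projection. -/
noncomputable def stereoFactor (y : EuclideanSpace ℝ (Fin m)) : ℝ := 4 / (‖y‖ ^ 2 + 4)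

theorem stereoFactor_pos (y : EuclideanSpace ℝ (Fin m)) : 0 < stereoFactor y := by
  unfold stereoFactor; positivity

theorem contDiff_coe_invStereo (c : UnitSphere m) :
    ContDiff ℝ 1 fun y => (invStereo c y : EuclideanSpace ℝ (Fin (m + 1))) := by
  obtain ⟨U, hU, h⟩ := exists_invStereo_eq c
  simp_rw [h]
  have h1 : ContDiff ℝ 1 fun y : EuclideanSpace ℝ (Fin m) => ‖y‖ ^ 2 := contDiff_norm_sq ℝ
  refine ((h1.add contDiff_const).inv fun y => by positivity).smul ?_
  refine ContDiff.sub (U.contDiff.const_smul (4 : ℝ)) ?_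
  exact (h1.sub contDiff_const).smul contDiff_const

/-- Conformality follows by passing to the limit in the chord formula along difference quotients,
with no differentiation of the explicit map. -/
theorem norm_fderiv_invStereo (c : UnitSphere m) (y v : EuclideanSpace ℝ (Fin m)) :
    ‖fderiv ℝ (fun y => (invStereo c y : EuclideanSpace ℝ (Fin (m + 1)))) y v‖ =
      stereoFactor y * ‖v‖ := by
  have hd := ((contDiff_coe_invStereo c).differentiable one_ne_zero y).hasFDerivAt
  have h1 := (hd.hasLineDerivAt v).tendsto_slope_zero.norm
  refine tendsto_nhds_unique h1 ?_
  have h2 : Tendsto (fun t : ℝ => 4 * ‖v‖ / (√(‖y + t • v‖ ^ 2 + 4) * √(‖y‖ ^ 2 + 4)))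
      (𝓝[≠] 0) (𝓝 (4 * ‖v‖ / (√(‖y + (0 : ℝ) • v‖ ^ 2 + 4) * √(‖y‖ ^ 2 + 4)))) := by
    refine (Continuous.tendsto ?_ 0).mono_left nhdsWithin_le_nhds
    refine continuous_const.div (by fun_prop) fun t => by positivity
  have h3 : 4 * ‖v‖ / (√(‖y + (0 : ℝ) • v‖ ^ 2 + 4) * √(‖y‖ ^ 2 + 4)) = stereoFactor y * ‖v‖ := by
    rw [zero_smul, add_zero, Real.mul_self_sqrt (by positivity), stereoFactor]
    ring
  rw [h3] at h2
  refine h2.congr' ?_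
  filter_upwards [self_mem_nhdsWithin] with t ht
  have ht' : t ≠ 0 := ht
  have h4 : ‖(invStereo c (y + t • v) - invStereo c y : EuclideanSpace ℝ (Fin (m + 1)))‖ =
      |t| * (4 * ‖v‖ / (√(‖y + t • v‖ ^ 2 + 4) * √(‖y‖ ^ 2 + 4))) := by
    refine pow_left_inj₀ (norm_nonneg _) (by positivity) two_ne_zero |>.1 ?_
    rw [norm_invStereo_sub_sq, add_sub_cancel_left, norm_smul, mul_pow, mul_pow, div_pow,
      mul_pow, mul_pow, Real.sq_sqrt (by positivity), Real.sq_sqrt (by positivity),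
      Real.norm_eq_abs]
    ring
  rw [norm_smul, h4, norm_inv, Real.norm_eq_abs, ← mul_assoc,
    inv_mul_cancel₀ (abs_ne_zero.2 ht'), one_mul]

theorem inner_fderiv_invStereo (c : UnitSphere m) (y v w : EuclideanSpace ℝ (Fin m)) :
    inner ℝ (fderiv ℝ (fun y => (invStereo c y : EuclideanSpace ℝ (Fin (m + 1)))) y v)
      (fderiv ℝ (fun y => (invStereo c y : EuclideanSpace ℝ (Fin (m + 1)))) y w) =
      stereoFactor y ^ 2 * inner ℝ v w := by
  rw [real_inner_eq_norm_add_mul_self_sub_norm_mul_self_sub_norm_mul_self_div_two,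
    real_inner_eq_norm_add_mul_self_sub_norm_mul_self_sub_norm_mul_self_div_two, ← map_add,
    norm_fderiv_invStereo, norm_fderiv_invStereo, norm_fderiv_invStereo]
  ring

theorem sphereIncl_mfderiv_invStereo (c : UnitSphere m) (y v : EuclideanSpace ℝ (Fin m)) :
    sphereIncl m (invStereo c y) (mfderiv (𝓡 m) (𝓡 m) (invStereo c) y v) =
      fderiv ℝ (fun y => (invStereo c y : EuclideanSpace ℝ (Fin (m + 1)))) y v := by
  have hs : MDifferentiableAt (𝓡 m) (𝓡 m) (invStereo c) y := by
    have h1 := contMDiffOn_chart_symm (I := 𝓡 m) (n := 1) (x := c)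
    rw [chart_target_unitSphere] at h1
    exact (contMDiffOn_univ.1 h1).mdifferentiable one_ne_zero y
  have h1 := mfderiv_comp (I := 𝓡 m) (I' := 𝓡 m)
    (I'' := 𝓘(ℝ, EuclideanSpace ℝ (Fin (m + 1)))) y
    ((contMDiff_coe_unitSphere m (n := 1)).mdifferentiable one_ne_zero (invStereo c y)) hs
  rw [mfderiv_eq_fderiv] at h1
  exact (DFunLike.congr_fun h1 v).symm

theorem gram_conformalMetric {ρ : EuclideanSpace ℝ (Fin (m + 1)) → ℝ} (hρ : ContDiff ℝ ∞ ρ)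
    (hpos : ∀ x, 0 < ρ x) (c : UnitSphere m) (y : EuclideanSpace ℝ (Fin m)) :
    (conformalMetric m ρ hρ hpos).gram c y =
      (ρ (invStereo c y) * stereoFactor y) ^ 2 • (1 : Matrix (Fin m) (Fin m) ℝ) := by
  ext i j
  have h1 : (conformalMetric m ρ hρ hpos).gram c y i j =
      inner ℝ (ρ (invStereo c y) • sphereIncl m (invStereo c y)
        (mfderiv (𝓡 m) (𝓡 m) (invStereo c) y (EuclideanSpace.single i (1 : ℝ))))
      (ρ (invStereo c y) • sphereIncl m (invStereo c y)
        (mfderiv (𝓡 m) (𝓡 m) (invStereo c) y (EuclideanSpace.single j (1 : ℝ)))) := rfl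
  rw [h1, sphereIncl_mfderiv_invStereo, sphereIncl_mfderiv_invStereo, inner_smul_left,
    inner_smul_right, inner_fderiv_invStereo]
  rcases eq_or_ne i j with rfl | hij
  · simp
    ring
  · simp [hij, EuclideanSpace.inner_single_left]

theorem sqrt_det_gram_conformalMetric {ρ : EuclideanSpace ℝ (Fin (m + 1)) → ℝ}
    (hρ : ContDiff ℝ ∞ ρ) (hpos : ∀ x, 0 < ρ x) (c : UnitSphere m) (y : EuclideanSpace ℝ (Fin m)) :
    √((conformalMetric m ρ hρ hpos).gram c y).det =
      ρ (invStereo c y) ^ m * stereoFactor y ^ m := by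
  rw [gram_conformalMetric, Matrix.det_smul, Matrix.det_one, mul_one, Fintype.card_fin,
    ← pow_mul, mul_comm 2, pow_mul, Real.sqrt_sq, mul_pow]
  exact pow_nonneg (mul_nonneg (hpos _).le (stereoFactor_pos y).le) _

end Stereographic

/-! ### Riemannian volume against Hausdorff measure. -/

section Volume

variable {m : ℕ}

theorem exists_volume_eq_smul_hausdorffMeasure (m : ℕ) :
    ∃ c : ℝ≥0, (volume : Measure (EuclideanSpace ℝ (Fin m))) = c • μH[(m : ℝ)] := by
  have h : IsAddHaarMeasure (μH[(m : ℝ)] : Measure (EuclideanSpace ℝ (Fin m))) := by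
    have h := MeasureTheory.isAddHaarMeasure_hausdorffMeasure (E := EuclideanSpace ℝ (Fin m))
    rwa [finrank_euclideanSpace_fin] at h
  exact ⟨_, isAddLeftInvariant_eq_smul volume μH[(m : ℝ)]⟩

theorem exists_hausdorffMeasure_eq_smul_volume (m : ℕ) :
    ∃ c : ℝ≥0, (μH[(m : ℝ)] : Measure (EuclideanSpace ℝ (Fin m))) = c • volume := by
  have h : IsAddHaarMeasure (μH[(m : ℝ)] : Measure (EuclideanSpace ℝ (Fin m))) := by
    have h := MeasureTheory.isAddHaarMeasure_hausdorffMeasure (E := EuclideanSpace ℝ (Fin m))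
    rwa [finrank_euclideanSpace_fin] at h
  exact ⟨_, isAddLeftInvariant_eq_smul μH[(m : ℝ)] volume⟩

/-- The dyadic shells on which the stereographic factor is constant up to a factor `2`. -/
def stereoShell (m k : ℕ) : Set (EuclideanSpace ℝ (Fin m)) :=
  {y | 2 ^ k ≤ ‖y‖ ^ 2 + 4 ∧ ‖y‖ ^ 2 + 4 < 2 ^ (k + 1)}

theorem measurableSet_stereoShell (m k : ℕ) : MeasurableSet (stereoShell m k) :=
  have h : Measurable fun y : EuclideanSpace ℝ (Fin m) => ‖y‖ ^ 2 + 4 := by fun_prop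
  (measurableSet_le measurable_const h).inter (measurableSet_lt h measurable_const)

theorem iUnion_stereoShell (m : ℕ) : ⋃ k, stereoShell m k = univ := by
  refine eq_univ_of_forall fun y => ?_
  obtain ⟨k, hk⟩ := exists_nat_pow_near (x := ‖y‖ ^ 2 + 4) (y := 2)
    (by nlinarith [sq_nonneg ‖y‖]) one_lt_two
  exact mem_iUnion.2 ⟨k, hk⟩

theorem pairwise_disjoint_stereoShell (m : ℕ) : Pairwise (Function.onFun Disjoint (stereoShell m)) := by
  have key : ∀ k l, k < l → Disjoint (stereoShell m k) (stereoShell m l) := by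
    intro k l h
    refine Set.disjoint_left.2 fun y hk hl => ?_
    have h1 : (2 : ℝ) ^ (k + 1) ≤ 2 ^ l := pow_le_pow_right₀ one_le_two h
    exact absurd (hk.2.trans_le h1) (not_lt.2 hl.1)
  intro k l h
  rcases lt_or_gt_of_ne h with h | h
  · exact key k l h
  · exact (key l k h).symm

theorem hausdorffMeasure_le_image_invStereo (c : UnitSphere m) (k : ℕ)
    {t : Set (EuclideanSpace ℝ (Fin m))} (ht : t ⊆ stereoShell m k) :
    μH[(m : ℝ)] t ≤ ENNReal.ofReal ((2 ^ (k + 1) / 4) ^ m) * μH[(m : ℝ)] (invStereo c '' t) := by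
  have hlip : LipschitzOnWith (Real.toNNReal (2 ^ (k + 1) / 4))
      (Function.invFun (invStereo c)) (invStereo c '' t) := by
    refine LipschitzOnWith.of_dist_le_mul ?_
    rintro _ ⟨y, hy, rfl⟩ _ ⟨z, hz, rfl⟩
    rw [Function.leftInverse_invFun (invStereo_injective c),
      Function.leftInverse_invFun (invStereo_injective c), Real.coe_toNNReal _ (by positivity),
      Subtype.dist_eq, dist_eq_norm, dist_eq_norm]
    refine pow_le_pow_iff_left₀ (norm_nonneg _) (by positivity) two_ne_zero |>.1 ?_
    rw [mul_pow, norm_invStereo_sub_sq]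
    have h1 := (ht hy).2.le
    have h2 := (ht hz).2.le
    have h3 : (‖y‖ ^ 2 + 4) * (‖z‖ ^ 2 + 4) ≤ 2 ^ (k + 1) * 2 ^ (k + 1) :=
      mul_le_mul h1 h2 (by positivity) (by positivity)
    rw [← mul_div_assoc, le_div_iff₀ (by positivity)]
    calc _ ≤ ‖y - z‖ ^ 2 * (2 ^ (k + 1) * 2 ^ (k + 1)) := by gcongr
      _ = _ := by ring
  have h := hlip.hausdorffMeasure_image_le (Nat.cast_nonneg m)
  rw [← image_comp, Function.leftInverse_invFun (invStereo_injective c) |>.comp_eq_id,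
    image_id] at h
  rwa [ENNReal.rpow_natCast, ← ENNReal.ofReal.eq_def, ← ENNReal.ofReal_pow (by positivity)] at h

/-- On the `k`-th shell the density is at most `(4 / 2 ^ k) ^ m` and the inverse of `invStereo` is
`2 ^ (k + 1) / 4`-Lipschitz. The product of the two scales is `2` for every `k`, so summation over
the shells loses only the factor `2 ^ m`. -/
theorem exists_map_invStereo_le (m : ℕ) : ∃ C : ℝ≥0, ∀ c : UnitSphere m,
    (volume.withDensity fun y => ENNReal.ofReal (stereoFactor y ^ m)).map (invStereo c) ≤
      C • (μH[(m : ℝ)] : Measure (UnitSphere m)) := by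
  obtain ⟨b, hb⟩ := exists_volume_eq_smul_hausdorffMeasure m
  refine ⟨b * 2 ^ m, fun c => Measure.le_iff.2 fun s hs => ?_⟩
  have hs' := (continuous_invStereo c).measurable hs
  rw [map_apply (continuous_invStereo c).measurable hs, withDensity_apply _ hs']
  have hcov : (invStereo c) ⁻¹' s = ⋃ k, (invStereo c) ⁻¹' s ∩ stereoShell m k := by
    rw [← inter_iUnion, iUnion_stereoShell, inter_univ]
  have hdisj : Pairwise (Function.onFun Disjoint fun k =>
      (invStereo c) ⁻¹' s ∩ stereoShell m k) :=
    fun k l h => (pairwise_disjoint_stereoShell m h).mono inter_subset_right inter_subset_right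
  have hmeas : ∀ k, MeasurableSet ((invStereo c) ⁻¹' s ∩ stereoShell m k) :=
    fun k => hs'.inter (measurableSet_stereoShell m k)
  rw [hcov, lintegral_iUnion hmeas hdisj]
  have hterm : ∀ k, ∫⁻ y in (invStereo c) ⁻¹' s ∩ stereoShell m k,
      ENNReal.ofReal (stereoFactor y ^ m) ≤
      (b * 2 ^ m : ℝ≥0) • μH[(m : ℝ)] (invStereo c '' ((invStereo c) ⁻¹' s ∩ stereoShell m k)) := by
    intro k
    set t := (invStereo c) ⁻¹' s ∩ stereoShell m k with ht
    calc _ ≤ ∫⁻ y in t, ENNReal.ofReal ((4 / 2 ^ k) ^ m) := by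
          refine setLIntegral_mono measurable_const fun y hy => ?_
          refine ENNReal.ofReal_le_ofReal (pow_le_pow_left₀ (stereoFactor_pos y).le ?_ m)
          exact div_le_div_of_nonneg_left (by norm_num) (by positivity) hy.2.1
      _ = ENNReal.ofReal ((4 / 2 ^ k) ^ m) * (b * μH[(m : ℝ)] t) := by
          rw [setLIntegral_const, hb]; rfl
      _ ≤ ENNReal.ofReal ((4 / 2 ^ k) ^ m) * (b * (ENNReal.ofReal ((2 ^ (k + 1) / 4) ^ m) *
            μH[(m : ℝ)] (invStereo c '' t))) := by
          gcongr
          exact hausdorffMeasure_le_image_invStereo c k inter_subset_right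
      _ = (ENNReal.ofReal ((4 / 2 ^ k) ^ m) * ENNReal.ofReal ((2 ^ (k + 1) / 4) ^ m)) * b *
            μH[(m : ℝ)] (invStereo c '' t) := by ring
      _ = _ := by
          rw [← ENNReal.ofReal_mul (by positivity), ← mul_pow]
          have : (4 / 2 ^ k * (2 ^ (k + 1) / 4) : ℝ) = 2 := by
            field_simp; ring
          rw [this, ENNReal.smul_def, smul_eq_mul, ENNReal.ofReal_pow zero_le_two]
          simp [mul_comm]
  refine (ENNReal.tsum_le_tsum hterm).trans ?_
  simp_rw [ENNReal.smul_def, smul_eq_mul]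
  rw [ENNReal.tsum_mul_left, ← measure_iUnion]
  · rw [Measure.smul_apply, smul_eq_mul]
    gcongr
    refine iUnion_subset fun k => ?_
    rw [image_subset_iff]
    exact inter_subset_left
  · exact fun k l h => (disjoint_image_iff (invStereo_injective c)).2 (hdisj h)
  · exact fun k => (measurableEmbedding_invStereo c).measurableSet_image' (hmeas k)

/-- Each chart volume has density `ρ ^ m` relative to the round chart volume. The dominating measure
is the same for all charts, so it also dominates their supremum. -/
theorem exists_volumeMeasure_conformalMetric_le (m : ℕ) :
    ∃ C : ℝ≥0, ∀ (ρ : EuclideanSpace ℝ (Fin (m + 1)) → ℝ) (hρ : ContDiff ℝ ∞ ρ)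
      (hpos : ∀ x, 0 < ρ x), (conformalMetric m ρ hρ hpos).volumeMeasure univ ≤
        C * ∫⁻ x : UnitSphere m, ENNReal.ofReal (ρ x ^ m) ∂μH[(m : ℝ)] := by
  obtain ⟨C, hC⟩ := exists_map_invStereo_le m
  refine ⟨C, fun ρ hρ hpos => ?_⟩
  have hmeas : Measurable fun x : UnitSphere m => ENNReal.ofReal (ρ x ^ m) :=
    (((hρ.continuous.comp continuous_subtype_val).pow m).measurable).ennreal_ofReal
  have hmeas' : Measurable fun y : EuclideanSpace ℝ (Fin m) =>
      ENNReal.ofReal (stereoFactor y ^ m) := by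
    unfold stereoFactor; fun_prop
  have key : (conformalMetric m ρ hρ hpos).volumeMeasure ≤
      C • ((μH[(m : ℝ)] : Measure (UnitSphere m)).withDensity
        fun x => ENNReal.ofReal (ρ x ^ m)) := by
    refine iSup_le fun c => ?_
    have hsm := withDensity_smul_measure (C : ℝ≥0∞) (μ := (μH[(m : ℝ)] : Measure (UnitSphere m)))
      (fun x => ENNReal.ofReal (ρ x ^ m))
    have heq : (conformalMetric m ρ hρ hpos).chartVolume c =
        ((volume.withDensity fun y => ENNReal.ofReal (stereoFactor y ^ m)).map
          (invStereo c)).withDensity fun x => ENNReal.ofReal (ρ x ^ m) := by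
      have h1 : (conformalMetric m ρ hρ hpos).chartVolume c = (volume.withDensity fun y =>
          ENNReal.ofReal √((conformalMetric m ρ hρ hpos).gram c y).det).map (invStereo c) := by
        rw [SmoothMetric.chartVolume, chart_target_unitSphere, Measure.restrict_univ]
        rfl
      rw [h1]
      ext s hs
      have hs' := (continuous_invStereo c).measurable hs
      rw [map_apply (continuous_invStereo c).measurable hs, withDensity_apply _ hs',
        withDensity_apply _ hs, setLIntegral_map hs hmeas (continuous_invStereo c).measurable]
      refine Eq.trans ?_ (setLIntegral_withDensity_eq_setLIntegral_mul _ hmeas'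
          (hmeas.comp (continuous_invStereo c).measurable) hs').symm
      refine lintegral_congr fun y => ?_
      rw [sqrt_det_gram_conformalMetric, mul_comm, ENNReal.ofReal_mul
        (pow_nonneg (stereoFactor_pos y).le m)]
      rfl
    rw [heq]
    refine le_trans (Measure.le_iff.2 fun s hs => ?_) hsm.le
    rw [withDensity_apply _ hs, withDensity_apply _ hs]
    exact lintegral_mono' (Measure.restrict_mono le_rfl (hC c)) le_rfl
  refine (key univ).trans_eq ?_
  rw [Measure.smul_apply, withDensity_apply _ MeasurableSet.univ, Measure.restrict_univ,
    ENNReal.smul_def, smul_eq_mul]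

theorem exists_hausdorffMeasure_ball_le (m : ℕ) : ∃ C : ℝ≥0, ∀ (p : UnitSphere m) (r : ℝ),
    0 < r → r ≤ 1 → μH[(m : ℝ)] (Metric.ball p r) ≤ C * ENNReal.ofReal (r ^ m) := by
  obtain ⟨b, hb⟩ := exists_hausdorffMeasure_eq_smul_volume m
  let V : ℝ≥0∞ := volume (Metric.ball (0 : EuclideanSpace ℝ (Fin m)) 1)
  have hV : V ≠ ⊤ := measure_ball_lt_top.ne
  refine ⟨b * 2 ^ m * V.toNNReal, fun p r hr hr1 => ?_⟩
  have hsub : Metric.ball p r ⊆ invStereo p '' Metric.ball 0 (2 * r) := by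
    intro x hx
    have hxs : x ∈ (chartAt (EuclideanSpace ℝ (Fin m)) p).source := by
      rw [chart_source_unitSphere]
      rintro rfl
      rw [Metric.mem_ball, Subtype.dist_eq, dist_eq_norm] at hx
      have : ‖((-p : UnitSphere m) : EuclideanSpace ℝ (Fin (m + 1))) - p‖ = 2 := by
        have h2 : ((-p : UnitSphere m) : EuclideanSpace ℝ (Fin (m + 1))) - p =
          (-2 : ℝ) • (p : EuclideanSpace ℝ (Fin (m + 1))) := by
          rw [show ((-p : UnitSphere m) : EuclideanSpace ℝ (Fin (m + 1))) = -p from rfl]; module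
        rw [h2, norm_smul, norm_coe_unitSphere]; norm_num
      linarith
    have hinv : invStereo p (chartAt (EuclideanSpace ℝ (Fin m)) p x) = x :=
      (chartAt (EuclideanSpace ℝ (Fin m)) p).left_inv hxs
    refine ⟨_, ?_, hinv⟩
    set y := chartAt (EuclideanSpace ℝ (Fin m)) p x
    rw [← hinv, Metric.mem_ball, Subtype.dist_eq, dist_eq_norm] at hx
    have h1 := norm_invStereo_sub_sq p y 0
    rw [invStereo_zero] at h1
    have h2 := pow_lt_pow_left₀ hx (norm_nonneg _) two_ne_zero
    rw [h1, div_lt_iff₀ (by positivity)] at h2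
    simp only [sub_zero, norm_zero] at h2
    rw [mem_ball_zero_iff]
    refine lt_of_pow_lt_pow_left₀ 2 (by positivity) ?_
    nlinarith [mul_nonneg (sub_nonneg.2 (pow_le_one₀ hr.le hr1 (n := 2))) (sq_nonneg ‖y‖)]
  calc μH[(m : ℝ)] (Metric.ball p r) ≤ μH[(m : ℝ)] (invStereo p '' Metric.ball 0 (2 * r)) :=
        measure_mono hsub
    _ ≤ (1 : ℝ≥0) ^ (m : ℝ) *
          μH[(m : ℝ)] (Metric.ball (0 : EuclideanSpace ℝ (Fin m)) (2 * r)) := by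
        simpa using (lipschitzWith_invStereo p).hausdorffMeasure_image_le (Nat.cast_nonneg m)
          (Metric.ball 0 (2 * r))
    _ = b * (ENNReal.ofReal ((2 * r) ^ m) * V) := by
        rw [hb, Measure.smul_apply, addHaar_ball_of_pos _ _ (by positivity), finrank_euclideanSpace_fin,
          ENNReal.smul_def, smul_eq_mul]
        simp [V]
    _ = _ := by
        rw [mul_pow, ENNReal.ofReal_mul (by positivity), ENNReal.coe_mul, ENNReal.coe_toNNReal hV,
          ENNReal.ofReal_pow zero_le_two]
        push_cast
        simp
        ring

theorem hausdorffMeasure_unitSphere_lt_top (m : ℕ) :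
    μH[(m : ℝ)] (univ : Set (UnitSphere m)) < ⊤ := by
  obtain ⟨C, hC⟩ := exists_hausdorffMeasure_ball_le m
  refine isCompact_univ.measure_lt_top_of_nhdsWithin fun p _ => ?_
  refine ⟨Metric.ball p 1, mem_nhdsWithin_of_mem_nhds (Metric.ball_mem_nhds p one_pos), ?_⟩
  refine (hC p 1 one_pos le_rfl).trans_lt ?_
  simp

end Volume

/-! ### Convexity of caps and pushing off a great sphere. -/

section SphereGeometry

variable {m : ℕ}

theorem dist_unitSphere (x y : UnitSphere m) :
    dist x y = ‖(y - x : EuclideanSpace ℝ (Fin (m + 1)))‖ := by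
  rw [Subtype.dist_eq, dist_comm, dist_eq_norm]

theorem dist_sq_unitSphere (x y : UnitSphere m) :
    dist x y ^ 2 = 2 - 2 * inner ℝ (x : EuclideanSpace ℝ (Fin (m + 1))) y := by
  rw [dist_unitSphere, norm_sub_sq_real, norm_coe_unitSphere, norm_coe_unitSphere, real_inner_comm]
  ring

theorem dist_lt_iff_unitSphere {x y : UnitSphere m} {r : ℝ} (hr : 0 ≤ r) :
    dist x y < r ↔ 1 - r ^ 2 / 2 < inner ℝ (x : EuclideanSpace ℝ (Fin (m + 1))) y := by
  rw [← pow_lt_pow_iff_left₀ dist_nonneg hr two_ne_zero, dist_sq_unitSphere]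
  constructor <;> intro h <;> linarith

theorem norm_chord_le_one {x y : UnitSphere m} {t : ℝ} (ht : t ∈ Icc (0 : ℝ) 1) :
    ‖(x + t • (y - x) : EuclideanSpace ℝ (Fin (m + 1)))‖ ≤ 1 := by
  have h := norm_chord_sq x y t
  have h1 : 0 ≤ t * (1 - t) * ‖(y - x : EuclideanSpace ℝ (Fin (m + 1)))‖ ^ 2 :=
    mul_nonneg (mul_nonneg ht.1 (sub_nonneg.2 ht.2)) (sq_nonneg _)
  rw [← sq_le_one_iff₀ (norm_nonneg _)]
  linarith

/-- Half spaces not containing the centre in their interior are convex for short arcs. -/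
theorem le_inner_arc {x y : UnitSphere m} (h : dist x y ≤ 1) {t : ℝ} (ht : t ∈ Icc (0 : ℝ) 1)
    {u : EuclideanSpace ℝ (Fin (m + 1))} {c : ℝ} (hc : 0 ≤ c) (hx : c ≤ inner ℝ u x)
    (hy : c ≤ inner ℝ u y) : c ≤ inner ℝ u (arc x y t) := by
  rw [dist_unitSphere] at h
  rw [coe_arc h, inner_smul_right, inner_add_right, inner_smul_right, inner_sub_right]
  have h1 : c ≤ inner ℝ u (x : EuclideanSpace ℝ (Fin (m + 1))) +
      t * (inner ℝ u (y : EuclideanSpace ℝ (Fin (m + 1))) - inner ℝ u x) := by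
    nlinarith [mul_nonneg ht.1 (sub_nonneg.2 hy), mul_nonneg (sub_nonneg.2 ht.2) (sub_nonneg.2 hx)]
  have h2 := one_le_inv_iff₀.2 ⟨norm_pos_iff.2 (chord_ne_zero h t), norm_chord_le_one ht⟩
  nlinarith

/-- Spherical caps are convex for short arcs. -/
theorem dist_arc_lt {x y p : UnitSphere m} (h : dist x y ≤ 1) {t r : ℝ}
    (ht : t ∈ Icc (0 : ℝ) 1) (hr : r ≤ 1) (hx : dist p x < r) (hy : dist p y < r) :
    dist p (arc x y t) < r := by
  have hr0 : 0 ≤ r := dist_nonneg.trans hx.le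
  have hr1 : r ^ 2 ≤ 1 := pow_le_one₀ hr0 hr
  rw [dist_lt_iff_unitSphere hr0] at *
  refine (lt_min hx hy).trans_le (le_inner_arc h ht ?_ (min_le_left _ _) (min_le_right _ _))
  exact le_trans (by linarith) (lt_min hx hy).le

theorem dist_arc_le {x y p : UnitSphere m} (h : dist x y ≤ 1) {t r : ℝ}
    (ht : t ∈ Icc (0 : ℝ) 1) (hr : r < 1) (hx : dist p x ≤ r) (hy : dist p y ≤ r) :
    dist p (arc x y t) ≤ r := by
  refine le_of_forall_gt_imp_ge_of_dense fun s hs => ?_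
  rcases le_or_gt s 1 with h1 | h1
  · exact (dist_arc_lt h ht h1 (hx.trans_lt hs) (hy.trans_lt hs)).le
  · exact (dist_arc_lt h ht le_rfl (hx.trans_lt hr) (hy.trans_lt hr)).le.trans h1.le

theorem dist_radial_le {x : UnitSphere m} {w : EuclideanSpace ℝ (Fin (m + 1))} (hw : w ≠ 0) :
    dist x (radial m w) ≤ 2 * ‖w - x‖ := by
  rw [dist_unitSphere, coe_radial hw]
  have h1 : ‖‖w‖⁻¹ • w - w‖ ≤ ‖w - x‖ := by
    have h2 : ‖w‖⁻¹ • w - w = (‖w‖⁻¹ - 1) • w := by module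
    have h3 : (‖w‖⁻¹ - 1) * ‖w‖ = 1 - ‖w‖ := by
      rw [sub_mul, inv_mul_cancel₀ (norm_ne_zero_iff.2 hw), one_mul]
    rw [h2, norm_smul, Real.norm_eq_abs, ← abs_of_nonneg (norm_nonneg w), ← abs_mul,
      abs_of_nonneg (norm_nonneg w), h3, norm_sub_rev]
    have h4 := abs_norm_sub_norm_le (x : EuclideanSpace ℝ (Fin (m + 1))) w
    rwa [norm_coe_unitSphere] at h4
  calc _ = ‖(‖w‖⁻¹ • w - w) + (w - x)‖ := by congr 1; abel
    _ ≤ _ := (norm_add_le _ _).trans (by linarith)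

/-- The point of the sphere obtained by pushing `x` in the direction `u`. -/
noncomputable def push (u : EuclideanSpace ℝ (Fin (m + 1))) (η : ℝ) (x : UnitSphere m) :
    UnitSphere m := radial m (x + (2 * η) • u)

variable {u : EuclideanSpace ℝ (Fin (m + 1))} {x : UnitSphere m} {η : ℝ}

theorem le_norm_add_smul (hu : ‖u‖ = 1) (hx : 0 ≤ inner ℝ u (x : EuclideanSpace ℝ (Fin (m + 1))))
    {α β : ℝ} (hα : 0 ≤ α) (hβ : 0 ≤ β) :
    α ≤ ‖α • (x : EuclideanSpace ℝ (Fin (m + 1))) + β • u‖ := by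
  refine le_of_sq_le_sq ?_ (norm_nonneg _)
  rw [norm_add_sq_real, norm_smul, norm_smul, norm_coe_unitSphere, hu, inner_smul_left,
    inner_smul_right, real_inner_comm, Real.norm_of_nonneg hα, Real.norm_of_nonneg hβ]
  have := mul_nonneg hα (mul_nonneg hβ hx)
  simp only [conj_trivial]
  nlinarith [sq_nonneg β]

theorem one_le_norm_push (hu : ‖u‖ = 1) (hx : 0 ≤ inner ℝ u (x : EuclideanSpace ℝ (Fin (m + 1))))
    (hη : 0 ≤ η) : 1 ≤ ‖(x : EuclideanSpace ℝ (Fin (m + 1))) + (2 * η) • u‖ := by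
  simpa using le_norm_add_smul hu hx zero_le_one (by positivity : 0 ≤ 2 * η)

theorem dist_push_le (hu : ‖u‖ = 1) (hx : 0 ≤ inner ℝ u (x : EuclideanSpace ℝ (Fin (m + 1))))
    (hη : 0 ≤ η) : dist x (push u η x) ≤ 4 * η := by
  have h1 := one_le_norm_push hu hx hη
  have h0 : (x : EuclideanSpace ℝ (Fin (m + 1))) + (2 * η) • u ≠ 0 := by
    rw [← norm_ne_zero_iff]; linarith
  refine (dist_radial_le h0).trans_eq ?_
  rw [add_sub_cancel_left, norm_smul, hu, Real.norm_of_nonneg (by positivity)]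
  ring

theorem le_inner_push (hu : ‖u‖ = 1) (hx : 0 ≤ inner ℝ u (x : EuclideanSpace ℝ (Fin (m + 1))))
    (hη : 0 ≤ η) (hη1 : η ≤ 1 / 2) :
    η ≤ inner ℝ u (push u η x : EuclideanSpace ℝ (Fin (m + 1))) := by
  have h1 := one_le_norm_push hu hx hη
  have h0 : (x : EuclideanSpace ℝ (Fin (m + 1))) + (2 * η) • u ≠ 0 := by
    rw [← norm_ne_zero_iff]; linarith
  have h2 : ‖(x : EuclideanSpace ℝ (Fin (m + 1))) + (2 * η) • u‖ ≤ 2 := by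
    refine (norm_add_le _ _).trans ?_
    rw [norm_coe_unitSphere, norm_smul, hu, Real.norm_of_nonneg (by positivity)]
    linarith
  rw [push, coe_radial h0, inner_smul_right, inner_add_right, inner_smul_right,
    real_inner_self_eq_norm_sq, hu, inv_mul_eq_div, le_div_iff₀ (by linarith)]
  nlinarith

/-- Pushing away from a great sphere does not approach any point of the great sphere. -/
theorem le_dist_arc_push (hu : ‖u‖ = 1) (hx : 0 ≤ inner ℝ u (x : EuclideanSpace ℝ (Fin (m + 1))))
    (hη : 0 ≤ η) (hη1 : η ≤ 1 / 4) {p : UnitSphere m}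
    (hp : inner ℝ u (p : EuclideanSpace ℝ (Fin (m + 1))) = 0) {r t : ℝ} (hr : 0 ≤ r) (hr1 : r ≤ 1)
    (ht : t ∈ Icc (0 : ℝ) 1) (h : r ≤ dist p x) : r ≤ dist p (arc x (push u η x) t) := by
  have h1 := one_le_norm_push hu hx hη
  set k := ‖(x : EuclideanSpace ℝ (Fin (m + 1))) + (2 * η) • u‖ with hk
  have h0 : (x : EuclideanSpace ℝ (Fin (m + 1))) + (2 * η) • u ≠ 0 := by
    rw [← norm_ne_zero_iff]; linarith
  have hd : dist x (push u η x) ≤ 1 := (dist_push_le hu hx hη).trans (by linarith)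
  rw [dist_unitSphere] at hd
  have hk0 : 0 ≤ k⁻¹ := by positivity
  have hα : 0 ≤ 1 - t + t * k⁻¹ := add_nonneg (sub_nonneg.2 ht.2) (mul_nonneg ht.1 hk0)
  have hβ : 0 ≤ t * k⁻¹ * (2 * η) := mul_nonneg (mul_nonneg ht.1 hk0) (by linarith)
  -- Chord points have the form `α x + β u` with `α, β ≥ 0`. Since `p ⟂ u`, pairing with `p` gives
  -- `α ⟪x, p⟫`, while the norm is at least `α`. Normalizing therefore keeps the pairing below `1 -
  -- r ^ 2 / 2`.
  have hchord : (x + t • (push u η x - x) : EuclideanSpace ℝ (Fin (m + 1))) =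
      (1 - t + t * k⁻¹) • (x : EuclideanSpace ℝ (Fin (m + 1))) + (t * k⁻¹ * (2 * η)) • u := by
    rw [push, coe_radial h0, ← hk]; module
  have hn := le_norm_add_smul hu hx hα hβ
  have hpos := norm_pos_iff.2 (chord_ne_zero hd t)
  have hr2 : r ^ 2 ≤ 1 := pow_le_one₀ hr hr1
  rw [← not_lt, dist_lt_iff_unitSphere hr, not_lt] at h ⊢
  rw [coe_arc hd, inner_smul_right, inv_mul_le_iff₀ hpos, hchord, inner_add_right,
    inner_smul_right, inner_smul_right, real_inner_comm, real_inner_comm u, hp, mul_zero, add_zero]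
  rw [real_inner_comm] at h
  calc _ ≤ (1 - t + t * k⁻¹) * (1 - r ^ 2 / 2) := mul_le_mul_of_nonneg_left h hα
    _ ≤ _ := mul_le_mul_of_nonneg_right hn (by linarith)

theorem le_dist_of_le_inner (hu : ‖u‖ = 1) {p : UnitSphere m}
    (hp : inner ℝ u (p : EuclideanSpace ℝ (Fin (m + 1))) = 0)
    (h : η ≤ inner ℝ u (x : EuclideanSpace ℝ (Fin (m + 1)))) : η ≤ dist p x := by
  rw [dist_unitSphere]
  have h1 := real_inner_le_norm u (x - p : EuclideanSpace ℝ (Fin (m + 1)))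
  rw [inner_sub_right, hp, hu, one_mul, sub_zero] at h1
  exact h.trans h1

end SphereGeometry

/-! ### Rescaled bump functions. -/

section Bump

variable {m : ℕ}

/-- A fixed bump function on `ℝ^(m+1)`. -/
noncomputable def unitBump (m : ℕ) : ContDiffBump (0 : EuclideanSpace ℝ (Fin (m + 1))) :=
  ⟨1 / 2, 1, by norm_num, by norm_num⟩

theorem exists_norm_fderiv_unitBump_le (m : ℕ) :
    ∃ G, 1 ≤ G ∧ ∀ x, ‖fderiv ℝ (unitBump m) x‖ ≤ G := by
  have h1 : HasCompactSupport (fderiv ℝ (unitBump m)) := (unitBump m).hasCompactSupport.fderiv ℝ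
  have h2 : Continuous (fderiv ℝ (unitBump m)) :=
    ((unitBump m).contDiff (n := 1)).continuous_fderiv one_ne_zero
  obtain ⟨G, hG⟩ := h1.exists_bound_of_continuous h2
  exact ⟨max 1 G, le_max_left _ _, fun x => (hG x).trans (le_max_right _ _)⟩

/-- A bound for the derivative of `unitBump`. -/
noncomputable def bumpConst (m : ℕ) : ℝ := (exists_norm_fderiv_unitBump_le m).choose

theorem one_le_bumpConst (m : ℕ) : 1 ≤ bumpConst m :=
  (exists_norm_fderiv_unitBump_le m).choose_spec.1

/-- The rescaled bump function centred at `p`, equal to `1` on the ball of radius `r / 2` and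
supported in the ball of radius `r`. -/
noncomputable def bump (p : EuclideanSpace ℝ (Fin (m + 1))) (r : ℝ)
    (x : EuclideanSpace ℝ (Fin (m + 1))) : ℝ := unitBump m (r⁻¹ • (x - p))

variable (p : EuclideanSpace ℝ (Fin (m + 1))) {r : ℝ} (x : EuclideanSpace ℝ (Fin (m + 1)))

theorem bump_nonneg : 0 ≤ bump p r x := (unitBump m).nonneg

theorem bump_le_one : bump p r x ≤ 1 := (unitBump m).le_one

theorem contDiff_bump (r : ℝ) : ContDiff ℝ ∞ (bump p r) :=
  (unitBump m).contDiff.comp ((contDiff_id.sub contDiff_const).const_smul _)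

variable {p x}

theorem bump_eq_one (hr : 0 < r) (h : dist x p ≤ r / 2) : bump p r x = 1 := by
  refine (unitBump m).one_of_mem_closedBall ?_
  rw [mem_closedBall_zero_iff, norm_smul, norm_inv, Real.norm_of_nonneg hr.le,
    inv_mul_le_iff₀ hr, ← dist_eq_norm]
  change _ ≤ r * (1 / 2)
  linarith

theorem bump_eq_zero (hr : 0 < r) (h : r ≤ dist x p) : bump p r x = 0 := by
  refine (unitBump m).zero_of_le_dist ?_
  rw [dist_zero_right, norm_smul, norm_inv, Real.norm_of_nonneg hr.le,
    le_inv_mul_iff₀ hr, ← dist_eq_norm]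
  change r * 1 ≤ _
  linarith

theorem norm_fderiv_bump_le (hr : 0 < r) : ‖fderiv ℝ (bump p r) x‖ ≤ bumpConst m / r := by
  have h1 : HasFDerivAt (fun x => r⁻¹ • (x - p))
      (r⁻¹ • ContinuousLinearMap.id ℝ (EuclideanSpace ℝ (Fin (m + 1)))) x :=
    ((hasFDerivAt_id x).sub_const p).const_smul r⁻¹
  have h2 := (((unitBump m).contDiff (n := 1)).differentiable one_ne_zero
    (r⁻¹ • (x - p))).hasFDerivAt.comp x h1
  have h3 : fderiv ℝ (bump p r) x = _ := h2.fderiv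
  rw [h3, div_eq_mul_inv]
  refine (ContinuousLinearMap.opNorm_comp_le _ _).trans ?_
  refine mul_le_mul ((exists_norm_fderiv_unitBump_le m).choose_spec.2 _) ?_ (norm_nonneg _)
    (zero_le_one.trans (one_le_bumpConst m))
  rw [norm_smul, norm_inv, Real.norm_of_nonneg hr.le]
  exact mul_le_of_le_one_right (by positivity) ContinuousLinearMap.norm_id_le

/-- A zero of a nonnegative function is a minimum; this also covers the boundary sphere of the
support. -/
theorem fderiv_bump_eq_zero (hr : 0 < r) (h : r ≤ dist x p) : fderiv ℝ (bump p r) x = 0 := by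
  refine IsLocalMin.fderiv_eq_zero (Filter.Eventually.of_forall fun y => ?_)
  rw [bump_eq_zero hr h]
  exact bump_nonneg p y

end Bump

/-! ### The tree of balls and its conformal factors. -/

/-- The data for a Cantor set in a great circle of the sphere `S^m`: an orthonormal frame, sizes
`a j` and branching numbers `b j`. -/
structure CantorTree (m : ℕ) where
  two_le : 2 ≤ m
  frame : Fin 3 → EuclideanSpace ℝ (Fin (m + 1))
  orthonormal_frame : Orthonormal ℝ frame
  a : ℕ → ℝ
  a_pos : ∀ j, 0 < a j
  a_antitone : Antitone a
  a_zero_le : a 0 ≤ 1 / 16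
  summable_a : Summable a
  b : ℕ → ℕ
  b_pos : ∀ j, 0 < b j
  b_le : ∀ j, b j ≤ 2

namespace CantorTree

variable {m : ℕ} (T : CantorTree m)

/-- The number of balls of level `j`. -/
def num (j : ℕ) : ℕ := ∏ i ∈ Finset.range j, T.b i

theorem num_zero : T.num 0 = 1 := by simp [num]

theorem num_succ (j : ℕ) : T.num (j + 1) = T.num j * T.b j := by simp [num, Finset.prod_range_succ]

theorem num_pos (j : ℕ) : 0 < T.num j := Finset.prod_pos fun i _ => T.b_pos i

/-- The radius of the balls of level `j`. -/
noncomputable def rad (j : ℕ) : ℝ := T.a j / 64 ^ j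

theorem rad_pos (j : ℕ) : 0 < T.rad j := div_pos (T.a_pos j) (by positivity)

theorem pow_mul_rad (j : ℕ) : 64 ^ j * T.rad j = T.a j := by
  unfold rad; field_simp

theorem rad_succ_le (j : ℕ) : T.rad (j + 1) ≤ T.rad j / 64 := by
  unfold rad
  rw [div_div, pow_succ]
  exact div_le_div_of_nonneg_right (T.a_antitone j.le_succ) (by positivity)

theorem rad_le (j : ℕ) : T.rad j ≤ 1 / 16 := by
  unfold rad
  refine (div_le_self (T.a_pos j).le (one_le_pow₀ (by norm_num))).trans ?_
  exact (T.a_antitone (Nat.zero_le j)).trans T.a_zero_le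

/-- The parameters of the centres of the balls of level `j`. -/
noncomputable def par : ℕ → ℕ → ℝ
  | 0, _ => 0
  -- The index `i` encodes the parent as `i / b j` and the child number, `0` or `1`, as `i % b j`.
  -- Child `0` keeps the centre of its parent.
  | j + 1, i => par j (i / T.b j) + (i % T.b j : ℕ) * (T.rad j / 8)

theorem mod_b_le_one (i j : ℕ) : i % T.b j ≤ 1 := by
  have := Nat.mod_lt i (T.b_pos j)
  have := T.b_le j
  omega

theorem par_nonneg (j i : ℕ) : 0 ≤ T.par j i := by
  induction j generalizing i with
  | zero => exact le_rfl
  | succ j ih =>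
    exact add_nonneg (ih _) (mul_nonneg (Nat.cast_nonneg _) (by linarith [T.rad_pos j]))

theorem par_sub_par_le (j i : ℕ) : T.par (j + 1) i - T.par j (i / T.b j) ≤ T.rad j / 8 := by
  have h : ((i % T.b j : ℕ) : ℝ) ≤ 1 := by exact_mod_cast T.mod_b_le_one i j
  rw [par, add_sub_cancel_left]
  exact mul_le_of_le_one_left (by linarith [T.rad_pos j]) h

theorem par_le_par (j i : ℕ) : T.par j (i / T.b j) ≤ T.par (j + 1) i := by
  rw [par]
  have := T.rad_pos j
  have : (0 : ℝ) ≤ (i % T.b j : ℕ) * (T.rad j / 8) := by positivity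
  linarith

/-- The induction closes because `rad j / 8 + rad (j + 1) ≤ rad j`. All parameters thus stay well
inside the range `|t| ≤ 1 / 2` in which the formula for `curve` is valid. -/
theorem par_add_rad_le (j i : ℕ) : T.par j i + T.rad j ≤ 1 / 8 := by
  induction j generalizing i with
  | zero => simp only [par]; linarith [T.rad_le 0]
  | succ j ih =>
    have := T.par_sub_par_le j i
    have := T.rad_succ_le j
    have := T.rad_pos j
    linarith [ih (i / T.b j)]

/-- The great circle containing the Cantor set, parametrized by the first coordinate. -/
noncomputable def curve (t : ℝ) : UnitSphere m :=
  radial m (t • T.frame 0 + √(1 - t ^ 2) • T.frame 1)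

theorem norm_frame (k : Fin 3) : ‖T.frame k‖ = 1 := T.orthonormal_frame.1 k

theorem inner_frame {k l : Fin 3} (h : k ≠ l) : inner ℝ (T.frame k) (T.frame l) = 0 :=
  T.orthonormal_frame.2 h

theorem coe_curve {t : ℝ} (ht : |t| ≤ 1 / 2) : (T.curve t : EuclideanSpace ℝ (Fin (m + 1))) =
    t • T.frame 0 + √(1 - t ^ 2) • T.frame 1 := by
  have h1 : t ^ 2 ≤ 1 := by rw [sq_le_one_iff_abs_le_one]; linarith
  have hn : ‖t • T.frame 0 + √(1 - t ^ 2) • T.frame 1‖ = 1 := by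
    rw [← sq_eq_sq₀ (norm_nonneg _) zero_le_one, norm_add_sq_real, norm_smul, norm_smul,
      T.norm_frame, T.norm_frame, inner_smul_left, inner_smul_right, T.inner_frame (by decide)]
    simp [Real.sq_sqrt (sub_nonneg.2 h1)]
  rw [curve, coe_radial, hn, inv_one, one_smul]
  rw [← norm_ne_zero_iff, hn]
  exact one_ne_zero

theorem inner_frame_curve {t : ℝ} (ht : |t| ≤ 1 / 2) :
    inner ℝ (T.frame 2) (T.curve t : EuclideanSpace ℝ (Fin (m + 1))) = 0 := by
  rw [T.coe_curve ht, inner_add_right, inner_smul_right, inner_smul_right,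
    T.inner_frame (by decide), T.inner_frame (by decide)]
  simp

theorem abs_sub_le_dist_curve {s t : ℝ} (hs : |s| ≤ 1 / 2) (ht : |t| ≤ 1 / 2) :
    |s - t| ≤ dist (T.curve s) (T.curve t) := by
  have key : ∀ {t : ℝ}, |t| ≤ 1 / 2 →
      inner ℝ (T.frame 0) (T.curve t : EuclideanSpace ℝ (Fin (m + 1))) = t := by
    intro t ht
    rw [T.coe_curve ht, inner_add_right, inner_smul_right, inner_smul_right,
      T.inner_frame (by decide : (0 : Fin 3) ≠ 1), real_inner_self_eq_norm_sq, T.norm_frame]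
    simp
  have h := abs_real_inner_le_norm (T.frame 0)
    (T.curve s - T.curve t : EuclideanSpace ℝ (Fin (m + 1)))
  rwa [inner_sub_right, key hs, key ht, T.norm_frame, one_mul, ← dist_eq_norm,
    ← Subtype.dist_eq] at h

theorem dist_curve_le {s t : ℝ} (hs : |s| ≤ 1 / 2) (ht : |t| ≤ 1 / 2) :
    dist (T.curve s) (T.curve t) ≤ 2 * |s - t| := by
  have hsq : ∀ {t : ℝ}, |t| ≤ 1 / 2 → t ^ 2 ≤ 1 / 4 := fun {t} ht => by
    rw [← sq_abs]; nlinarith [abs_nonneg t]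
  have hroot : ∀ {t : ℝ}, |t| ≤ 1 / 2 → 1 / 2 ≤ √(1 - t ^ 2) := fun {t} ht =>
    Real.le_sqrt_of_sq_le (by linarith [hsq ht])
  have h1 : |√(1 - s ^ 2) - √(1 - t ^ 2)| ≤ |s - t| := by
    have h2 : (√(1 - s ^ 2) - √(1 - t ^ 2)) * (√(1 - s ^ 2) + √(1 - t ^ 2)) =
        (t - s) * (s + t) := by
      have h3 := Real.sq_sqrt (by linarith [hsq hs] : 0 ≤ 1 - s ^ 2)
      have h4 := Real.sq_sqrt (by linarith [hsq ht] : 0 ≤ 1 - t ^ 2)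
      linear_combination h3 - h4
    have h5 : |√(1 - s ^ 2) - √(1 - t ^ 2)| * (√(1 - s ^ 2) + √(1 - t ^ 2)) =
        |s - t| * |s + t| := by
      rw [← abs_of_nonneg (by positivity : 0 ≤ √(1 - s ^ 2) + √(1 - t ^ 2)), ← abs_mul, h2,
        abs_mul, abs_sub_comm]
    have h6 : |s + t| ≤ 1 := (abs_add_le s t).trans (by linarith)
    have h7 : 1 ≤ √(1 - s ^ 2) + √(1 - t ^ 2) := by linarith [hroot hs, hroot ht]
    nlinarith [abs_nonneg (s - t), abs_nonneg (√(1 - s ^ 2) - √(1 - t ^ 2))]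
  rw [Subtype.dist_eq, dist_eq_norm, T.coe_curve hs, T.coe_curve ht]
  calc _ = ‖(s - t) • T.frame 0 + (√(1 - s ^ 2) - √(1 - t ^ 2)) • T.frame 1‖ := by
        congr 1; module
    _ ≤ |s - t| + |√(1 - s ^ 2) - √(1 - t ^ 2)| := by
        refine (norm_add_le _ _).trans ?_
        rw [norm_smul, norm_smul, T.norm_frame, T.norm_frame, mul_one, mul_one]
        rfl
    _ ≤ _ := by linarith

theorem abs_par_le (j i : ℕ) : |T.par j i| ≤ 1 / 2 := by
  rw [abs_of_nonneg (T.par_nonneg j i)]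
  linarith [T.par_add_rad_le j i, T.rad_pos j]

/-- The centres of the balls of level `j`. -/
noncomputable def pt (j i : ℕ) : UnitSphere m := T.curve (T.par j i)

theorem dist_pt_parent_le (j i : ℕ) : dist (T.pt (j + 1) i) (T.pt j (i / T.b j)) ≤ T.rad j / 4 := by
  refine (T.dist_curve_le (T.abs_par_le _ _) (T.abs_par_le _ _)).trans ?_
  rw [abs_of_nonneg (sub_nonneg.2 (T.par_le_par j i))]
  linarith [T.par_sub_par_le j i]

/-- As `1 / 4 + 1 / 64 < 1 / 2`, a ball lies in the concentric half of its parent, where the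
parent's bump function is constantly `1`. -/
theorem dist_parent_lt {j i : ℕ} {x : EuclideanSpace ℝ (Fin (m + 1))}
    (h : dist x (T.pt (j + 1) i) ≤ T.rad (j + 1)) : dist x (T.pt j (i / T.b j)) < T.rad j / 2 := by
  have h1 := T.dist_pt_parent_le j i
  rw [Subtype.dist_eq] at h1
  linarith [dist_triangle x (T.pt (j + 1) i : EuclideanSpace ℝ (Fin (m + 1)))
    (T.pt j (i / T.b j)), T.rad_succ_le j, T.rad_pos j]

theorem div_lt_num {j i : ℕ} (h : i < T.num (j + 1)) : i / T.b j < T.num j := by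
  rw [num_succ, mul_comm] at h
  exact Nat.div_lt_of_lt_mul h

/-- The closed balls of level `j` are disjoint. -/
theorem eq_of_dist_le {j i k : ℕ} (hi : i < T.num j) (hk : k < T.num j)
    {x : EuclideanSpace ℝ (Fin (m + 1))} (h : dist x (T.pt j i) ≤ T.rad j)
    (h' : dist x (T.pt j k) ≤ T.rad j) : i = k := by
  induction j generalizing i k with
  | zero =>
    rw [num_zero] at hi hk
    omega
  | succ j ih =>
    have hr := T.rad_pos j
    have hpar := ih (T.div_lt_num hi) (T.div_lt_num hk)
      ((T.dist_parent_lt h).le.trans (by linarith)) ((T.dist_parent_lt h').le.trans (by linarith))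
    suffices hmod : i % T.b j = k % T.b j by
      rw [← Nat.div_add_mod i (T.b j), hpar, hmod, Nat.div_add_mod]
    -- Two children of one parent have centres at least `rad j / 8` apart, more than twice `rad (j +
    -- 1) ≤ rad j / 64`.
    by_contra hne
    have h1 := T.abs_sub_le_dist_curve (T.abs_par_le (j + 1) i) (T.abs_par_le (j + 1) k)
    have h2 : |T.par (j + 1) i - T.par (j + 1) k| = T.rad j / 8 := by
      have hi1 := T.mod_b_le_one i j
      have hk1 := T.mod_b_le_one k j
      rw [par, par, hpar, add_sub_add_left_eq_sub, ← sub_mul, abs_mul,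
        abs_of_pos (by positivity : 0 < T.rad j / 8)]
      obtain ⟨e1, e2⟩ | ⟨e1, e2⟩ : (i % T.b j = 0 ∧ k % T.b j = 1) ∨
        (i % T.b j = 1 ∧ k % T.b j = 0) := by omega
      all_goals rw [e1, e2]; simp
    have h3 := dist_triangle_left (T.pt (j + 1) i : EuclideanSpace ℝ (Fin (m + 1)))
      (T.pt (j + 1) k) x
    rw [h2] at h1
    have h4 : dist (T.curve (T.par (j + 1) i)) (T.curve (T.par (j + 1) k)) =
      dist (T.pt (j + 1) i : EuclideanSpace ℝ (Fin (m + 1))) (T.pt (j + 1) k) := rfl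
    linarith [T.rad_succ_le j]

/-- The union of the open balls of level `j`. -/
def core (j : ℕ) : Set (EuclideanSpace ℝ (Fin (m + 1))) :=
  {x | ∃ i < T.num j, dist x (T.pt j i) < T.rad j}

theorem isOpen_core (j : ℕ) : IsOpen (T.core j) := by
  have : T.core j = ⋃ i ∈ Finset.range (T.num j),
      Metric.ball (T.pt j i : EuclideanSpace ℝ (Fin (m + 1))) (T.rad j) := by
    ext x; simp [core]
  rw [this]
  exact isOpen_biUnion fun i _ => Metric.isOpen_ball

theorem core_antitone : Antitone T.core := by
  refine antitone_nat_of_succ_le fun j => ?_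
  rintro x ⟨i, hi, h⟩
  refine ⟨i / T.b j, T.div_lt_num hi, ?_⟩
  linarith [T.dist_parent_lt h.le, T.rad_pos j]

/-- The sum of the bump functions of level `j`. -/
noncomputable def levelBump (j : ℕ) (x : EuclideanSpace ℝ (Fin (m + 1))) : ℝ :=
  ∑ i ∈ Finset.range (T.num j), bump (T.pt j i : EuclideanSpace ℝ (Fin (m + 1))) (T.rad j) x

theorem contDiff_levelBump (j : ℕ) : ContDiff ℝ ∞ (T.levelBump j) :=
  ContDiff.sum fun _ _ => contDiff_bump _ _

theorem levelBump_nonneg (j : ℕ) (x : EuclideanSpace ℝ (Fin (m + 1))) : 0 ≤ T.levelBump j x :=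
  Finset.sum_nonneg fun _ _ => bump_nonneg _ _

theorem levelBump_eq {j i : ℕ} (hi : i < T.num j) {x : EuclideanSpace ℝ (Fin (m + 1))}
    (h : dist x (T.pt j i) ≤ T.rad j) :
    T.levelBump j x = bump (T.pt j i : EuclideanSpace ℝ (Fin (m + 1))) (T.rad j) x := by
  refine Finset.sum_eq_single_of_mem i (Finset.mem_range.2 hi) fun k hk hki => ?_
  refine bump_eq_zero (T.rad_pos j) ?_
  by_contra hlt
  exact hki (T.eq_of_dist_le (Finset.mem_range.1 hk) hi (not_le.1 hlt).le h)

theorem levelBump_eq_zero {j : ℕ} {x : EuclideanSpace ℝ (Fin (m + 1))} (h : x ∉ T.core j) :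
    T.levelBump j x = 0 := by
  refine Finset.sum_eq_zero fun i hi => bump_eq_zero (T.rad_pos j) ?_
  by_contra hlt
  exact h ⟨i, Finset.mem_range.1 hi, not_le.1 hlt⟩

theorem levelBump_le_one (j : ℕ) (x : EuclideanSpace ℝ (Fin (m + 1))) : T.levelBump j x ≤ 1 := by
  by_cases h : x ∈ T.core j
  · obtain ⟨i, hi, h⟩ := h
    rw [T.levelBump_eq hi h.le]
    exact bump_le_one _ _
  · rw [T.levelBump_eq_zero h]
    exact zero_le_one

theorem norm_fderiv_levelBump_le (j : ℕ) (x : EuclideanSpace ℝ (Fin (m + 1))) :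
    ‖fderiv ℝ (T.levelBump j) x‖ ≤ bumpConst m / T.rad j := by
  have hpos : 0 ≤ bumpConst m / T.rad j :=
    div_nonneg (zero_le_one.trans (one_le_bumpConst m)) (T.rad_pos j).le
  have hsum : fderiv ℝ (T.levelBump j) x = ∑ i ∈ Finset.range (T.num j),
      fderiv ℝ (bump (T.pt j i : EuclideanSpace ℝ (Fin (m + 1))) (T.rad j)) x :=
    fderiv_fun_sum fun i _ => (contDiff_bump _ _).differentiable (by simp) x
  rw [hsum]
  by_cases h : x ∈ T.core j
  · obtain ⟨i, hi, h⟩ := h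
    rw [Finset.sum_eq_single_of_mem i (Finset.mem_range.2 hi) fun k hk hki => ?_]
    · exact norm_fderiv_bump_le (T.rad_pos j)
    · refine fderiv_bump_eq_zero (T.rad_pos j) ?_
      by_contra hlt
      exact hki (T.eq_of_dist_le (Finset.mem_range.1 hk) hi (not_le.1 hlt).le h.le)
  · rw [Finset.sum_eq_zero fun i hi => ?_, norm_zero]
    · exact hpos
    · refine fderiv_bump_eq_zero (T.rad_pos j) ?_
      by_contra hlt
      exact h ⟨i, Finset.mem_range.1 hi, not_le.1 hlt⟩

theorem fderiv_levelBump_eq_zero {j : ℕ} {x : EuclideanSpace ℝ (Fin (m + 1))}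
    (h : x ∉ T.core j) : fderiv ℝ (T.levelBump j) x = 0 := by
  refine IsLocalMin.fderiv_eq_zero (Filter.Eventually.of_forall fun y => ?_)
  rw [T.levelBump_eq_zero h]
  exact T.levelBump_nonneg j y

/-- The conformal factors. -/
noncomputable def factor (n : ℕ) (x : EuclideanSpace ℝ (Fin (m + 1))) : ℝ :=
  1 + ∑ j ∈ Finset.range n, 63 * 64 ^ j * T.levelBump j x

theorem factor_zero (x : EuclideanSpace ℝ (Fin (m + 1))) : T.factor 0 x = 1 := by simp [factor]

theorem factor_succ (n : ℕ) (x : EuclideanSpace ℝ (Fin (m + 1))) :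
    T.factor (n + 1) x = T.factor n x + 63 * 64 ^ n * T.levelBump n x := by
  simp [factor, Finset.sum_range_succ, add_assoc]

theorem contDiff_factor (n : ℕ) : ContDiff ℝ ∞ (T.factor n) :=
  contDiff_const.add (ContDiff.sum fun j _ => contDiff_const.mul (T.contDiff_levelBump j))

theorem factor_mono (x : EuclideanSpace ℝ (Fin (m + 1))) : Monotone fun n => T.factor n x := by
  refine monotone_nat_of_le_succ fun n => ?_
  rw [factor_succ]
  have := T.levelBump_nonneg n x
  have : 0 ≤ 63 * 64 ^ n * T.levelBump n x := by positivity
  linarith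

theorem one_le_factor (n : ℕ) (x : EuclideanSpace ℝ (Fin (m + 1))) : 1 ≤ T.factor n x := by
  rw [← T.factor_zero x]
  exact T.factor_mono x (Nat.zero_le n)

theorem factor_pos (n : ℕ) (x : EuclideanSpace ℝ (Fin (m + 1))) : 0 < T.factor n x :=
  zero_lt_one.trans_le (T.one_le_factor n x)

/-- By `dist_parent_lt` all earlier bumps equal `1` at such a point, and `1 + ∑_{i < j} 63 * 64 ^ i
= 64 ^ j`. -/
theorem factor_eq_of_mem {j : ℕ} {x : EuclideanSpace ℝ (Fin (m + 1))} (h : x ∈ T.core j) :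
    T.factor j x = 64 ^ j := by
  induction j with
  | zero => simp [factor]
  | succ j ih =>
    have hr := T.rad_pos j
    rw [factor_succ, ih (T.core_antitone j.le_succ h)]
    obtain ⟨i, hi, h⟩ := h
    have h1 := T.dist_parent_lt h.le
    rw [T.levelBump_eq (T.div_lt_num hi) (by linarith), bump_eq_one (T.rad_pos j) h1.le]
    ring

theorem factor_le (n : ℕ) (x : EuclideanSpace ℝ (Fin (m + 1))) : T.factor n x ≤ 64 ^ n := by
  induction n with
  | zero => simp [factor]
  | succ n ih =>
    rw [factor_succ, pow_succ]
    nlinarith [T.levelBump_le_one n x, pow_pos (by norm_num : (0 : ℝ) < 64) n]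

theorem factor_eq_of_notMem {j n : ℕ} (hjn : j ≤ n) {x : EuclideanSpace ℝ (Fin (m + 1))}
    (h : x ∉ T.core j) : T.factor n x = T.factor j x := by
  induction n, hjn using Nat.le_induction with
  | base => rfl
  | succ n hn ih =>
    rw [factor_succ, ih, T.levelBump_eq_zero fun hx => h (T.core_antitone hn hx), mul_zero,
      add_zero]

/-- All bumps of level at least `j` vanish outside `core j`. The bound does not involve `n`; paths
avoiding `core j` therefore have length controlled uniformly in `n`. -/
theorem factor_le_of_notMem {j : ℕ} (n : ℕ) {x : EuclideanSpace ℝ (Fin (m + 1))}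
    (h : x ∉ T.core j) : T.factor n x ≤ 64 ^ j := by
  rcases le_total j n with hjn | hjn
  · exact (T.factor_eq_of_notMem hjn h).trans_le (T.factor_le j x)
  · exact (T.factor_mono x hjn).trans (T.factor_le j x)

theorem fderiv_factor_succ (n : ℕ) (x : EuclideanSpace ℝ (Fin (m + 1))) :
    fderiv ℝ (T.factor (n + 1)) x =
      fderiv ℝ (T.factor n) x + (63 * 64 ^ n : ℝ) • fderiv ℝ (T.levelBump n) x := by
  have h1 : T.factor (n + 1) = fun x => T.factor n x + (63 * 64 ^ n : ℝ) • T.levelBump n x := by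
    ext x; rw [factor_succ, smul_eq_mul]
  have h2 := (T.contDiff_levelBump n).differentiable (by simp) x
  rw [h1]
  exact (((T.contDiff_factor n).differentiable (by simp) x).hasFDerivAt.add
    (h2.hasFDerivAt.const_smul (63 * 64 ^ n : ℝ))).fderiv

/-- The gradients of different levels do not overlap. On a ball of level `n` the new gradient is of
order `64 ^ n / rad n = (64 ^ n) ^ 2 / a n`, and the factor is at least `64 ^ n` there. The
quadratic form of the bound says that `1 / factor` is Lipschitz. -/
theorem norm_fderiv_factor_le {A : ℝ} (hA : 0 < A) {n : ℕ} (h : ∀ j < n, A ≤ T.a j)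
    (x : EuclideanSpace ℝ (Fin (m + 1))) :
    ‖fderiv ℝ (T.factor n) x‖ ≤ 64 * bumpConst m / A * T.factor n x ^ 2 := by
  have hG := zero_le_one.trans (one_le_bumpConst m)
  induction n with
  | zero =>
    have : T.factor 0 = fun _ => 1 := by ext x; exact T.factor_zero x
    rw [this, fderiv_fun_const]
    simp only [Pi.zero_apply, norm_zero]
    positivity
  | succ n ih =>
    rw [fderiv_factor_succ]
    by_cases hx : x ∈ T.core n
    · have h0 : fderiv ℝ (T.factor n) x = 0 := by
        have : T.factor n =ᶠ[𝓝 x] fun _ => 64 ^ n := by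
          filter_upwards [(T.isOpen_core n).mem_nhds hx] with y hy
          exact T.factor_eq_of_mem hy
        rw [this.fderiv_eq, fderiv_fun_const]
        rfl
      have h1 : (64 : ℝ) ^ n ≤ T.factor (n + 1) x := by
        rw [← T.factor_eq_of_mem hx]
        exact T.factor_mono x n.le_succ
      rw [h0, zero_add, norm_smul, Real.norm_of_nonneg (by positivity)]
      calc _ ≤ 63 * 64 ^ n * (bumpConst m / T.rad n) := by
            gcongr
            exact T.norm_fderiv_levelBump_le n x
        _ = 63 * bumpConst m / T.a n * (64 ^ n) ^ 2 := by
            have := T.a_pos n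
            unfold rad
            field_simp
        _ ≤ 64 * bumpConst m / A * T.factor (n + 1) x ^ 2 := by
            gcongr
            · norm_num
            · exact h n n.lt_succ_self
    · rw [T.fderiv_levelBump_eq_zero hx, smul_zero, add_zero,
        T.factor_eq_of_notMem n.le_succ hx]
      exact ih fun j hj => h j (hj.trans n.lt_succ_self)

theorem abs_inv_factor_sub_le {A : ℝ} (hA : 0 < A) {n : ℕ} (h : ∀ j < n, A ≤ T.a j)
    (x y : EuclideanSpace ℝ (Fin (m + 1))) :
    |(T.factor n y)⁻¹ - (T.factor n x)⁻¹| ≤ 64 * bumpConst m / A * dist x y := by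
  have hd : ∀ z, HasFDerivAt (fun x => (T.factor n x)⁻¹)
      (-(T.factor n z ^ 2)⁻¹ • fderiv ℝ (T.factor n) z) z := fun z => by
    have h1 := ((T.contDiff_factor n).differentiable (by simp) z).hasFDerivAt
    exact (hasDerivAt_inv (T.factor_pos n z).ne').comp_hasFDerivAt z h1
  have := Convex.norm_image_sub_le_of_norm_hasFDerivWithin_le (𝕜 := ℝ) (s := univ)
    (f := fun x => (T.factor n x)⁻¹) (C := 64 * bumpConst m / A) (x := x) (y := y)
    (fun z _ => (hd z).hasFDerivWithinAt) (fun z _ => ?_) convex_univ trivial trivial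
  · rwa [← dist_eq_norm, ← dist_eq_norm, dist_comm y x] at this
  · have hz := T.factor_pos n z
    rw [norm_smul, norm_neg, norm_inv, Real.norm_of_nonneg (by positivity),
      inv_mul_le_iff₀ (by positivity), mul_comm]
    exact T.norm_fderiv_factor_le hA h z

end CantorTree

/-! ### Upper bounds for the distances, uniform in `n`. -/

namespace CantorTree

variable {m : ℕ} (T : CantorTree m)

/-- The conformal metrics. -/
noncomputable def metric (n : ℕ) : SmoothMetric m (UnitSphere m) :=
  conformalMetric m (T.factor n) (T.contDiff_factor n) (T.factor_pos n)

theorem edist_metric_ne_top (n : ℕ) (x y : UnitSphere m) : (T.metric n).edist x y ≠ ⊤ := by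
  have := connectedSpace_unitSphere T.two_le
  exact (T.metric n).edist_ne_top x y

/-- The Riemannian distances of the conformal metrics. -/
noncomputable def d (n : ℕ) (x y : UnitSphere m) : ℝ := ((T.metric n).edist x y).toReal

theorem ofReal_d (n : ℕ) (x y : UnitSphere m) :
    ENNReal.ofReal (T.d n x y) = (T.metric n).edist x y :=
  ENNReal.ofReal_toReal (T.edist_metric_ne_top n x y)

theorem d_nonneg (n : ℕ) (x y : UnitSphere m) : 0 ≤ T.d n x y := ENNReal.toReal_nonneg

theorem d_self (n : ℕ) (x : UnitSphere m) : T.d n x x = 0 := by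
  have h : (T.metric n).edist x x = 0 := (T.metric n).toEMetricSpace.edist_self x
  rw [d, h, ENNReal.toReal_zero]

theorem d_comm (n : ℕ) (x y : UnitSphere m) : T.d n x y = T.d n y x := by
  have h : (T.metric n).edist x y = (T.metric n).edist y x :=
    (T.metric n).toEMetricSpace.edist_comm x y
  rw [d, h, d]

theorem d_triangle (n : ℕ) (x y z : UnitSphere m) : T.d n x z ≤ T.d n x y + T.d n y z := by
  have h : (T.metric n).edist x z ≤ (T.metric n).edist x y + (T.metric n).edist y z :=
    (T.metric n).toEMetricSpace.edist_triangle x y z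
  rw [d, d, d, ← ENNReal.toReal_add (T.edist_metric_ne_top n x y) (T.edist_metric_ne_top n y z)]
  exact ENNReal.toReal_mono
    (ENNReal.add_ne_top.2 ⟨T.edist_metric_ne_top n x y, T.edist_metric_ne_top n y z⟩) h

theorem d_mono (x y : UnitSphere m) : Monotone fun n => T.d n x y := fun _ k h =>
  ENNReal.toReal_mono (T.edist_metric_ne_top k x y)
    (conformal_edist_mono _ _ _ _ (fun z => T.factor_mono z h) x y)

theorem d_le_of_arc {n : ℕ} {x y : UnitSphere m} (h : dist x y ≤ 1) {c : ℝ} (hc0 : 0 ≤ c)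
    (hc : ∀ t ∈ Icc (0 : ℝ) 1, T.factor n (arc x y t) ≤ c) : T.d n x y ≤ 2 * c * dist x y := by
  rw [dist_unitSphere] at h ⊢
  exact ENNReal.toReal_le_of_le_ofReal (by positivity) (conformal_edist_le_of_arc _ _ h hc)

theorem abs_sub_le_d {n : ℕ} {f : EuclideanSpace ℝ (Fin (m + 1)) → ℝ} (hf : ContDiff ℝ 1 f)
    (h : ∀ x, ‖fderiv ℝ f x‖ ≤ T.factor n x) (x y : UnitSphere m) : |f x - f y| ≤ T.d n x y := by
  have := ofReal_abs_sub_le_conformal_edist (T.contDiff_factor n) (T.factor_pos n) hf h x y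
  rw [← ENNReal.toReal_ofReal (abs_nonneg (f x - f y))]
  exact ENNReal.toReal_mono (T.edist_metric_ne_top n x y) this

theorem d_le_pow_mul {n : ℕ} {x y : UnitSphere m} (h : dist x y ≤ 1) :
    T.d n x y ≤ 2 * 64 ^ n * dist x y :=
  T.d_le_of_arc h (by positivity) fun _ _ => T.factor_le n _

/-- A unit vector orthogonal to the points of the arc containing the Cantor set. -/
def IsNormal (u : EuclideanSpace ℝ (Fin (m + 1))) : Prop :=
  ‖u‖ = 1 ∧ ∀ t, |t| ≤ 1 / 2 → inner ℝ u (T.curve t : EuclideanSpace ℝ (Fin (m + 1))) = 0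

theorem isNormal_frame : T.IsNormal (T.frame 2) :=
  ⟨T.norm_frame 2, fun _ ht => T.inner_frame_curve ht⟩

variable {T} {u : EuclideanSpace ℝ (Fin (m + 1))}

theorem IsNormal.neg (hu : T.IsNormal u) : T.IsNormal (-u) :=
  ⟨by rw [norm_neg, hu.1], fun t ht => by rw [inner_neg_left, hu.2 t ht, neg_zero]⟩

theorem IsNormal.inner_pt (hu : T.IsNormal u) (j i : ℕ) :
    inner ℝ u (T.pt j i : EuclideanSpace ℝ (Fin (m + 1))) = 0 := hu.2 _ (T.abs_par_le j i)

theorem IsNormal.notMem_core (hu : T.IsNormal u) {j : ℕ} {x : UnitSphere m}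
    (hx : T.rad j ≤ inner ℝ u (x : EuclideanSpace ℝ (Fin (m + 1)))) :
    (x : EuclideanSpace ℝ (Fin (m + 1))) ∉ T.core j := by
  rintro ⟨i, hi, h⟩
  have := le_dist_of_le_inner hu.1 (hu.inner_pt j i) hx
  rw [dist_comm, Subtype.dist_eq] at this
  linarith

/-- The half space `⟪u, ·⟫ ≥ rad j` is convex for short arcs and disjoint from `core j`, because all
centres are orthogonal to `u`. -/
theorem IsNormal.d_le (hu : T.IsNormal u) {j : ℕ} (n : ℕ) {x y : UnitSphere m}
    (hx : T.rad j ≤ inner ℝ u (x : EuclideanSpace ℝ (Fin (m + 1))))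
    (hy : T.rad j ≤ inner ℝ u (y : EuclideanSpace ℝ (Fin (m + 1)))) (h : dist x y ≤ 1) :
    T.d n x y ≤ 2 * 64 ^ j * dist x y :=
  T.d_le_of_arc h (by positivity) fun _ ht => T.factor_le_of_notMem n
    (hu.notMem_core (le_inner_arc h ht (T.rad_pos j).le hx hy))

theorem IsNormal.le_inner_push (hu : T.IsNormal u) (j : ℕ) {x : UnitSphere m}
    (hx : 0 ≤ inner ℝ u (x : EuclideanSpace ℝ (Fin (m + 1)))) :
    T.rad j ≤ inner ℝ u (push u (T.rad j) x : EuclideanSpace ℝ (Fin (m + 1))) :=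
  _root_.le_inner_push hu.1 hx (T.rad_pos j).le (by linarith [T.rad_le j])

theorem IsNormal.dist_push_le (hu : T.IsNormal u) (j : ℕ) {x : UnitSphere m}
    (hx : 0 ≤ inner ℝ u (x : EuclideanSpace ℝ (Fin (m + 1)))) :
    dist x (push u (T.rad j) x) ≤ 4 * T.rad j :=
  _root_.dist_push_le hu.1 hx (T.rad_pos j).le

/-- By `le_dist_arc_push` the path stays outside `core j`, so a Euclidean length of order `rad j`
costs of order `64 ^ j * rad j = a j`. -/
theorem IsNormal.d_push_le (hu : T.IsNormal u) {j : ℕ} (n : ℕ) {x : UnitSphere m}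
    (hx : 0 ≤ inner ℝ u (x : EuclideanSpace ℝ (Fin (m + 1))))
    (h : (x : EuclideanSpace ℝ (Fin (m + 1))) ∉ T.core j) :
    T.d n x (push u (T.rad j) x) ≤ 8 * T.a j := by
  have hr := T.rad_pos j
  have hr1 := T.rad_le j
  have hd := hu.dist_push_le j hx
  have h1 : T.d n x (push u (T.rad j) x) ≤ 2 * 64 ^ j * dist x (push u (T.rad j) x) := by
    refine T.d_le_of_arc (by linarith) (by positivity) fun t ht => T.factor_le_of_notMem n ?_
    rintro ⟨i, hi, hlt⟩
    have h2 : T.rad j ≤ dist (T.pt j i) x := by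
      by_contra hlt
      refine h ⟨i, hi, ?_⟩
      rw [← Subtype.dist_eq, dist_comm]
      exact not_le.1 hlt
    have h3 := le_dist_arc_push hu.1 hx hr.le (by linarith) (hu.inner_pt j i) hr.le
      (by linarith) ht h2
    rw [dist_comm, Subtype.dist_eq] at h3
    linarith
  calc _ ≤ 2 * 64 ^ j * (4 * T.rad j) := h1.trans (by gcongr)
    _ = 8 * (64 ^ j * T.rad j) := by ring
    _ = _ := by rw [T.pow_mul_rad]

variable (T)

/-- The tails of the series of the sizes. -/
noncomputable def tail (i : ℕ) : ℝ := ∑' j, T.a (j + i)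

theorem summable_a_add (i : ℕ) : Summable fun j => T.a (j + i) :=
  (summable_nat_add_iff i).2 T.summable_a

theorem tail_eq (i : ℕ) : T.tail i = T.a i + T.tail (i + 1) := by
  rw [tail, (T.summable_a_add i).tsum_eq_zero_add, zero_add, tail]
  simp [add_assoc, add_comm 1]

theorem tail_nonneg (i : ℕ) : 0 ≤ T.tail i := tsum_nonneg fun _ => (T.a_pos _).le

theorem a_le_tail (i : ℕ) : T.a i ≤ T.tail i := by
  linarith [T.tail_eq i, T.tail_nonneg (i + 1)]

theorem tail_pos (i : ℕ) : 0 < T.tail i := (T.a_pos i).trans_le (T.a_le_tail i)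

theorem tendsto_tail : Tendsto T.tail atTop (𝓝 0) := tendsto_sum_nat_add T.a

/-- The children of a ball sit at its centre and possibly at parameter `+ rad j / 8`. The point at
parameter `- rad j / 8` is thus free of them, and being orthogonal to every normal `u`, it is a
window for crossing from the `u` side to the `-u` side. -/
theorem exists_gap {j k : ℕ} (hk : k < T.num j) : ∃ g : UnitSphere m,
    dist g (T.pt j k) ≤ T.rad j ∧ (g : EuclideanSpace ℝ (Fin (m + 1))) ∉ T.core (j + 1) ∧
    ∀ u, T.IsNormal u → inner ℝ u (g : EuclideanSpace ℝ (Fin (m + 1))) = 0 := by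
  have hr := T.rad_pos j
  have hpar := T.par_nonneg j k
  have hpar' := T.par_add_rad_le j k
  have ht : |T.par j k - T.rad j / 8| ≤ 1 / 2 := abs_le.2 ⟨by linarith, by linarith⟩
  have hd : dist (T.curve (T.par j k - T.rad j / 8)) (T.pt j k) ≤ T.rad j := by
    refine (T.dist_curve_le ht (T.abs_par_le j k)).trans ?_
    rw [sub_sub_cancel_left, abs_neg, abs_of_pos (by positivity)]
    linarith
  refine ⟨T.curve (T.par j k - T.rad j / 8), hd, ?_, fun u hu => hu.2 _ ht⟩
  rintro ⟨i, hi, hlt⟩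
  have h1 := T.dist_parent_lt hlt.le
  have h2 : i / T.b j = k :=
    T.eq_of_dist_le (T.div_lt_num hi) hk (h1.le.trans (by linarith)) (by rwa [← Subtype.dist_eq])
  have h3 := T.abs_sub_le_dist_curve ht (T.abs_par_le (j + 1) i)
  have h4 := T.par_le_par j i
  rw [h2] at h4
  have h5 := neg_abs_le (T.par j k - T.rad j / 8 - T.par (j + 1) i)
  have h6 : dist (T.curve (T.par j k - T.rad j / 8)) (T.curve (T.par (j + 1) i)) < T.rad (j + 1) :=
    hlt
  linarith [T.rad_succ_le j]

variable {T}

theorem IsNormal.d_push_pt_le_of_le_inner (hu : T.IsNormal u) {i k n : ℕ} {y : UnitSphere m}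
    (hy : T.rad (i + 1) ≤ inner ℝ u (y : EuclideanSpace ℝ (Fin (m + 1))))
    (hd : dist y (T.pt i k) ≤ 2 * T.rad i) :
    T.d n y (push u (T.rad i) (T.pt i k)) ≤ 768 * T.a i := by
  have h0 := (hu.inner_pt i k).ge
  have hr := T.rad_pos i
  have hr1 := T.rad_le i
  have h1 := hu.le_inner_push i h0
  have h2 := hu.dist_push_le i h0
  have h3 : dist y (push u (T.rad i) (T.pt i k)) ≤ 6 * T.rad i := by
    linarith [dist_triangle y (T.pt i k) (push u (T.rad i) (T.pt i k))]
  have h4 : T.rad (i + 1) ≤ T.rad i := by linarith [T.rad_succ_le i]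
  calc _ ≤ 2 * 64 ^ (i + 1) * dist y (push u (T.rad i) (T.pt i k)) :=
        hu.d_le n hy (h4.trans h1) (by linarith)
    _ ≤ 2 * 64 ^ (i + 1) * (6 * T.rad i) := by gcongr
    _ = 768 * (64 ^ i * T.rad i) := by ring
    _ = _ := by rw [T.pow_mul_rad]

theorem IsNormal.d_push_pt_le_of_notMem (hu : T.IsNormal u) {i k n : ℕ} {y : UnitSphere m}
    (hy : 0 ≤ inner ℝ u (y : EuclideanSpace ℝ (Fin (m + 1))))
    (hyc : (y : EuclideanSpace ℝ (Fin (m + 1))) ∉ T.core (i + 1))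
    (hd : dist y (T.pt i k) ≤ T.rad i) :
    T.d n y (push u (T.rad i) (T.pt i k)) ≤ 776 * T.a i := by
  have hr := T.rad_pos i
  have h1 := hu.d_push_le n hy hyc
  have h2 := hu.dist_push_le (i + 1) hy
  have h3 := hu.d_push_pt_le_of_le_inner (n := n) (k := k) (hu.le_inner_push (i + 1) hy) (by
    rw [dist_comm] at h2
    linarith [dist_triangle (push u (T.rad (i + 1)) y) y (T.pt i k), T.rad_succ_le i])
  have := T.a_antitone i.le_succ
  linarith [T.d_triangle n y (push u (T.rad (i + 1)) y) (push u (T.rad i) (T.pt i k))]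

/-- The pushed centre serves as a hub of the ball. A point in a child ball first travels to the
child's hub and then to the parent's at cost `O(a i)`; the costs along the nested balls add up to
the tail. The constant `2328 = 3 * 776` accounts for the three legs needed on the wrong side of `u`.
-/
theorem IsNormal.d_push_pt_le (hu : T.IsNormal u) {i k n : ℕ} (hin : i ≤ n) (hk : k < T.num i)
    {x : UnitSphere m} (hd : dist x (T.pt i k) ≤ T.rad i) :
    T.d n x (push u (T.rad i) (T.pt i k)) ≤ 2328 * T.tail i := by
  induction hin using Nat.decreasingInduction generalizing u k x with
  -- At level `n` no deeper bumps are present, and the global bound `factor ≤ 64 ^ n` suffices.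
  | self =>
    have h0 := (hu.inner_pt n k).ge
    have h2 := hu.dist_push_le n h0
    have hr1 := T.rad_le n
    have h3 : dist x (push u (T.rad n) (T.pt n k)) ≤ 5 * T.rad n := by
      linarith [dist_triangle x (T.pt n k) (push u (T.rad n) (T.pt n k))]
    calc _ ≤ 2 * 64 ^ n * dist x (push u (T.rad n) (T.pt n k)) := T.d_le_pow_mul (by linarith)
      _ ≤ 2 * 64 ^ n * (5 * T.rad n) := by gcongr
      _ = 10 * (64 ^ n * T.rad n) := by ring
      _ = 10 * T.a n := by rw [T.pow_mul_rad]
      _ ≤ _ := by linarith [T.a_le_tail n, T.tail_nonneg n]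
  | of_succ i hin ih =>
    have hr := T.rad_pos i
    have ha := T.a_pos i
    have htail := T.tail_nonneg (i + 1)
    rw [T.tail_eq i]
    by_cases hx : (x : EuclideanSpace ℝ (Fin (m + 1))) ∈ T.core (i + 1)
    · obtain ⟨k', hk', hlt⟩ := hx
      have h1 := T.dist_parent_lt hlt.le
      have h2 : k' / T.b i = k := T.eq_of_dist_le (T.div_lt_num hk') hk
        (h1.le.trans (by linarith)) (by rwa [← Subtype.dist_eq])
      have h3 := ih hu hk' hlt.le
      have h0 := (hu.inner_pt (i + 1) k').ge
      have h4 := hu.dist_push_le (i + 1) h0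
      have h5 := T.dist_pt_parent_le i k'
      rw [h2] at h5
      rw [dist_comm] at h4
      have h6 := hu.d_push_pt_le_of_le_inner (n := n) (k := k) (hu.le_inner_push (i + 1) h0) (by
        linarith [dist_triangle (push u (T.rad (i + 1)) (T.pt (i + 1) k')) (T.pt (i + 1) k')
          (T.pt i k), T.rad_succ_le i])
      linarith [T.d_triangle n x (push u (T.rad (i + 1)) (T.pt (i + 1) k'))
        (push u (T.rad i) (T.pt i k))]
    · rcases le_total 0 (inner ℝ u (x : EuclideanSpace ℝ (Fin (m + 1)))) with h0 | h0
      · linarith [hu.d_push_pt_le_of_notMem (n := n) (k := k) h0 hx hd]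
      -- On the wrong side, the path goes to the hub of `-u`, from there to the gap point `g`, and
      -- from `g` to the hub of `u`.
      · obtain ⟨g, hg, hgc, hgu⟩ := T.exists_gap hk
        have h1 := hu.neg.d_push_pt_le_of_notMem (n := n) (k := k)
          (by rw [inner_neg_left]; linarith) hx hd
        have h2 := hu.neg.d_push_pt_le_of_notMem (n := n) (hgu _ hu.neg).ge hgc hg
        have h3 := hu.d_push_pt_le_of_notMem (n := n) (hgu _ hu).ge hgc hg
        rw [T.d_comm] at h2
        linarith [T.d_triangle n x (push (-u) (T.rad i) (T.pt i k)) (push u (T.rad i) (T.pt i k)),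
          T.d_triangle n (push (-u) (T.rad i) (T.pt i k)) g (push u (T.rad i) (T.pt i k))]

variable (T)

/-- The balls of level `i` have diameter at most a multiple of the tail. -/
theorem d_le_tail {i k : ℕ} (n : ℕ) (hk : k < T.num i) {x y : UnitSphere m}
    (hx : dist x (T.pt i k) ≤ T.rad i) (hy : dist y (T.pt i k) ≤ T.rad i) :
    T.d n x y ≤ 4656 * T.tail i := by
  refine (T.d_mono x y (le_max_left n i)).trans ?_
  have h1 := T.isNormal_frame.d_push_pt_le (le_max_right n i) hk hx
  have h2 := T.isNormal_frame.d_push_pt_le (le_max_right n i) hk hy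
  rw [d_comm] at h2
  linarith [T.d_triangle (max n i) x (push (T.frame 2) (T.rad i) (T.pt i k)) y]

variable {T}

/-- Points inside a ball of level `i` are moved to its hub, all others are pushed off directly.
Lifted points can then be joined by an arc on which the factor is at most `64 ^ i`. -/
theorem IsNormal.exists_lift (hu : T.IsNormal u) {i n : ℕ} (hin : i ≤ n) {x : UnitSphere m}
    (hx : 0 ≤ inner ℝ u (x : EuclideanSpace ℝ (Fin (m + 1)))) : ∃ x' : UnitSphere m,
      T.rad i ≤ inner ℝ u (x' : EuclideanSpace ℝ (Fin (m + 1))) ∧ dist x x' ≤ 5 * T.rad i ∧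
      T.d n x x' ≤ 2336 * T.tail i := by
  have hr := T.rad_pos i
  have htail := T.tail_nonneg i
  by_cases hxc : (x : EuclideanSpace ℝ (Fin (m + 1))) ∈ T.core i
  · obtain ⟨k, hk, hlt⟩ := hxc
    rw [← Subtype.dist_eq] at hlt
    have h0 := (hu.inner_pt i k).ge
    refine ⟨_, hu.le_inner_push i h0, ?_, (hu.d_push_pt_le hin hk hlt.le).trans (by linarith)⟩
    linarith [dist_triangle x (T.pt i k) (push u (T.rad i) (T.pt i k)), hu.dist_push_le i h0]
  · refine ⟨_, hu.le_inner_push i hx, (hu.dist_push_le i hx).trans (by linarith), ?_⟩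
    linarith [hu.d_push_le n hx hxc, T.a_le_tail i]

theorem IsNormal.d_le_of_nonneg (hu : T.IsNormal u) {i n : ℕ} (hin : i ≤ n) {x z : UnitSphere m}
    (hx : 0 ≤ inner ℝ u (x : EuclideanSpace ℝ (Fin (m + 1))))
    (hz : 0 ≤ inner ℝ u (z : EuclideanSpace ℝ (Fin (m + 1)))) (h : dist x z ≤ 3 / 8) :
    T.d n x z ≤ 2 * 64 ^ i * dist x z + 5000 * T.tail i := by
  obtain ⟨x', hx1, hx2, hx3⟩ := hu.exists_lift hin hx
  obtain ⟨z', hz1, hz2, hz3⟩ := hu.exists_lift hin hz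
  have hr := T.rad_le i
  have h1 : dist x' z' ≤ dist x z + 10 * T.rad i := by
    rw [dist_comm] at hx2
    linarith [dist_triangle4 x' x z z']
  have h2 : T.d n x' z' ≤ 2 * 64 ^ i * dist x z + 20 * T.a i := by
    calc _ ≤ 2 * 64 ^ i * dist x' z' := hu.d_le n hx1 hz1 (by linarith)
      _ ≤ 2 * 64 ^ i * (dist x z + 10 * T.rad i) := by gcongr
      _ = 2 * 64 ^ i * dist x z + 20 * (64 ^ i * T.rad i) := by ring
      _ = _ := by rw [T.pow_mul_rad]
  rw [d_comm] at hz3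
  linarith [T.d_triangle n x x' z, T.d_triangle n x' z' z, T.a_le_tail i, T.tail_nonneg i]

variable (T)

/-- A bound for the distance that is uniform in `n`. -/
theorem d_le (i n : ℕ) {x z : UnitSphere m} (h : dist x z ≤ 3 / 8) :
    T.d n x z ≤ 4 * 64 ^ i * dist x z + 10000 * T.tail i := by
  refine (T.d_mono x z (le_max_left n i)).trans ?_
  have hin := le_max_right n i
  set k := max n i
  have htail := T.tail_nonneg i
  have hpos : 0 ≤ 64 ^ i * dist x z := by positivity
  have key : ∀ {u : EuclideanSpace ℝ (Fin (m + 1))}, T.IsNormal u →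
      0 ≤ inner ℝ u (x : EuclideanSpace ℝ (Fin (m + 1))) →
      T.d k x z ≤ 4 * 64 ^ i * dist x z + 10000 * T.tail i := by
    intro u hu hx
    rcases le_total 0 (inner ℝ u (z : EuclideanSpace ℝ (Fin (m + 1)))) with hz | hz
    · linarith [hu.d_le_of_nonneg hin hx hz h]
    · have hxz : ‖(z - x : EuclideanSpace ℝ (Fin (m + 1)))‖ ≤ 1 := by
        rw [← dist_unitSphere]; linarith
      -- When the endpoints lie on opposite sides, the arc is cut where it crosses the great sphere
      -- `⟪u, ·⟫ = 0`. The crossing point is admissible for both `u` and `-u`.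
      have hcont : ContinuousOn
          (fun t => inner ℝ u (arc x z t : EuclideanSpace ℝ (Fin (m + 1)))) (Icc 0 1) :=
        (continuous_const.inner (contDiff_arc hxz).continuous).continuousOn
      obtain ⟨t, ht, hc⟩ := intermediate_value_Icc' zero_le_one hcont
        (show (0 : ℝ) ∈ Icc _ _ by simpa [arc_zero, arc_one] using ⟨hz, hx⟩)
      have h1 : dist x (arc x z t) ≤ dist x z :=
        dist_arc_le (by linarith) ht (by linarith) (by simp) le_rfl
      have h2 : dist z (arc x z t) ≤ dist x z :=
        dist_arc_le (by linarith) ht (by linarith) (dist_comm z x).le (by simp)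
      have h3 := hu.d_le_of_nonneg hin hx hc.ge (h1.trans h)
      have h4 := hu.neg.d_le_of_nonneg hin (by rw [inner_neg_left]; linarith)
        (by rw [inner_neg_left]; exact (neg_eq_zero.2 hc).ge) (h2.trans h)
      rw [d_comm] at h4
      have h5 := mul_le_mul_of_nonneg_left h1 (by positivity : (0 : ℝ) ≤ 2 * 64 ^ i)
      have h6 := mul_le_mul_of_nonneg_left h2 (by positivity : (0 : ℝ) ≤ 2 * 64 ^ i)
      linarith [T.d_triangle k x (arc x z t) z]
  rcases le_total 0 (inner ℝ (T.frame 2) (x : EuclideanSpace ℝ (Fin (m + 1)))) with hx | hx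
  · exact key T.isNormal_frame hx
  · exact key T.isNormal_frame.neg (by rw [inner_neg_left]; linarith)

end CantorTree

/-! ### Lower bounds along branches and the limit space. -/

namespace CantorTree

variable {m : ℕ} (T : CantorTree m)

/-- A branch of the tree. -/
def IsBranch (c : ℕ → ℕ) : Prop := ∀ i, c i < T.num i ∧ c (i + 1) / T.b i = c i

/-- The cumulated bump functions along a branch, from level `j` on. -/
noncomputable def branchBump (c : ℕ → ℕ) (j n : ℕ) (x : EuclideanSpace ℝ (Fin (m + 1))) : ℝ :=
  ∑ i ∈ Finset.Ico j n, T.a i * bump (T.pt i (c i) : EuclideanSpace ℝ (Fin (m + 1))) (T.rad i) x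

variable {T} {c c' : ℕ → ℕ}

theorem IsBranch.dist_lt_of_dist_lt (hc : T.IsBranch c) {j n : ℕ} (h : j ≤ n)
    {x : EuclideanSpace ℝ (Fin (m + 1))} (hx : dist x (T.pt n (c n)) < T.rad n) :
    dist x (T.pt j (c j)) < T.rad j := by
  induction n, h using Nat.le_induction with
  | base => exact hx
  | succ n hn ih =>
    have h1 := T.dist_parent_lt hx.le
    rw [(hc n).2] at h1
    exact ih (h1.trans (by linarith [T.rad_pos n]))

theorem IsBranch.dist_lt_of_dist_le (hc : T.IsBranch c) {j n : ℕ} (h : j < n)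
    {x : EuclideanSpace ℝ (Fin (m + 1))} (hx : dist x (T.pt n (c n)) ≤ T.rad n) :
    dist x (T.pt j (c j)) < T.rad j / 2 := by
  obtain ⟨n, rfl⟩ : ∃ k, n = k + 1 := ⟨n - 1, by omega⟩
  have h1 := T.dist_parent_lt hx
  rw [(hc n).2] at h1
  rcases (Nat.lt_succ_iff.1 h).eq_or_lt with rfl | hlt
  · exact h1
  · have h2 := hc.dist_lt_of_dist_lt (Nat.succ_le_of_lt hlt)
      (h1.trans (by linarith [T.rad_pos n]))
    have h3 := T.dist_parent_lt h2.le
    rwa [(hc j).2] at h3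

theorem contDiff_branchBump (j n : ℕ) : ContDiff ℝ ∞ (T.branchBump c j n) :=
  ContDiff.sum fun _ _ => contDiff_const.mul (contDiff_bump _ _)

theorem IsBranch.branchBump_eq_sum (hc : T.IsBranch c) {j n : ℕ}
    {x : EuclideanSpace ℝ (Fin (m + 1))} (hx : dist x (T.pt n (c n)) ≤ T.rad n) :
    T.branchBump c j n x = ∑ i ∈ Finset.Ico j n, T.a i := by
  refine Finset.sum_congr rfl fun i hi => ?_
  rw [bump_eq_one (T.rad_pos i) (hc.dist_lt_of_dist_le (Finset.mem_Ico.1 hi).2 hx).le, mul_one]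

theorem IsBranch.branchBump_eq_zero (hc : T.IsBranch c) {j n : ℕ}
    {x : EuclideanSpace ℝ (Fin (m + 1))} (hx : T.rad j ≤ dist x (T.pt j (c j))) :
    T.branchBump c j n x = 0 := by
  refine Finset.sum_eq_zero fun i hi => ?_
  rw [bump_eq_zero (T.rad_pos i), mul_zero]
  by_contra hlt
  exact absurd (hc.dist_lt_of_dist_lt (Finset.mem_Ico.1 hi).1 (not_le.1 hlt)) (not_lt.2 hx)

/-- Where the bump of level `n` varies, all earlier bumps of the branch are constant, so the
gradients do not add up. The single gradient is at most `a n * G / rad n = G * 64 ^ n` with `G =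
bumpConst m`, and the factor is at least `64 ^ n` there. -/
theorem IsBranch.norm_fderiv_branchBump_le (hc : T.IsBranch c) {j n : ℕ} (h : j ≤ n)
    (x : EuclideanSpace ℝ (Fin (m + 1))) :
    ‖fderiv ℝ (T.branchBump c j n) x‖ ≤ bumpConst m * T.factor n x := by
  have hG := zero_le_one.trans (one_le_bumpConst m)
  induction n, h using Nat.le_induction with
  | base =>
    have h0 : T.branchBump c j j = fun _ => 0 := by ext x; simp [branchBump]
    rw [h0, fderiv_fun_const]
    simpa using mul_nonneg hG (T.factor_pos j x).le
  | succ n hn ih =>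
    have h1 : T.branchBump c j (n + 1) = fun x => T.branchBump c j n x +
        T.a n • bump (T.pt n (c n) : EuclideanSpace ℝ (Fin (m + 1))) (T.rad n) x := by
      ext x; rw [branchBump, Finset.sum_Ico_succ_top hn, smul_eq_mul]; rfl
    have h2 : fderiv ℝ (T.branchBump c j (n + 1)) x = fderiv ℝ (T.branchBump c j n) x +
        T.a n • fderiv ℝ (bump (T.pt n (c n) : EuclideanSpace ℝ (Fin (m + 1))) (T.rad n)) x := by
      rw [h1]
      exact (((contDiff_branchBump j n).differentiable (by simp) x).hasFDerivAt.add
        (((contDiff_bump _ _).differentiable (by simp) x).hasFDerivAt.const_smul (T.a n))).fderiv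
    rw [h2]
    by_cases hx : dist x (T.pt n (c n)) < T.rad n
    · have h3 : fderiv ℝ (T.branchBump c j n) x = 0 := by
        have : T.branchBump c j n =ᶠ[𝓝 x] fun _ => ∑ i ∈ Finset.Ico j n, T.a i := by
          filter_upwards [Metric.isOpen_ball.mem_nhds (Metric.mem_ball.2 hx)] with y hy
          exact hc.branchBump_eq_sum (le_of_lt hy)
        rw [this.fderiv_eq, fderiv_fun_const]
        rfl
      have h4 : (64 : ℝ) ^ n ≤ T.factor (n + 1) x := by
        rw [← T.factor_eq_of_mem ⟨c n, (hc n).1, hx⟩]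
        exact T.factor_mono x n.le_succ
      rw [h3, zero_add, norm_smul, Real.norm_of_nonneg (T.a_pos n).le]
      calc _ ≤ T.a n * (bumpConst m / T.rad n) :=
            mul_le_mul_of_nonneg_left (norm_fderiv_bump_le (T.rad_pos n)) (T.a_pos n).le
        _ = bumpConst m * 64 ^ n := by
            have := T.a_pos n
            unfold rad
            field_simp
        _ ≤ _ := by gcongr
    · rw [fderiv_bump_eq_zero (T.rad_pos n) (not_lt.1 hx), smul_zero, add_zero]
      exact ih.trans (mul_le_mul_of_nonneg_left (T.factor_mono x n.le_succ) hG)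

/-- Leaving a ball of level `j` from a point deep in the Cantor set is expensive. -/
theorem IsBranch.sum_le_d (hc : T.IsBranch c) {j n : ℕ} (h : j ≤ n) {x y : UnitSphere m}
    (hx : dist x (T.pt n (c n)) ≤ T.rad n) (hy : T.rad j ≤ dist y (T.pt j (c j))) :
    ∑ i ∈ Finset.Ico j n, T.a i ≤ bumpConst m * T.d n x y := by
  have hG := zero_lt_one.trans_le (one_le_bumpConst m)
  have hd : ∀ z, ‖fderiv ℝ (fun x => (bumpConst m)⁻¹ • T.branchBump c j n x) z‖ ≤ T.factor n z := by
    intro z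
    have h1 : fderiv ℝ (fun x => (bumpConst m)⁻¹ • T.branchBump c j n x) z =
        (bumpConst m)⁻¹ • fderiv ℝ (T.branchBump c j n) z :=
      (((contDiff_branchBump j n).differentiable (by simp) z).hasFDerivAt.const_smul
        (bumpConst m)⁻¹).fderiv
    rw [h1, norm_smul, norm_inv, Real.norm_of_nonneg hG.le, inv_mul_le_iff₀ hG]
    exact hc.norm_fderiv_branchBump_le h z
  have h2 := T.abs_sub_le_d
    (((contDiff_branchBump (T := T) (c := c) j n).const_smul (bumpConst m)⁻¹).of_le (by simp))
    hd x y
  rw [Subtype.dist_eq] at hx hy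
  rw [hc.branchBump_eq_sum hx, hc.branchBump_eq_zero hy, smul_zero, sub_zero, smul_eq_mul] at h2
  rw [← inv_mul_le_iff₀ hG]
  exact (le_abs_self _).trans h2

variable (T)

/-- Nearby points are at distance bounded uniformly in `n`, so the set of points with bounded
distance to `x` is clopen, hence everything; compactness makes the bound uniform. -/
theorem exists_d_le_of_forall (x : UnitSphere m) : ∃ C, ∀ n y, T.d n x y ≤ C := by
  have := connectedSpace_unitSphere T.two_le
  have hloc : ∀ n (y z : UnitSphere m), dist y z ≤ 3 / 8 → T.d n y z ≤ 2 + 10000 * T.tail 0 := by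
    intro n y z h
    have := T.d_le 0 n h
    rw [pow_zero] at this
    linarith
  have hopen : ∀ y z : UnitSphere m, dist y z ≤ 3 / 8 → (∃ C, ∀ n, T.d n x y ≤ C) →
      ∃ C, ∀ n, T.d n x z ≤ C := by
    rintro y z h ⟨C, hC⟩
    exact ⟨C + (2 + 10000 * T.tail 0), fun n =>
      (T.d_triangle n x y z).trans (add_le_add (hC n) (hloc n y z h))⟩
  have hclopen : IsClopen {y : UnitSphere m | ∃ C, ∀ n, T.d n x y ≤ C} := by
    constructor
    · rw [← isOpen_compl_iff, Metric.isOpen_iff]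
      refine fun y hy => ⟨3 / 8, by norm_num, fun z hz hz' => hy ?_⟩
      exact hopen z y (Metric.mem_ball.1 hz).le hz'
    · rw [Metric.isOpen_iff]
      exact fun y hy => ⟨3 / 8, by norm_num, fun z hz =>
        hopen y z (by rw [dist_comm]; exact (Metric.mem_ball.1 hz).le) hy⟩
  have huniv := hclopen.eq_univ ⟨x, 0, fun n => (T.d_self n x).le⟩
  have hcpt : ∃ C, ∀ y ∈ (univ : Set (UnitSphere m)), ∀ n, T.d n x y ≤ C := by
    refine isCompact_univ.induction_on (p := fun s => ∃ C, ∀ y ∈ s, ∀ n, T.d n x y ≤ C)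
      ⟨0, by simp⟩ ?_ ?_ ?_
    · rintro s t hst ⟨C, hC⟩
      exact ⟨C, fun y hy => hC y (hst hy)⟩
    · rintro s t ⟨C, hC⟩ ⟨C', hC'⟩
      refine ⟨max C C', ?_⟩
      rintro y (hy | hy) n
      · exact (hC y hy n).trans (le_max_left _ _)
      · exact (hC' y hy n).trans (le_max_right _ _)
    · intro y _
      obtain ⟨C, hC⟩ : y ∈ {y : UnitSphere m | ∃ C, ∀ n, T.d n x y ≤ C} := huniv ▸ mem_univ y
      refine ⟨Metric.ball y (3 / 8), mem_nhdsWithin_of_mem_nhds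
        (Metric.ball_mem_nhds y (by norm_num)), C + (2 + 10000 * T.tail 0), fun z hz n => ?_⟩
      exact (T.d_triangle n x y z).trans (add_le_add (hC n) (hloc n y z
        (by rw [dist_comm]; exact (Metric.mem_ball.1 hz).le)))
  obtain ⟨C, hC⟩ := hcpt
  exact ⟨C, fun n y => hC y trivial n⟩

/-- The diameters of the conformal metrics are bounded. -/
theorem exists_d_le : ∃ C, 0 ≤ C ∧ ∀ n x y, T.d n x y ≤ C := by
  obtain ⟨C, hC⟩ := T.exists_d_le_of_forall (Classical.arbitrary _)
  refine ⟨C + C, ?_, fun n x y => (T.d_triangle n x (Classical.arbitrary _) y).trans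
    (add_le_add ((T.d_comm _ _ _).trans_le (hC n x)) (hC n y))⟩
  have := (T.d_nonneg 0 _ _).trans (hC 0 (Classical.arbitrary _))
  linarith

/-- The limit distance. -/
noncomputable def limDist (x y : UnitSphere m) : ℝ := ⨆ n, T.d n x y

theorem bddAbove_d (x y : UnitSphere m) : BddAbove (range fun n => T.d n x y) := by
  obtain ⟨C, -, hC⟩ := T.exists_d_le
  exact ⟨C, by rintro _ ⟨n, rfl⟩; exact hC n x y⟩

theorem d_le_limDist (n : ℕ) (x y : UnitSphere m) : T.d n x y ≤ T.limDist x y :=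
  le_ciSup (T.bddAbove_d x y) n

theorem limDist_le {x y : UnitSphere m} {C : ℝ} (h : ∀ n, T.d n x y ≤ C) : T.limDist x y ≤ C :=
  ciSup_le h

theorem tendsto_d (x y : UnitSphere m) : Tendsto (fun n => T.d n x y) atTop (𝓝 (T.limDist x y)) :=
  tendsto_atTop_ciSup (T.d_mono x y) (T.bddAbove_d x y)

theorem eq_of_d_eq_zero {n : ℕ} {x y : UnitSphere m} (h : T.d n x y = 0) : x = y := by
  have h1 : (T.metric n).edist x y = 0 := by rw [← T.ofReal_d, h, ENNReal.ofReal_zero]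
  exact (T.metric n).toEMetricSpace.eq_of_edist_eq_zero h1

theorem limDist_self (x : UnitSphere m) : T.limDist x x = 0 := by simp [limDist, d_self]

/-- The limit space: the sphere with the limit distance. -/
def Limit (_T : CantorTree m) : Type := UnitSphere m

noncomputable instance : MetricSpace T.Limit where
  dist := T.limDist
  dist_self := T.limDist_self
  dist_comm x y := by simp only [limDist, T.d_comm _ x y]
  dist_triangle x y z := T.limDist_le fun n => (T.d_triangle n x y z).trans
    (add_le_add (T.d_le_limDist n x y) (T.d_le_limDist n y z))
  eq_of_dist_eq_zero {x y} h := T.eq_of_d_eq_zero (n := 0)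
    (le_antisymm ((T.d_le_limDist 0 x y).trans h.le) (T.d_nonneg 0 x y))

/-- The identity map from the sphere to the limit space. -/
def toLimit : UnitSphere m ≃ T.Limit := Equiv.refl _

theorem dist_toLimit (x y : UnitSphere m) :
    dist (T.toLimit x) (T.toLimit y) = T.limDist x y := rfl

/-- Equicontinuity: `i` is chosen first to make the tail term of `d_le` small, then `δ` to absorb
the factor `64 ^ i`. -/
theorem exists_forall_limDist_le {ε : ℝ} (hε : 0 < ε) :
    ∃ δ > 0, ∀ x y : UnitSphere m, dist x y ≤ δ → T.limDist x y ≤ ε := by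
  have h1 : Tendsto (fun i => 10000 * T.tail i) atTop (𝓝 (10000 * 0)) := T.tendsto_tail.const_mul _
  rw [mul_zero] at h1
  obtain ⟨i, hi⟩ := (h1.eventually_lt_const (half_pos hε)).exists
  refine ⟨min (3 / 8) (ε / 2 / (4 * 64 ^ i)), by positivity, fun x y h => T.limDist_le fun n => ?_⟩
  have h2 := h.trans (min_le_right _ _)
  rw [le_div_iff₀ (by positivity)] at h2
  linarith [T.d_le i n (h.trans (min_le_left _ _))]

theorem continuous_toLimit : Continuous T.toLimit := by
  refine Metric.continuous_iff.2 fun x ε hε => ?_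
  obtain ⟨δ, hδ, h⟩ := T.exists_forall_limDist_le (half_pos hε)
  exact ⟨δ, hδ, fun y hy => (h y x hy.le).trans_lt (half_lt_self hε)⟩

instance : CompactSpace T.Limit :=
  ⟨by
    rw [← T.toLimit.surjective.range_eq]
    exact isCompact_range T.continuous_toLimit⟩

instance : Nonempty T.Limit := inferInstanceAs (Nonempty (UnitSphere m))

/-- The limit space is homeomorphic to the sphere. -/
noncomputable def limitHomeo : T.Limit ≃ₜ UnitSphere m :=
  (Continuous.homeoOfEquivCompactToT2 (f := T.toLimit) T.continuous_toLimit).symm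

noncomputable instance : MeasurableSpace T.Limit := borel _

instance : BorelSpace T.Limit := ⟨rfl⟩

/-- A finite net for the limit distance is a net for every `d n`, since `d n ≤ limDist`. On its
finitely many pairs pointwise convergence is uniform. -/
theorem tendsto_ghDist [ConnectedSpace (UnitSphere m)] :
    Tendsto (fun n => GromovHausdorff.ghDist (T.metric n).Space T.Limit) atTop (𝓝 0) := by
  rw [Metric.tendsto_atTop]
  intro ε hε
  obtain ⟨δ, hδ, h⟩ := T.exists_forall_limDist_le (by positivity : 0 < ε / 4)
  obtain ⟨s, -, hs, hcov⟩ := (isCompact_univ (X := UnitSphere m)).finite_cover_balls hδ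
  have hclose : ∀ᶠ n in atTop, ∀ x ∈ s, ∀ y ∈ s, |T.d n x y - T.limDist x y| ≤ ε / 4 := by
    rw [Filter.eventually_all_finite hs]
    intro x _
    rw [Filter.eventually_all_finite hs]
    intro y _
    filter_upwards [Metric.tendsto_nhds.1 (T.tendsto_d x y) _ (by positivity : 0 < ε / 4)]
      with n hn using le_of_lt hn
  obtain ⟨N, hN⟩ := Filter.eventually_atTop.1 hclose
  refine ⟨N, fun n hn => ?_⟩
  have hnet : ∀ x : UnitSphere m, ∃ y ∈ s, T.limDist x y ≤ ε / 4 := by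
    intro x
    have hx := hcov (mem_univ x)
    simp only [mem_iUnion, Metric.mem_ball] at hx
    obtain ⟨y, hy, hxy⟩ := hx
    exact ⟨y, hy, h x y hxy.le⟩
  have key := GromovHausdorff.ghDist_le_of_approx_subsets (X := (T.metric n).Space)
    (Y := T.Limit) (s := s) (fun x : s => T.toLimit (x : UnitSphere m)) (ε₁ := ε / 4)
    (ε₂ := ε / 4) (ε₃ := ε / 4) ?_ ?_ ?_
  · rw [Real.dist_eq, sub_zero, abs_of_nonneg (by exact dist_nonneg)]
    linarith
  · intro x
    obtain ⟨y, hy, hxy⟩ := hnet x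
    exact ⟨y, hy, (T.d_le_limDist n x y).trans hxy⟩
  · intro x
    obtain ⟨y, hy, hxy⟩ := hnet (T.toLimit.symm x)
    exact ⟨⟨y, hy⟩, hxy⟩
  · exact fun x y => hN n hn x.1 x.2 y.1 y.2

end CantorTree

/-! ### Contraction of caps along great circle arcs. -/

section Contractible

variable {m : ℕ}

theorem continuous_arc_of_dist_le {A : Type*} [TopologicalSpace A] {f : A → UnitSphere m}
    {g : A → ℝ} (hf : Continuous f) (hg : Continuous g) {z : UnitSphere m}
    (h : ∀ a, dist (f a) z ≤ 1) : Continuous fun a => arc (f a) z (g a) := by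
  refine Topology.IsInducing.subtypeVal.continuous_iff.2 ?_
  have h1 : ∀ a, ‖(z - f a : EuclideanSpace ℝ (Fin (m + 1)))‖ ≤ 1 := fun a => by
    rw [← dist_unitSphere]; exact h a
  have h2 : (Subtype.val ∘ fun a => arc (f a) z (g a)) = fun a =>
      ‖(f a + g a • (z - f a) : EuclideanSpace ℝ (Fin (m + 1)))‖⁻¹ •
        (f a + g a • (z - f a) : EuclideanSpace ℝ (Fin (m + 1))) := by
    ext1 a
    exact coe_arc (h1 a) (g a)
  rw [h2]
  have h3 : Continuous fun a => (f a + g a • (z - f a) : EuclideanSpace ℝ (Fin (m + 1))) := by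
    fun_prop
  exact (h3.norm.inv₀ fun a => norm_ne_zero_iff.2 (chord_ne_zero (h1 a) _)).smul h3

/-- A set lying in a small cap is contractible in every set containing the cap. -/
theorem contractibleIn_of_subset_ball {A B : Set (UnitSphere m)} {z : UnitSphere m} {τ : ℝ}
    (h0 : 0 < τ) (h1 : τ ≤ 1) (hA : A ⊆ Metric.ball z τ) (hB : Metric.ball z τ ⊆ B) :
    ContractibleIn A B := by
  have hd : ∀ a : A, dist (a : UnitSphere m) z < τ := fun a => hA a.2
  have hmem : ∀ (t : unitInterval) (a : A), arc (a : UnitSphere m) z t ∈ B := by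
    intro t a
    refine hB ?_
    rw [Metric.mem_ball, dist_comm]
    refine dist_arc_lt ((hd a).le.trans h1) t.2 h1 ?_ (by rwa [dist_self])
    rw [dist_comm]
    exact hd a
  refine ⟨hA.trans hB, ⟨z, hB (Metric.mem_ball_self h0)⟩, ⟨⟨⟨fun p => ⟨_, hmem p.1 p.2⟩, ?_⟩,
    fun a => ?_, fun a => ?_⟩⟩⟩
  · refine Continuous.subtype_mk (continuous_arc_of_dist_le
      (f := fun p : unitInterval × A => (p.2 : UnitSphere m)) (by fun_prop) (by fun_prop)
      fun p => (hd p.2).le.trans h1) _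
  · exact Subtype.ext (arc_zero _ _)
  · exact Subtype.ext (arc_one _ _)

end Contractible

/-! ### The common contractibility function. -/

namespace CantorTree

variable {m : ℕ} (T : CantorTree m)

/-- The level is the first one with `a i < A`, cut off at `n`. -/
theorem exists_level (n : ℕ) (A : ℝ) :
    ∃ i ≤ n, (∀ j < i, A ≤ T.a j) ∧ (i = n ∨ T.a i < A) := by
  by_cases h : ∃ j, T.a j < A
  · classical
    refine ⟨min n (Nat.find h), min_le_left _ _, fun j hj => ?_, ?_⟩
    · exact not_lt.1 (Nat.find_min h (hj.trans_le (min_le_right _ _)))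
    · rcases le_total n (Nat.find h) with h1 | h1
      · exact Or.inl (min_eq_left h1)
      · rw [min_eq_right h1]
        exact Or.inr (Nat.find_spec h)
  · push Not at h
    exact ⟨n, le_rfl, fun j _ => h j, Or.inl rfl⟩

/-- The radius of a cap containing the metric ball of radius `s` around `z`. -/
noncomputable def capRadius (i : ℕ) (z : UnitSphere m) (s : ℝ) : ℝ :=
  2 * bumpConst m * s / T.factor i z

variable {T} {s : ℝ} {i n : ℕ} {z : UnitSphere m}

theorem capRadius_pos (hs : 0 < s) : 0 < T.capRadius i z s := by
  have := one_le_bumpConst m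
  have := T.factor_pos i z
  unfold capRadius
  positivity

theorem capRadius_le (hs : 0 < s) : T.capRadius i z s ≤ 2 * bumpConst m * s := by
  have := one_le_bumpConst m
  exact div_le_self (by positivity) (T.one_le_factor i z)

/-- The constant `256 * bumpConst m ^ 2` makes the variation of `1 / factor i` over the cap at most
half of its value at the centre. -/
theorem harnack (hs : 0 < s) (h : ∀ j < i, 256 * bumpConst m ^ 2 * s ≤ T.a j)
    {x : EuclideanSpace ℝ (Fin (m + 1))} (hx : dist x z ≤ T.capRadius i z s) :
    T.factor i z ≤ 2 * T.factor i x ∧ T.factor i x ≤ 2 * T.factor i z := by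
  have hG := one_le_bumpConst m
  have hz := T.factor_pos i z
  have hx0 := T.factor_pos i x
  have h1 := T.abs_inv_factor_sub_le (by positivity) h (z : EuclideanSpace ℝ (Fin (m + 1))) x
  have h2 : 64 * bumpConst m / (256 * bumpConst m ^ 2 * s) * dist (z : EuclideanSpace ℝ (Fin (m + 1))) x ≤
      (T.factor i z)⁻¹ / 2 := by
    calc _ ≤ 64 * bumpConst m / (256 * bumpConst m ^ 2 * s) * T.capRadius i z s := by
          rw [dist_comm]; gcongr
      _ = _ := by
          unfold capRadius
          field_simp
          norm_num
  obtain ⟨h3, h4⟩ := abs_le.1 (h1.trans h2)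
  constructor
  · have h5 : (T.factor i x)⁻¹ ≤ 2 * (T.factor i z)⁻¹ := by
      have := inv_pos.2 hz
      linarith
    rw [← div_eq_mul_inv, inv_eq_one_div, div_le_div_iff₀ hx0 hz] at h5
    linarith
  · have h5 : (T.factor i z)⁻¹ ≤ 2 * (T.factor i x)⁻¹ := by linarith
    rw [← div_eq_mul_inv, inv_eq_one_div, div_le_div_iff₀ hz hx0] at h5
    linarith

/-- The test function is `s` times the bump of the cap. Its gradient is at most `factor i z / 2`,
hence at most `factor n` by the Harnack inequality, and it drops by `s` from `z` to the outside of
the cap. -/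
theorem dist_lt_capRadius (hs : 0 < s) (h : ∀ j < i, 256 * bumpConst m ^ 2 * s ≤ T.a j)
    (hin : i ≤ n) {x : UnitSphere m} (hx : T.d n z x < s) : dist x z < T.capRadius i z s := by
  have hG := one_le_bumpConst m
  have hz := T.factor_pos i z
  have hr := capRadius_pos (T := T) (i := i) (z := z) hs
  by_contra hlt
  rw [not_lt] at hlt
  have hd : ∀ y, HasFDerivAt (fun y => s • bump (z : EuclideanSpace ℝ (Fin (m + 1)))
      (T.capRadius i z s) y) (s • fderiv ℝ (bump (z : EuclideanSpace ℝ (Fin (m + 1)))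
      (T.capRadius i z s)) y) y := fun y =>
    ((contDiff_bump _ _).differentiable (by simp) y).hasFDerivAt.const_smul s
  have h1 := T.abs_sub_le_d (n := n) (((contDiff_bump (z : EuclideanSpace ℝ (Fin (m + 1)))
    (T.capRadius i z s)).const_smul s).of_le (by simp)) (fun y => ?_) z x
  · rw [bump_eq_one hr (by rw [dist_self]; positivity), bump_eq_zero hr hlt, smul_zero, sub_zero,
      smul_eq_mul, mul_one, abs_of_pos hs] at h1
    linarith
  · rw [(hd y).fderiv]
    rcases le_total (T.capRadius i z s) (dist y z) with hy | hy
    · rw [fderiv_bump_eq_zero hr hy, smul_zero, norm_zero]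
      exact (T.factor_pos n y).le
    · rw [norm_smul, Real.norm_of_nonneg hs.le]
      calc _ ≤ s * (bumpConst m / T.capRadius i z s) :=
            mul_le_mul_of_nonneg_left (norm_fderiv_bump_le hr) hs.le
        _ = T.factor i z / 2 := by
            unfold capRadius
            field_simp
        _ ≤ T.factor i y := by linarith [(harnack hs h hy).1]
        _ ≤ _ := T.factor_mono y hin

/-- If `i = n` or the cap misses `core i`, the factor is comparable to `factor i z` on the cap, and
the arc to `z` has length `O(s)`. Otherwise `factor i z` is comparable to `64 ^ i`, and `d_le` gives
`O(s) + O(tail i)` with `tail i ≤ K * a i ^ α = O(s ^ α)`. -/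
theorem d_le_of_dist_lt_capRadius (hs : 0 < s) (hs1 : 16 * bumpConst m * s ≤ 1)
    (h : ∀ j < i, 256 * bumpConst m ^ 2 * s ≤ T.a j)
    (hin : i = n ∨ i ≤ n ∧ T.a i < 256 * bumpConst m ^ 2 * s) {α K : ℝ} (hα0 : 0 ≤ α)
    (hα1 : α ≤ 1) (hK : ∀ i, T.tail i ≤ K * T.a i ^ α) {x : UnitSphere m}
    (hx : dist x z < T.capRadius i z s) :
    T.d n z x ≤ (16 * bumpConst m + 10000 * K * (256 * bumpConst m ^ 2) ^ α) * s ^ α := by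
  have hG := one_le_bumpConst m
  have hz := T.factor_pos i z
  have hr := capRadius_pos (T := T) (i := i) (z := z) hs
  have hr1 : T.capRadius i z s ≤ 1 / 8 := (capRadius_le hs).trans (by linarith)
  have hs1' : s ≤ 1 := by nlinarith
  have hsα : s ≤ s ^ α := Real.self_le_rpow_of_le_one hs.le hs1' hα1
  have hK0 : 0 ≤ K := by
    have h1 := (T.tail_nonneg 0).trans (hK 0)
    exact nonneg_of_mul_nonneg_left h1 (Real.rpow_pos_of_pos (T.a_pos 0) α)
  have hmul : T.factor i z * T.capRadius i z s = 2 * bumpConst m * s := by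
    unfold capRadius; field_simp
  by_cases hcase : i = n ∨ ∀ y : UnitSphere m, dist y z < T.capRadius i z s →
      (y : EuclideanSpace ℝ (Fin (m + 1))) ∉ T.core i
  · have hfac : ∀ y : UnitSphere m, dist y z < T.capRadius i z s →
        T.factor n y ≤ 2 * T.factor i z := by
      intro y hy
      have h1 : T.factor n y = T.factor i y := by
        rcases hin with rfl | ⟨hin, -⟩
        · rfl
        · rcases hcase with rfl | hcase
          · rfl
          · exact T.factor_eq_of_notMem hin (hcase y hy)
      rw [h1]
      exact (harnack hs h hy.le).2
    have hzx : dist z x < T.capRadius i z s := by rwa [dist_comm]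
    have h1 : T.d n z x ≤ 2 * (2 * T.factor i z) * dist z x := by
      refine T.d_le_of_arc (by linarith) (by positivity) fun t ht => hfac _ ?_
      rw [dist_comm]
      exact dist_arc_lt (by linarith) ht (by linarith) (by rwa [dist_self]) hzx
    calc _ ≤ 2 * (2 * T.factor i z) * T.capRadius i z s := h1.trans (by gcongr)
      _ = 4 * (T.factor i z * T.capRadius i z s) := by ring
      _ = 8 * bumpConst m * s := by rw [hmul]; ring
      _ ≤ (16 * bumpConst m + 10000 * K * (256 * bumpConst m ^ 2) ^ α) * s := by
          gcongr
          have : 0 ≤ 10000 * K * (256 * bumpConst m ^ 2) ^ α := by positivity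
          linarith
      _ ≤ _ := by gcongr
  · push Not at hcase
    obtain ⟨hne, y, hy, hyc⟩ := hcase
    obtain ⟨-, ha⟩ := hin.resolve_left hne
    have h1 := (harnack hs h hy.le).1
    have h1' := (harnack hs h hy.le).2
    rw [T.factor_eq_of_mem hyc] at h1 h1'
    have h2 := T.d_le i n (x := z) (z := x) (by rw [dist_comm]; linarith)
    have h3 : 4 * 64 ^ i * dist z x ≤ 16 * bumpConst m * s := by
      rw [dist_comm]
      calc 4 * 64 ^ i * dist x z ≤ 4 * (2 * T.factor i z) * T.capRadius i z s := by gcongr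
        _ = 8 * (T.factor i z * T.capRadius i z s) := by ring
        _ = _ := by rw [hmul]; ring
    have h4 : T.tail i ≤ K * ((256 * bumpConst m ^ 2) ^ α * s ^ α) := by
      rw [← Real.mul_rpow (by positivity) hs.le]
      refine (hK i).trans (mul_le_mul_of_nonneg_left ?_ hK0)
      exact Real.rpow_le_rpow (T.a_pos i).le ha.le hα0
    have h5 : 16 * bumpConst m * s ≤ 16 * bumpConst m * s ^ α := by gcongr
    linarith

/-- The conformal metrics have a common contractibility function. -/
theorem exists_isLocalContractibilityFunction [ConnectedSpace (UnitSphere m)] {α K : ℝ}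
    (hα : α ∈ Ioo (0 : ℝ) 1) (hK : ∀ i, T.tail i ≤ K * T.a i ^ α) :
    ∃ C r : ℝ, 0 < C ∧ 0 < r ∧
      ∀ n, IsLocalContractibilityFunction (T.metric n).Space r fun s => C * s ^ α := by
  have hG := one_le_bumpConst m
  have hK0 : 0 ≤ K := by
    have h1 := (T.tail_nonneg 0).trans (hK 0)
    exact nonneg_of_mul_nonneg_left h1 (Real.rpow_pos_of_pos (T.a_pos 0) α)
  set C := 16 * bumpConst m + 10000 * K * (256 * bumpConst m ^ 2) ^ α with hC
  have hC1 : 1 ≤ C := by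
    have : 0 ≤ 10000 * K * (256 * bumpConst m ^ 2) ^ α := by positivity
    linarith
  -- The summand `1` turns the weak bound into the strict one required for open balls.
  refine ⟨C + 1, (16 * bumpConst m)⁻¹, by linarith, by positivity, fun n => ?_⟩
  have hsmall : ∀ {s : ℝ}, s < (16 * bumpConst m)⁻¹ → 16 * bumpConst m * s ≤ 1 := by
    intro s hs
    calc 16 * bumpConst m * s ≤ 16 * bumpConst m * (16 * bumpConst m)⁻¹ := by gcongr
      _ = 1 := mul_inv_cancel₀ (by positivity)
  constructor
  · positivity
  · exact (continuous_const.mul (Real.continuous_rpow_const hα.1.le)).continuousOn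
  · simp [Real.zero_rpow hα.1.ne']
  · intro s hs
    have hs1 : s ≤ 1 := by nlinarith [hsmall hs.2, hs.1]
    have h1 : s ≤ s ^ α := Real.self_le_rpow_of_le_one hs.1 hs1 hα.2.le
    have h2 : 0 ≤ s ^ α := Real.rpow_nonneg hs.1 α
    nlinarith
  · intro (z : UnitSphere m) s hs
    obtain ⟨i, hin, hi, hi'⟩ := T.exists_level n (256 * bumpConst m ^ 2 * s)
    have hsα : 0 < s ^ α := Real.rpow_pos_of_pos hs.1 α
    refine contractibleIn_of_subset_ball (z := z) (τ := T.capRadius i z s) (capRadius_pos hs.1)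
      ((capRadius_le hs.1).trans (by nlinarith [hsmall hs.2, hs.1])) ?_ ?_
    · intro x hx
      have hx' : T.d n z x < s := (T.d_comm n z x).trans_lt hx
      exact dist_lt_capRadius hs.1 hi hin hx'
    · intro x hx
      have h1 := d_le_of_dist_lt_capRadius hs.1 (hsmall hs.2) hi (hi'.imp_right fun h => ⟨hin, h⟩)
        hα.1.le hα.2.le hK hx
      have h2 : T.d n z x < (C + 1) * s ^ α := by linarith
      exact (T.d_comm n x z).trans_lt h2

end CantorTree

/-! ### Hausdorff measure under locally Lipschitz maps. -/

section LocallyLipschitz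

/-- The change of the Hausdorff measure under a locally Lipschitz map. -/
theorem hausdorffMeasure_image_le_of_locally {X Y : Type*} [MetricSpace X] [MeasurableSpace X]
    [BorelSpace X] [SecondCountableTopology X] [MetricSpace Y] [MeasurableSpace Y] [BorelSpace Y]
    {f : X → Y} {K : ℝ≥0} {A : Set X} (hA : MeasurableSet A)
    (h : ∀ x ∈ A, ∃ ε > 0, LipschitzOnWith K f (Metric.ball x ε)) {d : ℝ} (hd : 0 ≤ d) :
    μH[d] (f '' A) ≤ (K : ℝ≥0∞) ^ d * μH[d] A := by
  choose! ε hε hf using h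
  obtain ⟨t, htA, htc, hcov⟩ := TopologicalSpace.countable_cover_nhdsWithin
    (f := fun x => Metric.ball x (ε x)) (s := A)
    fun x hx => mem_nhdsWithin_of_mem_nhds (Metric.ball_mem_nhds x (hε x hx))
  rcases t.eq_empty_or_nonempty with rfl | hne
  · simp only [mem_empty_iff_false, iUnion_of_empty, iUnion_empty, subset_empty_iff] at hcov
    simp [hcov]
  obtain ⟨e, rfl⟩ := htc.exists_eq_range hne
  rw [biUnion_range] at hcov
  -- With disjoint pieces the measures of the parts of `A` add up exactly, and no overlap constant
  -- appears.
  set P : ℕ → Set X := disjointed fun n => Metric.ball (e n) (ε (e n))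
  have hP : ∀ n, MeasurableSet (A ∩ P n) := fun n =>
    hA.inter (MeasurableSet.disjointed (fun _ => Metric.isOpen_ball.measurableSet) n)
  have hAP : A = ⋃ n, A ∩ P n := by
    rw [← inter_iUnion, iUnion_disjointed, inter_eq_left.2 hcov]
  calc μH[d] (f '' A) = μH[d] (⋃ n, f '' (A ∩ P n)) := by rw [← image_iUnion, ← hAP]
    _ ≤ ∑' n, μH[d] (f '' (A ∩ P n)) := measure_iUnion_le _
    _ ≤ ∑' n, (K : ℝ≥0∞) ^ d * μH[d] (A ∩ P n) := by
        refine ENNReal.tsum_le_tsum fun n => ?_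
        refine LipschitzOnWith.hausdorffMeasure_image_le ?_ hd
        exact (hf _ (htA (mem_range_self n))).mono
          (inter_subset_right.trans (disjointed_subset _ n))
    _ = (K : ℝ≥0∞) ^ d * μH[d] A := by
        rw [ENNReal.tsum_mul_left, ← measure_iUnion _ hP, ← hAP]
        exact fun i j hij => (disjoint_disjointed _ hij).mono inter_subset_right inter_subset_right

end LocallyLipschitz

/-! ### Bounded volume and finite Hausdorff measure. -/

namespace CantorTree

variable {m : ℕ} (T : CantorTree m)

theorem exists_hausdorffMeasure_core_le (m : ℕ) : ∃ C : ℝ≥0, ∀ (T : CantorTree m) (j : ℕ),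
    μH[(m : ℝ)] {x : UnitSphere m | ∃ i < T.num j, dist x (T.pt j i) ≤ T.rad j} ≤
      C * ENNReal.ofReal (T.num j * T.rad j ^ m) := by
  obtain ⟨C, hC⟩ := exists_hausdorffMeasure_ball_le m
  refine ⟨C * 2 ^ m, fun T j => ?_⟩
  have hr := T.rad_pos j
  have hr1 := T.rad_le j
  have hsub : {x : UnitSphere m | ∃ i < T.num j, dist x (T.pt j i) ≤ T.rad j} ⊆
      ⋃ i ∈ Finset.range (T.num j), Metric.ball (T.pt j i) (2 * T.rad j) := by
    rintro x ⟨i, hi, hx⟩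
    simp only [mem_iUnion, Finset.mem_range, Metric.mem_ball]
    exact ⟨i, hi, by linarith⟩
  calc _ ≤ ∑ i ∈ Finset.range (T.num j), μH[(m : ℝ)] (Metric.ball (T.pt j i) (2 * T.rad j)) :=
        (measure_mono hsub).trans (measure_biUnion_finset_le _ _)
    _ ≤ ∑ i ∈ Finset.range (T.num j), C * ENNReal.ofReal ((2 * T.rad j) ^ m) :=
        Finset.sum_le_sum fun i _ => hC _ _ (by positivity) (by linarith)
    _ = _ := by
        rw [Finset.sum_const, Finset.card_range, nsmul_eq_mul, mul_pow,
          ENNReal.ofReal_mul (by positivity), ENNReal.ofReal_mul (by positivity),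
          ENNReal.ofReal_pow zero_le_two, ENNReal.ofReal_natCast]
        push_cast
        simp
        ring

theorem ofReal_pow_mul_rad_pow (k j : ℕ) :
    ENNReal.ofReal ((64 ^ (j + k)) ^ m) * ENNReal.ofReal (T.num j * T.rad j ^ m) =
      ENNReal.ofReal ((64 ^ k) ^ m) * ENNReal.ofReal (T.num j * T.a j ^ m) := by
  rw [← ENNReal.ofReal_mul (by positivity), ← ENNReal.ofReal_mul (by positivity),
    ← T.pow_mul_rad j]
  congr 1
  ring

/-- Only the deepest ball containing `x` matters, and the sum over levels has a term dominating its
contribution. Integrated, level `j` contributes a constant times `num j * a j ^ m`. -/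
theorem factor_pow_le (n : ℕ) (x : UnitSphere m) : ENNReal.ofReal (T.factor n x ^ m) ≤
    1 + ∑ j ∈ Finset.range n, indicator
      {x : UnitSphere m | ∃ i < T.num j, dist x (T.pt j i) ≤ T.rad j}
      (fun _ => ENNReal.ofReal ((64 ^ (j + 1)) ^ m)) x := by
  induction n with
  | zero => simp [factor_zero]
  | succ n ih =>
    rw [Finset.sum_range_succ, ← add_assoc]
    by_cases hx : (x : EuclideanSpace ℝ (Fin (m + 1))) ∈ T.core n
    · obtain ⟨i, hi, h⟩ := hx
      have hx' : x ∈ {x : UnitSphere m | ∃ i < T.num n, dist x (T.pt n i) ≤ T.rad n} :=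
        ⟨i, hi, le_of_lt h⟩
      rw [indicator_of_mem hx']
      refine le_add_left (ENNReal.ofReal_le_ofReal ?_)
      exact pow_le_pow_left₀ (T.factor_pos _ _).le (T.factor_le _ _) m
    · rw [T.factor_eq_of_notMem n.le_succ hx]
      exact ih.trans le_self_add

theorem isClosed_closedCore (j : ℕ) :
    IsClosed {x : UnitSphere m | ∃ i < T.num j, dist x (T.pt j i) ≤ T.rad j} := by
  have : {x : UnitSphere m | ∃ i < T.num j, dist x (T.pt j i) ≤ T.rad j} =
      ⋃ i ∈ Finset.range (T.num j), Metric.closedBall (T.pt j i) (T.rad j) := by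
    ext x; simp
  rw [this]
  exact isClosed_biUnion_finset fun i _ => Metric.isClosed_closedBall

theorem notMem_core_of_notMem {j : ℕ} {x : UnitSphere m}
    (hx : x ∉ {x : UnitSphere m | ∃ i < T.num j, dist x (T.pt j i) ≤ T.rad j}) :
    (x : EuclideanSpace ℝ (Fin (m + 1))) ∉ T.core j := by
  rintro ⟨i, hi, h⟩
  exact hx ⟨i, hi, le_of_lt h⟩

theorem tsum_ofReal_lt_top (hsum : Summable fun j => T.num j * T.a j ^ m) :
    ∑' j, ENNReal.ofReal (T.num j * T.a j ^ m) < ⊤ := by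
  rw [← ENNReal.ofReal_tsum_of_nonneg (fun j => ?_) hsum]
  · exact ENNReal.ofReal_lt_top
  · have := T.a_pos j
    positivity

/-- The volumes of the conformal metrics are bounded. -/
theorem exists_volumeMeasure_le (hsum : Summable fun j => T.num j * T.a j ^ m) :
    ∃ V < ⊤, ∀ n, (T.metric n).volumeMeasure univ ≤ V := by
  obtain ⟨C, hC⟩ := exists_volumeMeasure_conformalMetric_le m
  obtain ⟨C', hC'⟩ := exists_hausdorffMeasure_core_le m
  refine ⟨C * (μH[(m : ℝ)] (univ : Set (UnitSphere m)) + C' * (ENNReal.ofReal ((64 ^ 1) ^ m) *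
    ∑' j, ENNReal.ofReal (T.num j * T.a j ^ m))), ?_, fun n => (hC _ _ _).trans ?_⟩
  · exact ENNReal.mul_lt_top ENNReal.coe_lt_top (ENNReal.add_lt_top.2
      ⟨hausdorffMeasure_unitSphere_lt_top m, ENNReal.mul_lt_top ENNReal.coe_lt_top
        (ENNReal.mul_lt_top ENNReal.ofReal_lt_top (T.tsum_ofReal_lt_top hsum))⟩)
  gcongr
  have hmeas : ∀ j, MeasurableSet
      {x : UnitSphere m | ∃ i < T.num j, dist x (T.pt j i) ≤ T.rad j} :=
    fun j => (T.isClosed_closedCore j).measurableSet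
  refine (lintegral_mono (T.factor_pow_le n)).trans ?_
  rw [lintegral_add_left measurable_const, lintegral_const, one_mul,
    lintegral_finsetSum _ fun j _ => measurable_const.indicator (hmeas j)]
  gcongr
  calc _ ≤ ∑ j ∈ Finset.range n, C' * (ENNReal.ofReal ((64 ^ 1) ^ m) *
          ENNReal.ofReal (T.num j * T.a j ^ m)) := by
        refine Finset.sum_le_sum fun j _ => ?_
        rw [lintegral_indicator_const (hmeas j), ← T.ofReal_pow_mul_rad_pow]
        calc _ ≤ ENNReal.ofReal ((64 ^ (j + 1)) ^ m) *
              (C' * ENNReal.ofReal (T.num j * T.rad j ^ m)) := by gcongr; exact hC' T j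
          _ = _ := by ring
    _ ≤ ∑' j, C' * (ENNReal.ofReal ((64 ^ 1) ^ m) * ENNReal.ofReal (T.num j * T.a j ^ m)) :=
        ENNReal.sum_le_tsum _
    _ = _ := by rw [ENNReal.tsum_mul_left, ENNReal.tsum_mul_left]

theorem exists_lipschitzOnWith_toLimit {j : ℕ} {x : UnitSphere m}
    (hx : x ∉ {x : UnitSphere m | ∃ i < T.num j, dist x (T.pt j i) ≤ T.rad j}) :
    ∃ ε > 0, LipschitzOnWith (2 * 64 ^ j) T.toLimit (Metric.ball x ε) := by
  obtain ⟨ε, hε, h⟩ := Metric.isOpen_iff.1 (T.isClosed_closedCore j).isOpen_compl x hx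
  refine ⟨min ε (1 / 2), by positivity, LipschitzOnWith.of_dist_le_mul fun y hy z hz => ?_⟩
  rw [dist_toLimit]
  refine T.limDist_le fun n => ?_
  rw [Metric.mem_ball] at hy hz
  have hyz : dist y z ≤ 1 := by
    have h1 := hy.trans_le (min_le_right _ _)
    have h2 := hz.trans_le (min_le_right _ _)
    linarith [dist_triangle_right y z x]
  push_cast
  refine T.d_le_of_arc hyz (by positivity) fun t ht => T.factor_le_of_notMem n ?_
  refine T.notMem_core_of_notMem (h ?_)
  rw [Metric.mem_ball, dist_comm]
  rw [dist_comm] at hy hz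
  exact (dist_arc_lt hyz ht ((min_le_right _ _).trans (by norm_num)) hy hz).trans_le
    (min_le_left _ _)

/-- The Hausdorff measure of a subset of the Cantor set is controlled by the number of balls that
are needed to cover it. -/
theorem hausdorffMeasure_image_toLimit_le {A : Set (UnitSphere m)} {J : ℕ → ℕ}
    (hJ : Tendsto J atTop atTop) {I : ℕ → Finset ℕ} (hI : ∀ k, ∀ i ∈ I k, i < T.num (J k))
    (hA : ∀ k, ∀ x ∈ A, ∃ i ∈ I k, dist x (T.pt (J k) i) ≤ T.rad (J k)) {B : ℝ}
    (hB : ∀ᶠ k in atTop, (I k).card * T.tail (J k) ^ m ≤ B) :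
    μH[(m : ℝ)] (T.toLimit '' A) ≤ ENNReal.ofReal (4656 ^ m * B) := by
  have htend : Tendsto (fun k => ENNReal.ofReal (4656 * T.tail (J k))) atTop (𝓝 0) := by
    rw [← ENNReal.ofReal_zero, ← mul_zero (4656 : ℝ)]
    exact ENNReal.tendsto_ofReal ((T.tendsto_tail.comp hJ).const_mul _)
  have hdiam : ∀ k, ∀ i : I k,
      Metric.ediam (T.toLimit '' Metric.closedBall (T.pt (J k) i) (T.rad (J k))) ≤
        ENNReal.ofReal (4656 * T.tail (J k)) := by
    intro k i
    refine Metric.ediam_le ?_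
    rintro _ ⟨x, hx, rfl⟩ _ ⟨y, hy, rfl⟩
    rw [edist_dist]
    exact ENNReal.ofReal_le_ofReal (T.limDist_le fun n => T.d_le_tail n (hI k i i.2) hx hy)
  refine (hausdorffMeasure_le_liminf_sum (ι := fun k => I k) (m : ℝ) (T.toLimit '' A) _ htend
    (fun k i => T.toLimit '' Metric.closedBall (T.pt (J k) i) (T.rad (J k)))
    (Eventually.of_forall hdiam) (Eventually.of_forall fun k => ?_)).trans ?_
  · rintro _ ⟨x, hx, rfl⟩
    obtain ⟨i, hi, h⟩ := hA k x hx
    exact mem_iUnion.2 ⟨⟨i, hi⟩, x, h, rfl⟩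
  · refine (liminf_le_liminf ?_).trans (liminf_const (f := (atTop : Filter ℕ)) _).le
    filter_upwards [hB] with k hk
    have ht := T.tail_nonneg (J k)
    calc _ ≤ ∑ i : I k, ENNReal.ofReal (4656 * T.tail (J k)) ^ (m : ℝ) := by
          refine Finset.sum_le_sum fun i _ => ?_
          exact ENNReal.rpow_le_rpow (hdiam k i) (Nat.cast_nonneg m)
      _ = ENNReal.ofReal (4656 ^ m * ((I k).card * T.tail (J k) ^ m)) := by
          rw [Finset.sum_const, Finset.card_univ, Fintype.card_coe, nsmul_eq_mul,
            ENNReal.rpow_natCast, ← ENNReal.ofReal_pow (by positivity), ← ENNReal.ofReal_natCast,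
            ← ENNReal.ofReal_mul (by positivity)]
          congr 1
          ring
      _ ≤ _ := by gcongr

/-- The Cantor set. -/
def cantor : Set (UnitSphere m) :=
  ⋂ j, {x : UnitSphere m | ∃ i < T.num j, dist x (T.pt j i) ≤ T.rad j}

/-- The sphere splits into the complement of the level `0` ball, the differences of consecutive
levels and the Cantor set. The `j`-th difference is mapped with local Lipschitz constant `2 * 64 ^
(j + 1)` and contributes `O(num j * a j ^ m)`. For the Cantor set, good covers along the subsequence
`J` are enough. -/
theorem hausdorffMeasure_limit_lt_top (hsum : Summable fun j => T.num j * T.a j ^ m)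
    {J : ℕ → ℕ} (hJ : Tendsto J atTop atTop) {B : ℝ}
    (hB : ∀ k, T.num (J k) * T.tail (J k) ^ m ≤ B) : μH[(m : ℝ)] (univ : Set T.Limit) < ⊤ := by
  obtain ⟨C, hC⟩ := exists_hausdorffMeasure_core_le m
  set F : ℕ → Set (UnitSphere m) :=
    fun j => {x : UnitSphere m | ∃ i < T.num j, dist x (T.pt j i) ≤ T.rad j} with hF
  have hmeas : ∀ j, MeasurableSet (F j) := fun j => (T.isClosed_closedCore j).measurableSet
  have hcov : (univ : Set T.Limit) ⊆ T.toLimit '' (F 0)ᶜ ∪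
      ((⋃ j, T.toLimit '' (F j \ F (j + 1))) ∪ T.toLimit '' T.cantor) := by
    rw [← image_iUnion, ← image_union, ← image_union, ← T.toLimit.surjective.range_eq,
      ← image_univ]
    refine image_mono fun x _ => ?_
    by_contra hx
    simp only [mem_union, not_or, mem_compl_iff, not_not, mem_iUnion, not_exists, Set.mem_sdiff,
      not_and] at hx
    refine hx.2.2 (mem_iInter.2 fun j => ?_)
    induction j with
    | zero => exact hx.1
    | succ j ih => exact hx.2.1 j ih
  have h0 : μH[(m : ℝ)] (T.toLimit '' (F 0)ᶜ) < ⊤ := by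
    refine (hausdorffMeasure_image_le_of_locally (hmeas 0).compl
      (fun x hx => T.exists_lipschitzOnWith_toLimit hx) (Nat.cast_nonneg m)).trans_lt ?_
    exact ENNReal.mul_lt_top (ENNReal.rpow_lt_top_of_nonneg (Nat.cast_nonneg m)
      ENNReal.coe_ne_top) ((measure_mono (subset_univ _)).trans_lt
        (hausdorffMeasure_unitSphere_lt_top m))
  have h1 : ∀ j, μH[(m : ℝ)] (T.toLimit '' (F j \ F (j + 1))) ≤
      C * (2 ^ m * (ENNReal.ofReal ((64 ^ 1) ^ m) * ENNReal.ofReal (T.num j * T.a j ^ m))) := by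
    intro j
    refine (hausdorffMeasure_image_le_of_locally ((hmeas j).diff (hmeas (j + 1)))
      (fun x hx => T.exists_lipschitzOnWith_toLimit hx.2) (Nat.cast_nonneg m)).trans ?_
    rw [← T.ofReal_pow_mul_rad_pow]
    calc _ ≤ ((2 * 64 ^ (j + 1) : ℝ≥0) : ℝ≥0∞) ^ (m : ℝ) *
          (C * ENNReal.ofReal (T.num j * T.rad j ^ m)) := by
          gcongr
          exact (measure_mono sdiff_subset).trans (hC T j)
      _ = _ := by
          rw [ENNReal.rpow_natCast, ENNReal.ofReal_pow (by positivity),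
            ENNReal.ofReal_pow (by positivity)]
          have e : (128 : ℝ≥0∞) ^ m = 2 ^ m * 64 ^ m := by rw [← mul_pow]; norm_num
          push_cast
          simp only [ENNReal.ofReal_ofNat]
          ring_nf
          rw [e]
          ring
  have h2 : μH[(m : ℝ)] (T.toLimit '' T.cantor) < ⊤ := by
    refine (T.hausdorffMeasure_image_toLimit_le (I := fun k => Finset.range (T.num (J k))) hJ
      (fun k i hi => Finset.mem_range.1 hi) (fun k x hx => ?_)
      (Eventually.of_forall fun k => ?_) (B := B)).trans_lt ENNReal.ofReal_lt_top
    · obtain ⟨i, hi, h⟩ := mem_iInter.1 hx (J k)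
      exact ⟨i, Finset.mem_range.2 hi, h⟩
    · rw [Finset.card_range]
      exact hB k
  refine (measure_mono hcov).trans_lt ((measure_union_le _ _).trans_lt (ENNReal.add_lt_top.2
    ⟨h0, (measure_union_le _ _).trans_lt (ENNReal.add_lt_top.2
      ⟨(measure_iUnion_le _).trans_lt ?_, h2⟩)⟩))
  refine (ENNReal.tsum_le_tsum h1).trans_lt ?_
  rw [ENNReal.tsum_mul_left, ENNReal.tsum_mul_left, ENNReal.tsum_mul_left]
  exact ENNReal.mul_lt_top ENNReal.coe_lt_top (ENNReal.mul_lt_top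
    (by simp) (ENNReal.mul_lt_top ENNReal.ofReal_lt_top (T.tsum_ofReal_lt_top hsum)))

end CantorTree

/-! ### Addresses and positive measure of the Cantor set. -/

namespace CantorTree

variable {m : ℕ} {T : CantorTree m} {c c' : ℕ → ℕ}

theorem IsBranch.tail_le_limDist (hc : T.IsBranch c) {j : ℕ} {x y : UnitSphere m}
    (hx : ∀ n, dist x (T.pt n (c n)) ≤ T.rad n) (hy : T.rad j ≤ dist y (T.pt j (c j))) :
    T.tail j ≤ bumpConst m * T.limDist x y := by
  have hG := one_le_bumpConst m
  refine le_of_tendsto' (T.summable_a_add j).hasSum.tendsto_sum_nat fun k => ?_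
  have h1 := hc.sum_le_d (Nat.le_add_right j k) (hx (j + k)) hy
  rw [Finset.sum_Ico_eq_sum_range, Nat.add_sub_cancel_left] at h1
  simp_rw [add_comm j] at h1
  refine h1.trans ?_
  gcongr
  exact T.d_le_limDist _ x y

/-- Level `0` has a single ball and a level with `b j = 1` only copies indices, so the first
disagreement comes directly after a level with `b j = 2`. -/
theorem IsBranch.exists_branching (hc : T.IsBranch c) (hc' : T.IsBranch c') {J : ℕ}
    (h : c J ≠ c' J) : ∃ j < J, T.b j = 2 ∧ c j = c' j ∧ c (j + 1) ≠ c' (j + 1) := by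
  classical
  have hex : ∃ j, c j ≠ c' j := ⟨J, h⟩
  obtain ⟨j, hj⟩ : ∃ j, Nat.find hex = j + 1 := by
    refine Nat.exists_eq_succ_of_ne_zero fun h0 => ?_
    have h1 := Nat.find_spec hex
    rw [h0] at h1
    have h2 := (hc 0).1
    have h3 := (hc' 0).1
    rw [num_zero] at h2 h3
    omega
  have h1 := Nat.find_spec hex
  have h2 : c j = c' j := not_not.1 (Nat.find_min hex (m := j) (by omega))
  have h3 := Nat.find_min' hex h
  rw [hj] at h1
  refine ⟨j, by omega, ?_, h2, h1⟩
  by_contra hb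
  have h4 : T.b j = 1 := by
    have := T.b_pos j
    have := T.b_le j
    omega
  have h5 := (hc j).2
  have h6 := (hc' j).2
  rw [h4, Nat.div_one] at h5 h6
  exact h1 (by rw [h5, h6, h2])

theorem IsBranch.tail_le_limDist_of_ne (hc : T.IsBranch c) (hc' : T.IsBranch c') {j : ℕ}
    {x y : UnitSphere m} (hx : ∀ n, dist x (T.pt n (c n)) ≤ T.rad n)
    (hy : ∀ n, dist y (T.pt n (c' n)) ≤ T.rad n) (h : c j ≠ c' j) :
    T.tail j ≤ bumpConst m * T.limDist x y := by
  refine hc.tail_le_limDist hx ?_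
  by_contra hlt
  exact h (T.eq_of_dist_le (x := y) (hc j).1 (hc' j).1 (not_le.1 hlt).le (hy j))

theorem IsBranch.exists_mem (hc : T.IsBranch c) :
    ∃ x : UnitSphere m, ∀ n, dist x (T.pt n (c n)) ≤ T.rad n := by
  have h := IsCompact.nonempty_iInter_of_sequence_nonempty_isCompact_isClosed
    (fun n => Metric.closedBall (T.pt n (c n)) (T.rad n)) (fun n x hx => ?_)
    (fun n => ⟨_, Metric.mem_closedBall_self (T.rad_pos n).le⟩)
    (isCompact_closedBall _ _) fun n => Metric.isClosed_closedBall
  · obtain ⟨x, hx⟩ := h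
    exact ⟨x, fun n => mem_iInter.1 hx n⟩
  · have h1 := hc.dist_lt_of_dist_le n.lt_succ_self (x := x) hx
    have h2 : dist x (T.pt n (c n)) < T.rad n / 2 := h1
    rw [Metric.mem_closedBall]
    linarith [T.rad_pos n]

variable (T)

/-- The branch with address `t ∈ [0, 1)`. -/
noncomputable def address (t : ℝ) (j : ℕ) : ℕ := ⌊T.num j * t⌋₊

theorem isBranch_address {t : ℝ} (ht : t ∈ Ico (0 : ℝ) 1) : T.IsBranch (T.address t) := by
  intro j
  have hN : (0 : ℝ) < T.num j := by exact_mod_cast T.num_pos j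
  have hb : (T.b j : ℝ) ≠ 0 := by exact_mod_cast (T.b_pos j).ne'
  constructor
  · rw [address, Nat.floor_lt (mul_nonneg hN.le ht.1)]
    exact mul_lt_of_lt_one_right hN ht.2
  · rw [address, ← Nat.floor_div_natCast, address, num_succ]
    congr 1
    push_cast
    field_simp

theorem abs_sub_le_of_address_eq {s t : ℝ} (hs : 0 ≤ s) (ht : 0 ≤ t) {j : ℕ}
    (h : T.address s j = T.address t j) : |s - t| ≤ 1 / T.num j := by
  have hN : (0 : ℝ) < T.num j := by exact_mod_cast T.num_pos j
  have h1 := Nat.floor_le (mul_nonneg hN.le hs)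
  have h2 := Nat.lt_floor_add_one (T.num j * s)
  have h3 := Nat.floor_le (mul_nonneg hN.le ht)
  have h4 := Nat.lt_floor_add_one (T.num j * t)
  change ⌊T.num j * s⌋₊ = ⌊T.num j * t⌋₊ at h
  rw [h] at h1 h2
  rw [le_div_iff₀ hN, ← abs_of_pos hN, ← abs_mul]
  exact abs_le.2 ⟨by linarith, by linarith⟩

/-- A point of the Cantor set with a given address. -/
noncomputable def addressPoint (t : Ico (0 : ℝ) 1) : UnitSphere m :=
  (T.isBranch_address t.2).exists_mem.choose

theorem dist_addressPoint_le (t : Ico (0 : ℝ) 1) (n : ℕ) :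
    dist (T.addressPoint t) (T.pt n (T.address t n)) ≤ T.rad n :=
  (T.isBranch_address t.2).exists_mem.choose_spec n

theorem addressPoint_mem_cantor (t : Ico (0 : ℝ) 1) : T.addressPoint t ∈ T.cantor :=
  mem_iInter.2 fun n => ⟨_, (T.isBranch_address t.2 n).1, T.dist_addressPoint_le t n⟩

/-- If the branches separate after level `j`, then `|s - t| ≤ 1 / num j`, while the points are at
distance at least `tail (j + 1) / bumpConst m`. The hypothesis on `K` compares these two quantities,
and only at branching levels. -/
theorem abs_sub_le_limDist_pow (hnum : Tendsto T.num atTop atTop) {K : ℝ} (hK0 : 0 ≤ K)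
    (hK : ∀ j, T.b j = 2 → 1 / T.num j ≤ K * T.tail (j + 1) ^ m) (s t : Ico (0 : ℝ) 1) :
    |(s : ℝ) - t| ≤ K * bumpConst m ^ m * T.limDist (T.addressPoint s) (T.addressPoint t) ^ m := by
  have hG := one_le_bumpConst m
  have hd : 0 ≤ T.limDist (T.addressPoint s) (T.addressPoint t) :=
    (T.d_nonneg 0 _ _).trans (T.d_le_limDist 0 _ _)
  by_cases h : ∃ J, T.address s J ≠ T.address t J
  · obtain ⟨J, hJ⟩ := h
    obtain ⟨j, -, hb, hj, hj'⟩ :=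
      (T.isBranch_address s.2).exists_branching (T.isBranch_address t.2) hJ
    have h1 := (T.isBranch_address s.2).tail_le_limDist_of_ne (T.isBranch_address t.2)
      (T.dist_addressPoint_le s) (T.dist_addressPoint_le t) hj'
    calc _ ≤ 1 / (T.num j : ℝ) := T.abs_sub_le_of_address_eq s.2.1 t.2.1 hj
      _ ≤ K * T.tail (j + 1) ^ m := hK j hb
      _ ≤ K * (bumpConst m * T.limDist (T.addressPoint s) (T.addressPoint t)) ^ m := by
          have := T.tail_nonneg (j + 1)
          gcongr
      _ = _ := by ring
  · push Not at h
    have h1 : |(s : ℝ) - t| ≤ 0 := by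
      refine ge_of_tendsto' (tendsto_one_div_atTop_nhds_zero_nat.comp hnum) fun j => ?_
      exact T.abs_sub_le_of_address_eq s.2.1 t.2.1 (h j)
    exact h1.trans (by positivity)

/-- The inverse of the address map is `m`-Hölder onto `[0, 1)`, so the one-dimensional measure of
the interval bounds the `m`-dimensional measure of the Cantor set from below. -/
theorem hausdorffMeasure_cantor_pos (hnum : Tendsto T.num atTop atTop) {K : ℝ} (hK0 : 0 ≤ K)
    (hK : ∀ j, T.b j = 2 → 1 / T.num j ≤ K * T.tail (j + 1) ^ m) :
    0 < μH[(m : ℝ)] (T.toLimit '' T.cantor) := by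
  have hG := one_le_bumpConst m
  have hm : (m : ℝ≥0) ≠ 0 := by have := T.two_le; positivity
  have key := T.abs_sub_le_limDist_pow hnum hK0 hK
  set K' := K * bumpConst m ^ m
  have hK' : 0 ≤ K' := by positivity
  set x : Ico (0 : ℝ) 1 → T.Limit := fun t => T.toLimit (T.addressPoint t)
  have hinj : Function.Injective x := by
    intro s t hst
    have h1 : T.limDist (T.addressPoint s) (T.addressPoint t) = 0 := by
      rw [T.toLimit.injective hst]; exact T.limDist_self _
    have h2 := key s t
    rw [h1, zero_pow (by have := T.two_le; omega), mul_zero] at h2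
    exact Subtype.ext (sub_eq_zero.1 (abs_nonpos_iff.1 h2))
  have hne : Nonempty (Ico (0 : ℝ) 1) := ⟨⟨0, by simp⟩⟩
  set f : T.Limit → ℝ := fun y => ((Function.invFun x y : Ico (0 : ℝ) 1) : ℝ)
  have hfx : ∀ t, f (x t) = t := fun t => by
    change ((Function.invFun x (x t) : Ico (0 : ℝ) 1) : ℝ) = t
    rw [Function.leftInverse_invFun hinj]
  have hhol : HolderOnWith K'.toNNReal m f (range x) := by
    rintro _ ⟨s, rfl⟩ _ ⟨t, rfl⟩
    rw [hfx, hfx, edist_dist, edist_dist, Real.dist_eq, NNReal.coe_natCast, ENNReal.rpow_natCast,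
      ← ENNReal.ofReal_pow dist_nonneg]
    change _ ≤ ENNReal.ofReal K' * _
    rw [← ENNReal.ofReal_mul hK']
    exact ENNReal.ofReal_le_ofReal (key s t)
  have h1 := hhol.hausdorffMeasure_image_le (pos_iff_ne_zero.2 hm) (zero_le_one (α := ℝ))
  have h2 : f '' range x = Ico 0 1 := by
    rw [← range_comp, show f ∘ x = Subtype.val from funext hfx, Subtype.range_coe]
  rw [h2, hausdorffMeasure_real, Real.volume_Ico, mul_one, NNReal.coe_natCast,
    ENNReal.rpow_one] at h1
  have h3 : μH[(m : ℝ)] (range x) ≠ 0 := by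
    intro h0
    rw [h0, mul_zero] at h1
    simp at h1
  refine (pos_iff_ne_zero.2 h3).trans_le (measure_mono ?_)
  rintro _ ⟨t, rfl⟩
  exact ⟨_, T.addressPoint_mem_cantor t, rfl⟩

theorem exists_branch_of_mem_cantor {x : UnitSphere m} (hx : x ∈ T.cantor) :
    ∃ c, T.IsBranch c ∧ ∀ n, dist x (T.pt n (c n)) ≤ T.rad n := by
  have h := mem_iInter.1 hx
  choose c hc hcx using h
  refine ⟨c, fun j => ⟨hc j, ?_⟩, hcx⟩
  refine T.eq_of_dist_le (x := x) (T.div_lt_num (hc (j + 1))) (hc j) ?_ (hcx j)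
  have := T.dist_parent_lt (x := x) (hcx (j + 1))
  linarith [T.rad_pos j]

end CantorTree

/-! ### Packing and non-rectifiability. -/

section Packing

/-- The number of `δ`-separated points in a ball. -/
theorem card_mul_pow_le_of_separated {m : ℕ} {ι : Type*} (I : Finset ι)
    (y : ι → EuclideanSpace ℝ (Fin m)) {R δ : ℝ} (hR : 0 ≤ R) (hδ : 0 < δ) (hδ1 : δ ≤ 1)
    (hy : ∀ i ∈ I, ‖y i‖ < R) (hsep : ∀ i ∈ I, ∀ j ∈ I, i ≠ j → δ ≤ dist (y i) (y j)) :
    I.card * δ ^ m ≤ (2 * (R + 1)) ^ m := by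
  set V : ℝ≥0∞ := volume (Metric.ball (0 : EuclideanSpace ℝ (Fin m)) 1)
  have hV0 : V ≠ 0 := (Metric.measure_ball_pos volume _ one_pos).ne'
  have hV : V ≠ ⊤ := measure_ball_lt_top.ne
  have hball : ∀ (p : EuclideanSpace ℝ (Fin m)) {r : ℝ}, 0 < r →
      volume (Metric.ball p r) = ENNReal.ofReal (r ^ m) * V := fun p r hr => by
    rw [addHaar_ball_of_pos _ _ hr, finrank_euclideanSpace_fin]
  have hdisj : (I : Set ι).PairwiseDisjoint fun i => Metric.ball (y i) (δ / 2) := by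
    intro i hi j hj hij
    refine Metric.ball_disjoint_ball ?_
    have := hsep i hi j hj hij
    linarith
  have hsub : ⋃ i ∈ I, Metric.ball (y i) (δ / 2) ⊆ Metric.ball 0 (R + 1) := by
    refine iUnion₂_subset fun i hi => Metric.ball_subset_ball' ?_
    rw [dist_zero_right]
    linarith [hy i hi]
  have h1 := measure_mono (μ := volume) hsub
  rw [measure_biUnion_finset hdisj fun i _ => measurableSet_ball,
    Finset.sum_congr rfl fun i _ => hball (y i) (half_pos hδ), Finset.sum_const, nsmul_eq_mul,
    hball _ (by linarith), ← mul_assoc, ENNReal.mul_le_mul_iff_left hV0 hV,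
    ← ENNReal.ofReal_natCast, ← ENNReal.ofReal_mul (by positivity),
    ENNReal.ofReal_le_ofReal_iff (by positivity), div_pow, ← mul_div_assoc,
    div_le_iff₀ (by positivity)] at h1
  rw [mul_pow]
  linarith

end Packing

namespace CantorTree

variable {m : ℕ} (T : CantorTree m)

/-- Distinct balls of level `J` separated at a branching level below `J`, so their distance is
governed by the tail at that level and not by the possibly far smaller `tail J`. -/
theorem tail_le_mul_limDist_of_ne {J : ℕ} {δ : ℝ}
    (hδ : ∀ i < J, T.b i = 2 → δ ≤ T.tail (i + 1)) {x x' : UnitSphere m} (hx : x ∈ T.cantor)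
    (hx' : x' ∈ T.cantor) {i i' : ℕ} (hi : i < T.num J) (hi' : i' < T.num J)
    (hxi : dist x (T.pt J i) ≤ T.rad J) (hxi' : dist x' (T.pt J i') ≤ T.rad J) (h : i ≠ i') :
    δ ≤ bumpConst m * T.limDist x x' := by
  obtain ⟨c, hc, hcx⟩ := T.exists_branch_of_mem_cantor hx
  obtain ⟨c', hc', hcx'⟩ := T.exists_branch_of_mem_cantor hx'
  have h1 : c J = i := T.eq_of_dist_le (x := x) (hc J).1 hi (hcx J) hxi
  have h2 : c' J = i' := T.eq_of_dist_le (x := x') (hc' J).1 hi' (hcx' J) hxi'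
  obtain ⟨j, hj, hb, -, hne⟩ := hc.exists_branching hc' (J := J) (by rwa [h1, h2])
  exact (hδ j hj hb).trans (hc.tail_le_limDist_of_ne hc' hcx hcx' hne)

/-- Choosing one point of the set in each ball of level `J k` that meets it, the Lipschitz preimages
are separated by a multiple of `M k * tail (J k)` in a ball of `ℝᵐ`. Packing bounds the number of
balls times `tail (J k) ^ m` by `O((M k) ^ (-m))`, which tends to zero. -/
theorem hausdorffMeasure_cantor_inter_lipschitz_image_eq_zero {J : ℕ → ℕ}
    (hJ : Tendsto J atTop atTop) {M : ℕ → ℝ} (hM0 : ∀ k, 0 < M k) (hM : Tendsto M atTop atTop)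
    (hM1 : ∀ k, M k * T.tail (J k) ≤ 1)
    (hMb : ∀ k, ∀ i < J k, T.b i = 2 → M k * T.tail (J k) ≤ T.tail (i + 1))
    {S : Set (EuclideanSpace ℝ (Fin m))} {f : S → T.Limit} {L : ℝ≥0} (hf : LipschitzWith L f)
    {R : ℝ} (hR : 0 ≤ R) :
    μH[(m : ℝ)] (T.toLimit '' {x | x ∈ T.cantor ∧
      ∃ y : S, ‖(y : EuclideanSpace ℝ (Fin m))‖ < R ∧ f y = T.toLimit x}) = 0 := by
  classical
  have hG := one_le_bumpConst m
  set A := {x | x ∈ T.cantor ∧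
      ∃ y : S, ‖(y : EuclideanSpace ℝ (Fin m))‖ < R ∧ f y = T.toLimit x}
  let I : ℕ → Finset ℕ := fun k => (Finset.range (T.num (J k))).filter
    fun i => ∃ x ∈ A, dist x (T.pt (J k) i) ≤ T.rad (J k)
  -- The maximum ensures `Λ ≥ 1`, so that the separation `M k * tail (J k) / Λ` is at most `1`, as
  -- the packing lemma requires.
  set Λ : ℝ := bumpConst m * max 1 L with hΛ
  have hΛ1 : 1 ≤ Λ := one_le_mul_of_one_le_of_one_le hG (le_max_left _ _)
  have hcard : ∀ k, (I k).card * T.tail (J k) ^ m ≤ (2 * (R + 1) * Λ) ^ m * (M k)⁻¹ ^ m := by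
    intro k
    have hex : ∀ i : I k, ∃ x ∈ T.cantor, ∃ y : S, ‖(y : EuclideanSpace ℝ (Fin m))‖ < R ∧
        f y = T.toLimit x ∧ (i : ℕ) < T.num (J k) ∧ dist x (T.pt (J k) i) ≤ T.rad (J k) := by
      intro i
      obtain ⟨hi, x, ⟨hx, y, hy, hfy⟩, hxi⟩ := Finset.mem_filter.1 i.2
      exact ⟨x, hx, y, hy, hfy, Finset.mem_range.1 hi, hxi⟩
    choose x hx y hy hfy hi hxi using hex
    have hδ : 0 < M k * T.tail (J k) / Λ := by
      have := hM0 k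
      have := T.tail_pos (J k)
      positivity
    have hδ1 : M k * T.tail (J k) / Λ ≤ 1 := by
      rw [div_le_one (by positivity)]
      exact (hM1 k).trans hΛ1
    have hpack := card_mul_pow_le_of_separated Finset.univ (fun i => (y i : EuclideanSpace ℝ (Fin m)))
      hR hδ hδ1 (fun i _ => hy i) (fun i _ i' _ hne => ?_)
    · rw [Finset.card_univ, Fintype.card_coe] at hpack
      have hMk := hM0 k
      have e1 : (2 * (R + 1) * Λ) ^ m * (M k)⁻¹ ^ m = (2 * (R + 1)) ^ m * (Λ / M k) ^ m := by
        rw [div_eq_mul_inv, mul_pow Λ, mul_pow _ Λ, mul_assoc]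
      have e2 : (I k).card * T.tail (J k) ^ m =
          (I k).card * (M k * T.tail (J k) / Λ) ^ m * (Λ / M k) ^ m := by
        rw [mul_assoc, ← mul_pow]
        congr 2
        field_simp
      rw [e1, e2]
      gcongr
    · have h1 := T.tail_le_mul_limDist_of_ne (hMb k) (hx i) (hx i') (hi i) (hi i') (hxi i) (hxi i')
        fun h => hne (Subtype.ext h)
      have h2 := hf.dist_le_mul (y i) (y i')
      rw [hfy, hfy, dist_toLimit, Subtype.dist_eq] at h2
      rw [div_le_iff₀ (by positivity)]
      calc _ ≤ bumpConst m * T.limDist (x i) (x i') := h1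
        _ ≤ bumpConst m * (max 1 L * dist (y i : EuclideanSpace ℝ (Fin m)) (y i')) := by
            refine mul_le_mul_of_nonneg_left (h2.trans ?_) (by linarith)
            exact mul_le_mul_of_nonneg_right (le_max_right _ _) dist_nonneg
        _ = _ := by rw [hΛ]; ring
  have hlim : Tendsto (fun k => (2 * (R + 1) * Λ) ^ m * (M k)⁻¹ ^ m) atTop (𝓝 0) := by
    have h1 := ((tendsto_inv_atTop_zero.comp hM).pow m).const_mul ((2 * (R + 1) * Λ) ^ m)
    rwa [zero_pow (by have := T.two_le; omega), mul_zero] at h1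
  refine nonpos_iff_eq_zero.1 ?_
  have hε : ∀ ε : ℝ, 0 < ε → μH[(m : ℝ)] (T.toLimit '' A) ≤ ENNReal.ofReal (4656 ^ m * ε) := by
    intro ε hε
    refine T.hausdorffMeasure_image_toLimit_le hJ (I := I)
      (fun k i hi => Finset.mem_range.1 (Finset.mem_filter.1 hi).1) (fun k x hx => ?_) ?_
    · obtain ⟨i, hi, hxi⟩ := mem_iInter.1 hx.1 (J k)
      exact ⟨i, Finset.mem_filter.2 ⟨Finset.mem_range.2 hi, x, hx, hxi⟩, hxi⟩
    · filter_upwards [hlim.eventually_le_const hε] with k hk using (hcard k).trans hk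
  have h0 : Tendsto (fun ε : ℝ => ENNReal.ofReal (4656 ^ m * ε)) (𝓝[>] 0) (𝓝 0) := by
    have h1 : Tendsto (fun ε : ℝ => ENNReal.ofReal (4656 ^ m * ε)) (𝓝 0)
        (𝓝 (ENNReal.ofReal (4656 ^ m * 0))) :=
      (ENNReal.continuous_ofReal.comp (continuous_const.mul continuous_id)).tendsto 0
    rw [mul_zero, ENNReal.ofReal_zero] at h1
    exact h1.mono_left nhdsWithin_le_nhds
  refine ge_of_tendsto h0 ?_
  filter_upwards [self_mem_nhdsWithin] with ε hε' using hε ε hε'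

theorem normalizedHausdorff_apply {Z : Type} [MetricSpace Z] [MeasurableSpace Z] [BorelSpace Z]
    (s : Set Z) : normalizedHausdorff m Z s =
      volume (Metric.ball (0 : EuclideanSpace ℝ (Fin m)) 1) / 2 ^ m * μH[(m : ℝ)] s := rfl

theorem normalizing_ne_zero (m : ℕ) :
    volume (Metric.ball (0 : EuclideanSpace ℝ (Fin m)) 1) / 2 ^ m ≠ 0 :=
  ENNReal.div_ne_zero.2 ⟨(Metric.measure_ball_pos volume _ one_pos).ne', by simp⟩

theorem normalizing_lt_top (m : ℕ) :
    volume (Metric.ball (0 : EuclideanSpace ℝ (Fin m)) 1) / 2 ^ m < ⊤ :=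
  ENNReal.div_lt_top measure_ball_lt_top.ne (by simp)

theorem not_isCountablyRectifiable (hpos : 0 < μH[(m : ℝ)] (T.toLimit '' T.cantor)) {J : ℕ → ℕ}
    (hJ : Tendsto J atTop atTop) {M : ℕ → ℝ} (hM0 : ∀ k, 0 < M k) (hM : Tendsto M atTop atTop)
    (hM1 : ∀ k, M k * T.tail (J k) ≤ 1)
    (hMb : ∀ k, ∀ i < J k, T.b i = 2 → M k * T.tail (J k) ≤ T.tail (i + 1)) :
    ¬ IsCountablyRectifiable m (univ : Set T.Limit) := by
  rintro ⟨-, S, f, hf, h0⟩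
  rw [normalizedHausdorff_apply, mul_eq_zero, or_iff_right (normalizing_ne_zero m)] at h0
  refine hpos.ne' (measure_mono_null ?_ (measure_union_null h0 (measure_iUnion_null fun i =>
    measure_iUnion_null fun n : ℕ => T.hausdorffMeasure_cantor_inter_lipschitz_image_eq_zero hJ hM0
      hM hM1 hMb (hf i).choose_spec (R := n) n.cast_nonneg)))
  rintro _ ⟨x, hx, rfl⟩
  by_cases hxf : T.toLimit x ∈ ⋃ i, range (f i)
  · obtain ⟨i, y, hy⟩ := mem_iUnion.1 hxf
    obtain ⟨n, hn⟩ := exists_nat_gt ‖(y : EuclideanSpace ℝ (Fin m))‖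
    exact Or.inr (mem_iUnion.2 ⟨i, mem_iUnion.2 ⟨n, x, ⟨hx, y, hn, hy⟩, rfl⟩⟩)
  · exact Or.inl ⟨trivial, hxf⟩

end CantorTree

/-! ### Sizes with tails `(j + 1) ^ (-P)`. -/

section Sizes

/-- The increments of the sequence `1 / (j + 1) ^ P`. -/
noncomputable def powDiff (P j : ℕ) : ℝ := 1 / ((j : ℝ) + 1) ^ P - 1 / ((j : ℝ) + 2) ^ P

theorem hasSum_powDiff {P : ℕ} (hP : P ≠ 0) (i : ℕ) :
    HasSum (fun j => powDiff P (j + i)) (1 / ((i : ℝ) + 1) ^ P) := by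
  have hlim : Tendsto (fun n : ℕ => 1 / (((n + i : ℕ) : ℝ) + 1) ^ P) atTop (𝓝 0) := by
    have h1 : Tendsto (fun n : ℕ => (1 / ((n : ℝ) + 1)) ^ P) atTop (𝓝 (0 ^ P)) :=
      tendsto_one_div_add_atTop_nhds_zero_nat.pow P
    rw [zero_pow hP] at h1
    simpa only [one_div, inv_pow, Function.comp_def] using h1.comp (tendsto_add_atTop_nat i)
  have hsum : ∀ n, ∑ j ∈ Finset.range n, powDiff P (j + i) =
      1 / ((i : ℝ) + 1) ^ P - 1 / (((n + i : ℕ) : ℝ) + 1) ^ P := by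
    intro n
    have h := Finset.sum_range_sub' (fun j : ℕ => 1 / (((j + i : ℕ) : ℝ) + 1) ^ P) n
    rw [zero_add] at h
    rw [← h]
    refine Finset.sum_congr rfl fun j _ => ?_
    rw [powDiff]
    push_cast
    ring
  rw [hasSum_iff_tendsto_nat_of_nonneg]
  · simp_rw [hsum]
    simpa using tendsto_const_nhds.sub hlim
  · intro j
    rw [powDiff, sub_nonneg]
    exact one_div_le_one_div_of_le (by positivity) (by gcongr; norm_num)

theorem powDiff_le (P j : ℕ) : powDiff P j ≤ P / (((j : ℝ) + 1) ^ P * ((j : ℝ) + 2)) := by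
  have hj : (0 : ℝ) < (j : ℝ) + 2 := by positivity
  have h1 := one_add_mul_le_pow (a := -(1 / ((j : ℝ) + 2))) (by
    have : 1 / ((j : ℝ) + 2) ≤ 1 := by rw [div_le_one hj]; linarith [(j.cast_nonneg : (0 : ℝ) ≤ j)]
    linarith) P
  have h2 : 1 + -(1 / ((j : ℝ) + 2)) = ((j : ℝ) + 1) / ((j : ℝ) + 2) := by field_simp; ring
  rw [h2, div_pow] at h1
  have h3 : (0 : ℝ) < ((j : ℝ) + 1) ^ P := by positivity
  have h4 : powDiff P j = (1 - ((j : ℝ) + 1) ^ P / ((j : ℝ) + 2) ^ P) / ((j : ℝ) + 1) ^ P := by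
    unfold powDiff; field_simp
  rw [h4, div_le_iff₀ h3]
  calc _ ≤ P * (1 / ((j : ℝ) + 2)) := by linarith
    _ = _ := by field_simp

theorem le_powDiff (P j : ℕ) : P / (((j : ℝ) + 2) ^ P * ((j : ℝ) + 1)) ≤ powDiff P j := by
  have hj : (0 : ℝ) < (j : ℝ) + 1 := by positivity
  have h1 := one_add_mul_le_pow (a := 1 / ((j : ℝ) + 1)) (by
    have : 0 ≤ 1 / ((j : ℝ) + 1) := by positivity
    linarith) P
  have h2 : 1 + 1 / ((j : ℝ) + 1) = ((j : ℝ) + 2) / ((j : ℝ) + 1) := by field_simp; ring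
  rw [h2, div_pow] at h1
  have h3 : (0 : ℝ) < ((j : ℝ) + 2) ^ P := by positivity
  have h4 : powDiff P j = (((j : ℝ) + 2) ^ P / ((j : ℝ) + 1) ^ P - 1) / ((j : ℝ) + 2) ^ P := by
    unfold powDiff; field_simp
  rw [h4, le_div_iff₀ h3]
  calc _ = P * (1 / ((j : ℝ) + 1)) := by field_simp
    _ ≤ _ := by linarith

theorem powDiff_pos {P : ℕ} (hP : P ≠ 0) (j : ℕ) : 0 < powDiff P j :=
  lt_of_lt_of_le (by have := Nat.pos_of_ne_zero hP; positivity) (le_powDiff P j)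

/-- The two Bernoulli bounds, taken at consecutive indices, share the factor `(j + 2) ^ P`, so they
can be compared directly. -/
theorem antitone_powDiff (P : ℕ) : Antitone (powDiff P) := by
  refine antitone_nat_of_succ_le fun j => (powDiff_le P (j + 1)).trans (le_trans ?_ (le_powDiff P j))
  push_cast
  rw [show (j : ℝ) + 1 + 1 = j + 2 by ring]
  gcongr <;> linarith

theorem le_powDiff' {P : ℕ} (hP : P ≠ 0) (j : ℕ) :
    1 / (2 * ((j : ℝ) + 1) ^ (P + 1)) ≤ powDiff P j := by
  have h0 : (0 : ℝ) < (j : ℝ) + 1 := by positivity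
  have h1 : (((j : ℝ) + 1) / ((j : ℝ) + 2)) ^ P ≤ ((j : ℝ) + 1) / ((j : ℝ) + 2) :=
    pow_le_of_le_one (by positivity) (by rw [div_le_one (by positivity)]; linarith) hP
  have h4 : powDiff P j = (1 - (((j : ℝ) + 1) / ((j : ℝ) + 2)) ^ P) / ((j : ℝ) + 1) ^ P := by
    unfold powDiff; rw [div_pow]; field_simp
  rw [h4, le_div_iff₀ (by positivity)]
  calc _ = 1 / (2 * ((j : ℝ) + 1)) := by field_simp; ring
    _ ≤ 1 / ((j : ℝ) + 2) := one_div_le_one_div_of_le (by positivity) (by linarith)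
    _ = 1 - ((j : ℝ) + 1) / ((j : ℝ) + 2) := by field_simp; ring
    _ ≤ _ := by linarith

end Sizes

/-! ### Branchings arranged in long blocks. -/

section BranchingNumbers

/-- The index of the block `[2 ^ k ^ 2, 2 ^ (k + 1) ^ 2)` that contains `j`. -/
def blockIndex (j : ℕ) : ℕ := Nat.sqrt (Nat.log 2 j)

theorem monotone_blockIndex : Monotone blockIndex := fun _ _ h =>
  Nat.sqrt_le_sqrt (Nat.log_mono_right h)

theorem blockIndex_lt {j k : ℕ} (hk : k ≠ 0) (h : j < 2 ^ k ^ 2) : blockIndex j < k := by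
  rw [blockIndex, Nat.sqrt_lt']
  exact Nat.log_lt_of_lt_pow' (pow_ne_zero 2 hk) h

theorem two_pow_blockIndex_le {j : ℕ} (hj : j ≠ 0) : 2 ^ blockIndex j ^ 2 ≤ j :=
  (Nat.pow_le_pow_right two_pos (Nat.sqrt_le' _)).trans (Nat.pow_log_le_self 2 hj)

theorem lt_two_pow_blockIndex (j : ℕ) : j < 2 ^ (blockIndex j + 1) ^ 2 :=
  (Nat.lt_pow_succ_log_self one_lt_two j).trans_le
    (Nat.pow_le_pow_right two_pos (Nat.succ_le_of_lt (Nat.lt_succ_sqrt' _)))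

theorem blockIndex_eq {j k : ℕ} (h : 2 ^ k ^ 2 ≤ j) (h' : j < 2 ^ (k + 1) ^ 2) :
    blockIndex j = k := by
  refine le_antisymm (Nat.lt_succ_iff.1 (blockIndex_lt k.succ_ne_zero h')) ?_
  rw [blockIndex, Nat.le_sqrt', Nat.le_log_iff_pow_le one_lt_two]
  · exact h
  · exact (lt_of_lt_of_le (by positivity) h).ne'

/-- The binary logarithm of the number of balls of level `j`: in the `k`-th block there are
branchings until the exponent reaches `Q * (k + 1) ^ 2`. -/
def branchExp (Q : ℕ) : ℕ → ℕ
  | 0 => 0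
  | j + 1 => if branchExp Q j < Q * (blockIndex j + 1) ^ 2 then branchExp Q j + 1
      else branchExp Q j

variable (Q : ℕ)

theorem monotone_branchExp : Monotone (branchExp Q) := by
  refine monotone_nat_of_le_succ fun j => ?_
  rw [branchExp]
  split_ifs <;> omega

theorem branchExp_succ_le (j : ℕ) : branchExp Q (j + 1) ≤ Q * (blockIndex j + 1) ^ 2 := by
  induction j with
  | zero =>
    have h0 : branchExp Q 0 = 0 := rfl
    rw [branchExp]
    split_ifs <;> omega
  | succ j ih =>
    have h1 : Q * (blockIndex j + 1) ^ 2 ≤ Q * (blockIndex (j + 1) + 1) ^ 2 := by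
      have := monotone_blockIndex j.le_succ
      gcongr
    rw [branchExp]
    split_ifs <;> omega

theorem branchExp_le (j : ℕ) : branchExp Q j ≤ Q * (blockIndex j + 1) ^ 2 :=
  (monotone_branchExp Q j.le_succ).trans (branchExp_succ_le Q j)

theorem min_le_branchExp (k n : ℕ) (h : 2 ^ k ^ 2 + n ≤ 2 ^ (k + 1) ^ 2) :
    min (Q * (k + 1) ^ 2) n ≤ branchExp Q (2 ^ k ^ 2 + n) := by
  induction n with
  | zero => simp
  | succ n ih =>
    have h1 := ih (by omega)
    rw [← add_assoc, branchExp, blockIndex_eq (k := k) (by omega) (by omega)]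
    split_ifs <;> omega

/-- A block is normally long enough for the exponent to reach its target. Only the first few may be
too short, and the defect `Q ^ 2` covers them. -/
theorem mul_sq_le_branchExp_two_pow (k : ℕ) : Q * k ^ 2 ≤ branchExp Q (2 ^ k ^ 2) + Q ^ 2 := by
  rcases k with _ | k
  · simp
  have h1 : 2 ^ k ^ 2 * 2 ≤ 2 ^ (k + 1) ^ 2 := by
    rw [← pow_succ]
    exact Nat.pow_le_pow_right two_pos (by rw [add_sq]; omega)
  have h2 := min_le_branchExp Q k (2 ^ (k + 1) ^ 2 - 2 ^ k ^ 2) (by omega)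
  rw [Nat.add_sub_cancel' (by omega)] at h2
  have h3 : ∀ n : ℕ, Q * (n + 1) ≤ 2 ^ n + Q ^ 2 := by
    intro n
    rcases lt_or_ge n Q with hn | hn
    · calc Q * (n + 1) ≤ Q * Q := Nat.mul_le_mul_left Q hn
        _ = Q ^ 2 := (sq Q).symm
        _ ≤ _ := Nat.le_add_left _ _
    · obtain ⟨l, rfl⟩ := Nat.exists_eq_add_of_le hn
      have h4 : Q * (l + 1) ≤ 2 ^ Q * 2 ^ l :=
        Nat.mul_le_mul (Nat.lt_two_pow_self).le (Nat.lt_two_pow_self)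
      rw [pow_add]
      nlinarith
  have h7 : 1 ≤ (k + 1) ^ 2 := Nat.one_le_pow _ _ (Nat.succ_pos k)
  have h5 := h3 ((k + 1) ^ 2 - 1)
  rw [Nat.sub_add_cancel h7] at h5
  have h6 : 2 ^ ((k + 1) ^ 2 - 1) * 2 = 2 ^ (k + 1) ^ 2 := by
    rw [← pow_succ, Nat.sub_add_cancel h7]
  omega

theorem mul_sq_le_branchExp (j : ℕ) : Q * blockIndex j ^ 2 ≤ branchExp Q j + Q ^ 2 := by
  rcases eq_or_ne j 0 with rfl | hj
  · simp [blockIndex]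
  · exact (mul_sq_le_branchExp_two_pow Q _).trans
      (Nat.add_le_add_right (monotone_branchExp Q (two_pow_blockIndex_le hj)) _)

/-- Branching in block `k` happens only within its first `Q * (k + 1) ^ 2` levels, and `(k + 1) ^ 2
≤ 4 * 2 ^ k ^ 2`. Hence branching levels are comparable to the start of their block. -/
theorem add_two_le_of_branching {j : ℕ} (h : branchExp Q j < Q * (blockIndex j + 1) ^ 2) :
    j + 2 ≤ (4 * Q + 3) * 2 ^ blockIndex j ^ 2 := by
  have hpos : 1 ≤ 2 ^ blockIndex j ^ 2 := Nat.one_le_two_pow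
  rcases eq_or_ne j 0 with rfl | hj
  · nlinarith
  obtain ⟨n, hn⟩ := Nat.exists_eq_add_of_le (two_pow_blockIndex_le hj)
  set k := blockIndex j
  have h1 := min_le_branchExp Q k n (by rw [← hn]; exact (lt_two_pow_blockIndex j).le)
  rw [← hn] at h1
  have h2 : n < Q * (k + 1) ^ 2 := by omega
  have h3 : k ^ 2 < 2 ^ k ^ 2 := Nat.lt_two_pow_self
  have h4 : (k + 1) ^ 2 ≤ 4 * 2 ^ k ^ 2 := by
    rcases k.eq_zero_or_pos with h0 | h0
    · simp [h0]
    · nlinarith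
  nlinarith [Nat.mul_le_mul_left Q h4]

/-- As the block index is of order `√(log j)`, the left side grows more slowly than any power of
`j`. The explicit constant comes from `(k - 2 * Q) ^ 2 ≥ 0`. -/
theorem two_pow_sq_le (j : ℕ) :
    (2 ^ (Q * (2 * blockIndex j + 1))) ^ 2 ≤ 2 ^ (4 * Q ^ 2 + 2 * Q) * (j + 1) := by
  have h1 : 2 ^ blockIndex j ^ 2 ≤ j + 1 := by
    rcases eq_or_ne j 0 with rfl | hj
    · simp [blockIndex]
    · exact (two_pow_blockIndex_le hj).trans j.le_succ
  set k := blockIndex j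
  have h2 : Q * (2 * k + 1) * 2 ≤ 4 * Q ^ 2 + 2 * Q + k ^ 2 := by
    zify
    nlinarith [sq_nonneg ((k : ℤ) - 2 * Q)]
  calc _ = 2 ^ (Q * (2 * k + 1) * 2) := (pow_mul _ _ _).symm
    _ ≤ 2 ^ (4 * Q ^ 2 + 2 * Q + k ^ 2) := Nat.pow_le_pow_right two_pos h2
    _ ≤ _ := by rw [pow_add]; gcongr

end BranchingNumbers

/-! ### The tree used in the theorem. -/

section StandardTree

variable {m : ℕ} (hm : 2 ≤ m) {P : ℕ} (hP : P ≠ 0)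

/-- The tree with sizes of order `j ^ (-P-1)`, whose branchings are arranged in long blocks. -/
noncomputable def standardTree : CantorTree m where
  two_le := hm
  frame k := EuclideanSpace.single (Fin.castLE (by omega) k) (1 : ℝ)
  orthonormal_frame :=
    (EuclideanSpace.orthonormal_single).comp _ (Fin.castLE_injective (by omega))
  a j := powDiff P j / 16
  a_pos j := div_pos (powDiff_pos hP j) (by norm_num)
  a_antitone _ _ h := div_le_div_of_nonneg_right (antitone_powDiff P h) (by norm_num)
  a_zero_le := by
    refine div_le_div_of_nonneg_right ?_ (by norm_num)
    have : (0 : ℝ) < 1 / ((0 : ℕ) + 2) ^ P := by positivity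
    simp only [powDiff, Nat.cast_zero, zero_add, one_pow, div_one] at this ⊢
    linarith
  summable_a := ((hasSum_powDiff hP 0).summable).div_const 16
  b j := if branchExp (m * P) j < m * P * (blockIndex j + 1) ^ 2 then 2 else 1
  b_pos j := by split_ifs <;> norm_num
  b_le j := by split_ifs <;> norm_num

theorem num_standardTree (j : ℕ) : (standardTree hm hP).num j = 2 ^ branchExp (m * P) j := by
  induction j with
  | zero => simp [CantorTree.num_zero, branchExp]
  | succ j ih =>
    have hb : (standardTree hm hP).b j =
      if branchExp (m * P) j < m * P * (blockIndex j + 1) ^ 2 then 2 else 1 := rfl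
    rw [CantorTree.num_succ, ih, hb, branchExp]
    split_ifs
    · rw [pow_succ]
    · rw [mul_one]

theorem branching_standardTree {j : ℕ} (h : (standardTree hm hP).b j = 2) :
    branchExp (m * P) j < m * P * (blockIndex j + 1) ^ 2 := by
  by_contra hlt
  have hb : (standardTree hm hP).b j =
    if branchExp (m * P) j < m * P * (blockIndex j + 1) ^ 2 then 2 else 1 := rfl
  rw [hb, if_neg hlt] at h
  omega

theorem tail_standardTree (i : ℕ) :
    (standardTree hm hP).tail i = 1 / (16 * ((i : ℝ) + 1) ^ P) := by
  have h := ((hasSum_powDiff hP i).div_const 16).tsum_eq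
  rw [CantorTree.tail]
  refine h.trans ?_
  rw [div_div, mul_comm]

/-- The tail is of order `i ^ (-P)` and the size of order `i ^ (-(P + 1))`, so the condition on `α`
is exactly a comparison of exponents. -/
theorem tail_standardTree_le {α : ℝ} (hα0 : 0 ≤ α) (hα : α * (P + 1) ≤ P) (i : ℕ) :
    (standardTree hm hP).tail i ≤ 32 ^ α / 16 * (standardTree hm hP).a i ^ α := by
  have hi : (1 : ℝ) ≤ (i : ℝ) + 1 := by linarith [(i.cast_nonneg : (0 : ℝ) ≤ i)]
  have hi0 : (0 : ℝ) < (i : ℝ) + 1 := by linarith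
  have h1 : 1 / (32 * ((i : ℝ) + 1) ^ (P + 1)) ≤ (standardTree hm hP).a i := by
    have h2 : (standardTree hm hP).a i = powDiff P i / 16 := rfl
    rw [h2, le_div_iff₀ (by norm_num)]
    refine le_trans (le_of_eq ?_) (le_powDiff' hP i)
    field_simp
    norm_num
  have h3 : (((i : ℝ) + 1) ^ (P + 1)) ^ α ≤ ((i : ℝ) + 1) ^ P := by
    rw [← Real.rpow_natCast, ← Real.rpow_mul hi0.le, ← Real.rpow_natCast _ P]
    refine Real.rpow_le_rpow_of_exponent_le hi ?_
    push_cast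
    linarith
  have h4 := Real.rpow_le_rpow (by positivity) h1 hα0
  rw [Real.div_rpow zero_le_one (by positivity), Real.one_rpow,
    Real.mul_rpow (by norm_num) (by positivity)] at h4
  rw [tail_standardTree]
  have h32 : (0 : ℝ) < 32 ^ α := by positivity
  calc (1 : ℝ) / (16 * ((i : ℝ) + 1) ^ P) ≤ 1 / (16 * (((i : ℝ) + 1) ^ (P + 1)) ^ α) := by gcongr
    _ = 32 ^ α / 16 * (1 / (32 ^ α * (((i : ℝ) + 1) ^ (P + 1)) ^ α)) := by field_simp
    _ ≤ _ := by gcongr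

theorem tendsto_num_standardTree : Tendsto (standardTree hm hP).num atTop atTop := by
  have hmono : Monotone (standardTree hm hP).num := fun i j h => by
    rw [num_standardTree, num_standardTree]
    exact Nat.pow_le_pow_right two_pos (monotone_branchExp _ h)
  refine tendsto_atTop_atTop_of_monotone hmono fun n => ?_
  have hQ : 1 ≤ m * P := Nat.mul_pos (by omega) (Nat.pos_of_ne_zero hP)
  set Q := m * P
  refine ⟨2 ^ (n + Q ^ 2) ^ 2, ?_⟩
  rw [num_standardTree]
  have h1 := mul_sq_le_branchExp_two_pow Q (n + Q ^ 2)
  have h2 : n + Q ^ 2 ≤ (n + Q ^ 2) ^ 2 := Nat.le_self_pow two_ne_zero _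
  have h3 : (n + Q ^ 2) ^ 2 ≤ Q * (n + Q ^ 2) ^ 2 := Nat.le_mul_of_pos_left _ hQ
  have h4 : branchExp Q (2 ^ (n + Q ^ 2) ^ 2) < 2 ^ branchExp Q (2 ^ (n + Q ^ 2) ^ 2) :=
    Nat.lt_two_pow_self
  change n ≤ 2 ^ branchExp Q (2 ^ (n + Q ^ 2) ^ 2)
  omega

/-- The tails at branching levels are bounded below in terms of the block. -/
theorem le_tail_standardTree {i k : ℕ} (h : (standardTree hm hP).b i = 2) (hk : blockIndex i ≤ k) :
    1 / (16 * ((4 * (m * P : ℕ) + 3) * 2 ^ k ^ 2) ^ P) ≤ (standardTree hm hP).tail (i + 1) := by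
  have h1 := add_two_le_of_branching _ (branching_standardTree hm hP h)
  have h2 : i + 2 ≤ (4 * (m * P) + 3) * 2 ^ k ^ 2 :=
    h1.trans (Nat.mul_le_mul_left _ (Nat.pow_le_pow_right two_pos (Nat.pow_le_pow_left hk 2)))
  have h3 : ((i + 1 : ℕ) : ℝ) + 1 ≤ (4 * (m * P : ℕ) + 3) * 2 ^ k ^ 2 := by
    have : ((i + 2 : ℕ) : ℝ) ≤ (((4 * (m * P) + 3) * 2 ^ k ^ 2 : ℕ) : ℝ) := by exact_mod_cast h2
    push_cast at this ⊢
    linarith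
  rw [tail_standardTree]
  gcongr

/-- At a branching level of block `k`, up to constants, `num` is at least `2 ^ (m * P * k ^ 2)` and
the tail at least `2 ^ (-P * k ^ 2)`. The target exponent `Q = m * P` is chosen to balance the two.
-/
theorem exists_inv_num_standardTree_le : ∃ K, 0 ≤ K ∧ ∀ j, (standardTree hm hP).b j = 2 →
    1 / ((standardTree hm hP).num j : ℝ) ≤ K * (standardTree hm hP).tail (j + 1) ^ m := by
  refine ⟨2 ^ (m * P) ^ 2 * (16 * (4 * (m * P : ℕ) + 3) ^ P) ^ m, by positivity, fun j h => ?_⟩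
  have h1 := le_tail_standardTree hm hP h le_rfl
  have h2 := mul_sq_le_branchExp (m * P) j
  have h3 : (2 : ℝ) ^ (m * P * blockIndex j ^ 2) ≤
      2 ^ branchExp (m * P) j * 2 ^ (m * P) ^ 2 := by
    rw [← pow_add]; exact pow_le_pow_right₀ one_le_two h2
  set D : ℝ := 4 * (m * P : ℕ) + 3
  have hD : 0 < D := by positivity
  have h4 : (16 * D ^ P) ^ m * (1 / (16 * (D * 2 ^ blockIndex j ^ 2) ^ P)) ^ m =
      1 / 2 ^ (m * P * blockIndex j ^ 2) := by
    rw [← mul_pow]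
    have : 16 * D ^ P * (1 / (16 * (D * 2 ^ blockIndex j ^ 2) ^ P)) =
        1 / 2 ^ (blockIndex j ^ 2 * P) := by
      rw [mul_pow, ← pow_mul]; field_simp
    rw [this, div_pow, one_pow, ← pow_mul]
    congr 2
    ring
  calc _ = 1 / (2 : ℝ) ^ branchExp (m * P) j := by rw [num_standardTree]; norm_cast
    _ ≤ 2 ^ (m * P) ^ 2 * (1 / 2 ^ (m * P * blockIndex j ^ 2)) := by
        rw [mul_one_div, div_le_div_iff₀ (by positivity) (by positivity)]
        linarith
    _ = 2 ^ (m * P) ^ 2 * ((16 * D ^ P) ^ m *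
          (1 / (16 * (D * 2 ^ blockIndex j ^ 2) ^ P)) ^ m) := by rw [h4]
    _ ≤ 2 ^ (m * P) ^ 2 * ((16 * D ^ P) ^ m * (standardTree hm hP).tail (j + 1) ^ m) := by gcongr
    _ = _ := by ring

/-- At the end of a block the exponent is at most `m * P * (k + 1) ^ 2`, which the power `tail ^ m`
cancels. Inside a block the product is not claimed to be bounded. -/
theorem num_mul_tail_standardTree_le (k : ℕ) : (standardTree hm hP).num (2 ^ (k + 1) ^ 2) *
    (standardTree hm hP).tail (2 ^ (k + 1) ^ 2) ^ m ≤ 1 := by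
  have hpos : 1 ≤ 2 ^ (k + 1) ^ 2 := Nat.one_le_two_pow
  have h1 : branchExp (m * P) (2 ^ (k + 1) ^ 2) ≤ m * P * (k + 1) ^ 2 := by
    have h2 := branchExp_succ_le (m * P) (2 ^ (k + 1) ^ 2 - 1)
    rw [Nat.sub_add_cancel hpos] at h2
    have h3 : blockIndex (2 ^ (k + 1) ^ 2 - 1) < k + 1 :=
      blockIndex_lt k.succ_ne_zero (by omega)
    exact h2.trans (Nat.mul_le_mul_left _ (Nat.pow_le_pow_left h3 2))
  have h4 : (standardTree hm hP).tail (2 ^ (k + 1) ^ 2) ≤ 1 / 2 ^ ((k + 1) ^ 2 * P) := by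
    rw [tail_standardTree, pow_mul]
    refine one_div_le_one_div_of_le (by positivity) ?_
    push_cast
    have : ((2 : ℝ) ^ (k + 1) ^ 2) ^ P ≤ (2 ^ (k + 1) ^ 2 + 1) ^ P := by gcongr; linarith
    have h0 : (0 : ℝ) ≤ (2 ^ (k + 1) ^ 2 + 1) ^ P := by positivity
    linarith
  calc _ ≤ (2 : ℝ) ^ (m * P * (k + 1) ^ 2) * (1 / 2 ^ ((k + 1) ^ 2 * P)) ^ m := by
        rw [num_standardTree]
        have := (standardTree hm hP).tail_nonneg (2 ^ (k + 1) ^ 2)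
        push_cast
        gcongr
        exact one_le_two
    _ = 1 := by
        rw [div_pow, one_pow, ← pow_mul, show (k + 1) ^ 2 * P * m = m * P * (k + 1) ^ 2 by ring]
        field_simp

/-- The ratios between the tails at branching levels and at the ends of the blocks. -/
theorem gap_standardTree (k : ℕ) {i : ℕ} (hi : i < 2 ^ (k + 1) ^ 2)
    (h : (standardTree hm hP).b i = 2) :
    2 ^ (P * (2 * k + 1)) / (4 * (m * P : ℕ) + 3 : ℝ) ^ P *
      (standardTree hm hP).tail (2 ^ (k + 1) ^ 2) ≤ (standardTree hm hP).tail (i + 1) := by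
  have hk : blockIndex i ≤ k := Nat.lt_succ_iff.1 (blockIndex_lt k.succ_ne_zero hi)
  refine le_trans ?_ (le_tail_standardTree hm hP h hk)
  set D : ℝ := 4 * (m * P : ℕ) + 3
  have hD : 0 < D := by positivity
  have h1 : (2 : ℝ) ^ (P * (2 * k + 1)) * (2 ^ k ^ 2) ^ P = (2 ^ (k + 1) ^ 2) ^ P := by
    rw [← pow_mul, ← pow_mul, ← pow_add]
    congr 1
    ring
  have h2 : ((2 : ℝ) ^ (k + 1) ^ 2) ^ P ≤ (2 ^ (k + 1) ^ 2 + 1) ^ P := by gcongr; linarith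
  rw [tail_standardTree, div_mul_div_comm, div_le_div_iff₀ (by positivity) (by positivity)]
  push_cast
  calc _ = 16 * D ^ P * (2 ^ (P * (2 * k + 1)) * (2 ^ k ^ 2) ^ P) := by rw [mul_pow]; ring
    _ ≤ 16 * D ^ P * (2 ^ (k + 1) ^ 2 + 1) ^ P := by rw [h1]; gcongr
    _ = _ := by ring

theorem gap_mul_tail_standardTree_le_one (k : ℕ) :
    2 ^ (P * (2 * k + 1)) / (4 * (m * P : ℕ) + 3 : ℝ) ^ P *
      (standardTree hm hP).tail (2 ^ (k + 1) ^ 2) ≤ 1 := by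
  have h2 : ((2 : ℝ) ^ (k + 1) ^ 2) ^ P ≤ (2 ^ (k + 1) ^ 2 + 1) ^ P := by gcongr; linarith
  have h3 : (2 : ℝ) ^ (P * (2 * k + 1)) ≤ (2 ^ (k + 1) ^ 2) ^ P := by
    rw [← pow_mul, mul_comm P]
    refine pow_le_pow_right₀ one_le_two (Nat.mul_le_mul_right _ ?_)
    nlinarith [Nat.zero_le (k ^ 2)]
  have h4 : (1 : ℝ) ≤ (4 * (m * P : ℕ) + 3 : ℝ) ^ P :=
    one_le_pow₀ (by linarith [((m * P).cast_nonneg : (0 : ℝ) ≤ (m * P : ℕ))])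
  rw [tail_standardTree, div_mul_div_comm, div_le_one (by positivity), mul_one]
  push_cast at h4 ⊢
  have h5 : (0 : ℝ) < (2 ^ (k + 1) ^ 2 + 1) ^ P := by positivity
  nlinarith

theorem tendsto_gap_standardTree (m : ℕ) {P : ℕ} (hP : P ≠ 0) :
    Tendsto (fun k : ℕ => 2 ^ (P * (2 * k + 1)) / (4 * (m * P : ℕ) + 3 : ℝ) ^ P) atTop atTop := by
  refine Tendsto.atTop_div_const (by positivity) ?_
  refine (tendsto_pow_atTop_atTop_of_one_lt one_lt_two).comp ?_
  refine tendsto_atTop_mono (fun k => ?_) tendsto_id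
  have := Nat.pos_of_ne_zero hP
  simp only [id]
  nlinarith

/-- Against `a j ^ m = O(u ^ (-(m * P) - m))` with `u = j + 1`, the number of balls exceeds `u ^ (m
* P)` by a subpolynomial factor at most, here bounded by a multiple of `√u`. The terms are then `O(u
^ (1 / 2 - m))`, summable because `m ≥ 2`. -/
theorem summable_standardTree : Summable fun j =>
    (standardTree hm hP).num j * (standardTree hm hP).a j ^ m := by
  have hsum : Summable fun j : ℕ => 1 / (((j + 1 : ℕ) : ℝ) ^ (3 / 2 : ℝ)) :=
    (summable_nat_add_iff 1).2 (Real.summable_one_div_nat_rpow.2 (by norm_num))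
  set Q := m * P with hQ
  refine Summable.of_nonneg_of_le (fun j => ?_) (fun j => ?_)
    (hsum.mul_left (P ^ m * √(2 ^ (4 * Q ^ 2 + 2 * Q))))
  · have := (standardTree hm hP).a_pos j
    positivity
  set u : ℝ := (j : ℝ) + 1 with hu
  have hu1 : 1 ≤ u := by linarith [(j.cast_nonneg : (0 : ℝ) ≤ j)]
  have hu0 : 0 < u := by linarith
  have ha : (standardTree hm hP).a j ≤ P / u ^ (P + 1) := by
    have h1 : (standardTree hm hP).a j = powDiff P j / 16 := rfl
    have h2 : (P : ℝ) / (u ^ P * ((j : ℝ) + 2)) ≤ P / u ^ (P + 1) := by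
      rw [pow_succ]
      gcongr
      linarith
    have h3 := powDiff_pos hP j
    rw [h1]
    linarith [(powDiff_le P j).trans h2]
  have hblock : (2 : ℝ) ^ blockIndex j ^ 2 ≤ u := by
    rcases eq_or_ne j 0 with rfl | hj
    · simp [blockIndex, hu]
    · have : ((2 ^ blockIndex j ^ 2 : ℕ) : ℝ) ≤ j := by exact_mod_cast two_pow_blockIndex_le hj
      push_cast at this
      linarith
  have hnum : ((standardTree hm hP).num j : ℝ) ≤ u ^ Q * 2 ^ (Q * (2 * blockIndex j + 1)) := by
    rw [num_standardTree]
    push_cast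
    calc (2 : ℝ) ^ branchExp Q j ≤ 2 ^ (Q * (blockIndex j + 1) ^ 2) :=
          pow_le_pow_right₀ one_le_two (branchExp_le Q j)
      _ = (2 ^ blockIndex j ^ 2) ^ Q * 2 ^ (Q * (2 * blockIndex j + 1)) := by
          rw [← pow_mul, ← pow_add]
          congr 1
          ring
      _ ≤ _ := by gcongr
  have hroot : (2 : ℝ) ^ (Q * (2 * blockIndex j + 1)) ≤ √(2 ^ (4 * Q ^ 2 + 2 * Q)) * √u := by
    rw [← Real.sqrt_mul (by positivity)]
    refine Real.le_sqrt_of_sq_le ?_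
    have : (((2 ^ (Q * (2 * blockIndex j + 1))) ^ 2 : ℕ) : ℝ) ≤
        ((2 ^ (4 * Q ^ 2 + 2 * Q) * (j + 1) : ℕ) : ℝ) := by exact_mod_cast two_pow_sq_le Q j
    push_cast at this
    exact this
  have hpow : √u / u ^ m ≤ 1 / ((j + 1 : ℕ) : ℝ) ^ (3 / 2 : ℝ) := by
    have h1 : ((j + 1 : ℕ) : ℝ) = u := by push_cast; rfl
    have h2 : √u * u ^ (3 / 2 : ℝ) = u ^ 2 := by
      rw [Real.sqrt_eq_rpow, ← Real.rpow_add hu0, ← Real.rpow_natCast]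
      norm_num
    rw [h1, div_le_div_iff₀ (by positivity) (by positivity), h2, one_mul]
    exact pow_le_pow_right₀ hu1 hm
  have ha0 := (standardTree hm hP).a_pos j
  calc _ ≤ u ^ Q * (√(2 ^ (4 * Q ^ 2 + 2 * Q)) * √u) * (P / u ^ (P + 1)) ^ m := by
        gcongr
        exact hnum.trans (by gcongr)
    _ = P ^ m * √(2 ^ (4 * Q ^ 2 + 2 * Q)) * (√u / u ^ m) := by
        rw [div_pow, ← pow_mul, show (P + 1) * m = Q + m by rw [hQ]; ring]
        field_simp
        rw [pow_add]
    _ ≤ _ := by gcongr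

end StandardTree

theorem mainTheorem7 (m : ℕ) (hm : 2 ≤ m) (α : ℝ) (hα : α ∈ Ioo (0 : ℝ) 1) :
    haveI : ConnectedSpace (UnitSphere m) := connectedSpace_unitSphere hm
    ∃ (C r : ℝ) (_ : 0 < C) (_ : 0 < r) (g : ℕ → SmoothMetric m (UnitSphere m)),
      (⨆ n, ((g n).volumeMeasure univ + Metric.ediam (univ : Set (g n).Space))) < ⊤ ∧
      (∀ n, IsLocalContractibilityFunction (g n).Space r (fun s => C * s ^ α)) ∧
      ∃ (X : Type) (_ : MetricSpace X) (_ : CompactSpace X) (_ : Nonempty X)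
        (_ : MeasurableSpace X) (_ : BorelSpace X),
        Tendsto (fun n => GromovHausdorff.ghDist (g n).Space X) atTop (𝓝 0) ∧
        Nonempty (X ≃ₜ UnitSphere m) ∧
        0 < normalizedHausdorff m X univ ∧
        normalizedHausdorff m X univ < ⊤ ∧
        ¬ IsCountablyRectifiable m (univ : Set X) := by
  have : ConnectedSpace (UnitSphere m) := connectedSpace_unitSphere hm
  -- This choice is equivalent to `α * (P + 1) < P`.
  obtain ⟨P, hP⟩ := exists_nat_gt (α / (1 - α))
  have hα1 : 0 < 1 - α := sub_pos.2 hα.2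
  have hP0 : P ≠ 0 := by
    rintro rfl
    have : 0 < α / (1 - α) := div_pos hα.1 hα1
    rw [Nat.cast_zero] at hP
    linarith
  have hαP : α * (P + 1) ≤ P := by
    rw [div_lt_iff₀ hα1] at hP
    linarith
  set T := standardTree hm hP0
  obtain ⟨C, r, hC, hr, hcontr⟩ := T.exists_isLocalContractibilityFunction hα
    (tail_standardTree_le hm hP0 hα.1.le hαP)
  obtain ⟨V, hV, hvol⟩ := T.exists_volumeMeasure_le (summable_standardTree hm hP0)
  obtain ⟨D, -, hdiam⟩ := T.exists_d_le
  obtain ⟨K, hK0, hK⟩ := exists_inv_num_standardTree_le hm hP0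
  have hJ : Tendsto (fun k : ℕ => 2 ^ (k + 1) ^ 2) atTop atTop := by
    refine tendsto_atTop_mono (fun k => ?_) tendsto_id
    have h1 : (k + 1) ^ 2 < 2 ^ (k + 1) ^ 2 := Nat.lt_two_pow_self
    simp only [id]
    nlinarith
  have hpos := T.hausdorffMeasure_cantor_pos (tendsto_num_standardTree hm hP0) hK0 hK
  refine ⟨C, r, hC, hr, T.metric, ?_, hcontr, T.Limit, inferInstance, inferInstance, inferInstance,
    inferInstance, inferInstance, T.tendsto_ghDist, ⟨T.limitHomeo⟩, ?_, ?_, ?_⟩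
  · refine (iSup_le fun n => add_le_add (hvol n) (Metric.ediam_le (d := ENNReal.ofReal D)
      fun x _ y _ => ?_)).trans_lt (ENNReal.add_lt_top.2 ⟨hV, ENNReal.ofReal_lt_top⟩)
    rw [edist_dist]
    exact ENNReal.ofReal_le_ofReal (hdiam n x y)
  · rw [CantorTree.normalizedHausdorff_apply]
    exact ENNReal.mul_pos (CantorTree.normalizing_ne_zero m)
      (hpos.trans_le (measure_mono (subset_univ _))).ne'
  · rw [CantorTree.normalizedHausdorff_apply]
    exact ENNReal.mul_lt_top (CantorTree.normalizing_lt_top m)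
      (T.hausdorffMeasure_limit_lt_top (summable_standardTree hm hP0) hJ
        (num_mul_tail_standardTree_le hm hP0))
  · exact T.not_isCountablyRectifiable hpos hJ (fun k => by positivity)
      (tendsto_gap_standardTree m hP0) (gap_mul_tail_standardTree_le_one hm hP0)
      fun k i hi hb => gap_standardTree hm hP0 k hi hb
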